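/- Let $c_1\in(0,1)$ and $c_2>0$. There is a constant $C>0$, depending only on $c_1$ and $c_2$, with the following property. Let $k>0$ (wave number) and $h>0$ satisfy $kh>\pi/2$ and $k\neq\mu_n:=\frac{(2n-1)\pi}{2h}$ for all $n\ge 1$. Let $\mathbb R^2_h=\{(x_1,x_2):0<x_2<h\}$, $\Gamma_0=\{x_2=0\}$, $\Gamma_h=\{x_2=h\}$. For $y\in\mathbb R^2_h$ let $N(\cdot,y)$ be the waveguide Green function, i.e. the solution of $$\Delta_x N(x,y)+k^2N(x,y)=-\delta_y(x)\ \text{ in }\mathbb R^2_h,\qquad N=0\ \text{ on }\Gamma_0,\qquad \frac{\partial N}{\partial x_2}=0\ \text{ on }\Gamma_h,$$ satisfying the radiation condition that, for every $n\ge1$, the coefficient $u_n(x_1)$ of $\sin(\mu_n x_2)$ in the mode expansion $N(x,y)=\sum_{n\ge1}u_n(x_1)\sin(\mu_nx_2)$ satisfies $\frac{\partial u_n}{\partial|x_1|}-\mathrm i\xi_nu_n\to0$ as $|x_1|\to\infty$, where $\xi_n=\sqrt{k^2-\mu_n^2}$ if $\mu_n<k$ and $\xi_n=\mathrm i\sqrt{\mu_n^2-k^2}$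 if $\mu_n>k$. Let $$G(x,y)=\frac{\mathrm i}{4}H_0^{(1)}(k|x-y|)-\frac{\mathrm i}{4}H_0^{(1)}(k|x-y'|),\qquad y'=(y_1,-y_2),$$ be the Dirichlet Green function of the half-space $x_2>0$, where $H_0^{(1)}$ is the Hankel function of the first kind and order zero. Then for every $y\in\mathbb R^2_h$ the difference $N(\cdot,y)-G(\cdot,y)$ on $\mathbb R^2_h\setminus\{y\}$ extends to a $C^1$ function $S(\cdot,y)$ on $\mathbb R^2_h$. Let moreover $d>0$, $c_0\in(0,1)$ and let $\Omega\subset(-d,d)\times(0,h)$ be such that $$|y_1|\le c_0d,\qquad |y_2|\le c_1h,\qquad k|y_1-z_1|\le c_2\sqrt{kh}\qquad\text{for all }y,z\in\Omega.$$ Then $$|S(x,y)|\le\frac{C}{|\cos(kh)|}\frac1{\sqrt{kh}},\qquad |\nabla_xS(x,y)|\le\frac{Ck}{|\cos(kh)|}\frac1{\sqrt{kh}}\qquad\text{for all }x,y\in\Omega.$$ -/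

import Mathlib

open scoped ContDiff

noncomputable section

namespace Waveguide

/-! Points of the plane are pairs `x = (x.1, x.2)` of real numbers. The norm that Mathlib puts on
`ℝ × ℝ` is never used: Euclidean lengths are written out. -/

/-- The planar waveguide `{(x₁, x₂) : 0 < x₂ < h}` of thickness `h`. -/
def strip (h : ℝ) : Set (ℝ × ℝ) := {x | 0 < x.2 ∧ x.2 < h}

/-- The closed waveguide `{(x₁, x₂) : 0 ≤ x₂ ≤ h}`. -/
def closedStrip (h : ℝ) : Set (ℝ × ℝ) := {x | 0 ≤ x.2 ∧ x.2 ≤ h}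

/-- The Euclidean distance `|x - y|` of two points of the plane. -/
def euclDist (x y : ℝ × ℝ) : ℝ := √((x.1 - y.1) ^ 2 + (x.2 - y.2) ^ 2)

/-- The Laplacian `∂₁²φ + ∂₂²φ`. -/
def laplacian (φ : ℝ × ℝ → ℂ) (x : ℝ × ℝ) : ℂ :=
  iteratedDeriv 2 (fun s : ℝ => φ (s, x.2)) x.1 + iteratedDeriv 2 (fun t : ℝ => φ (x.1, t)) x.2

/-- The Euclidean length `(|∂₁f|² + |∂₂f|²)^(1/2)` of the gradient of `f` at `x`. -/
def gradNorm (f : ℝ × ℝ → ℂ) (x : ℝ × ℝ) : ℝ :=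
  √(‖fderiv ℝ f x (1, 0)‖ ^ 2 + ‖fderiv ℝ f x (0, 1)‖ ^ 2)

/-- The Bessel function `J₀` (Bessel's integral). -/
def besselJ0 (r : ℝ) : ℝ :=
  Real.pi⁻¹ * ∫ θ in (0 : ℝ)..Real.pi, Real.cos (r * Real.sin θ)

/-- The Bessel function of the second kind `Y₀`, on `r > 0` (Schläfli's integral). -/
def besselY0 (r : ℝ) : ℝ :=
  Real.pi⁻¹ * (∫ θ in (0 : ℝ)..Real.pi, Real.sin (r * Real.sin θ)) -
    2 * Real.pi⁻¹ * ∫ t in Set.Ioi (0 : ℝ), Real.exp (-(r * Real.sinh t))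

/-- The Hankel function of the first kind and order zero, `H₀⁽¹⁾ = J₀ + i Y₀`, on `r > 0`. -/
def hankelH0 (r : ℝ) : ℂ := (besselJ0 r : ℂ) + Complex.I * (besselY0 r : ℂ)

/-- The Green function of `Δ + k²` in the half-space `x₂ > 0` with the Dirichlet condition on
`x₂ = 0` and the Sommerfeld radiation condition:
`G(x, y) = (i/4) H₀⁽¹⁾(k|x - y|) - (i/4) H₀⁽¹⁾(k|x - y'|)`, where `y' = (y₁, -y₂)`. -/
def halfSpaceGreen (k : ℝ) (x y : ℝ × ℝ) : ℂ :=
  Complex.I / 4 * hankelH0 (k * euclDist x y) -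
    Complex.I / 4 * hankelH0 (k * euclDist x (y.1, -y.2))

/-- The cut-off frequencies `π/(2h), 3π/(2h), 5π/(2h), …`, numbered from `n = 0`. -/
def cutoff (h : ℝ) (n : ℕ) : ℝ := (2 * n + 1) * Real.pi / (2 * h)

/-- The axial wave number `ξₙ` of the `n`-th mode: `√(k² - μₙ²)` if `μₙ < k` (propagating mode), and
`i √(μₙ² - k²)` if `k < μₙ` (evanescent mode), where `μₙ = cutoff h n`. -/
def axialWaveNumber (k h : ℝ) (n : ℕ) : ℂ :=
  if cutoff h n < k then ((√(k ^ 2 - cutoff h n ^ 2) : ℝ) : ℂ)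
  else Complex.I * ((√(cutoff h n ^ 2 - k ^ 2) : ℝ) : ℂ)

/-- The coefficient `uₙ(x₁)` of the mode expansion `u(x₁, x₂) = ∑ₙ uₙ(x₁) sin (μₙ x₂)`. -/
def modeCoeff (h : ℝ) (u : ℝ × ℝ → ℂ) (n : ℕ) (s : ℝ) : ℂ :=
  (2 / h : ℂ) * ∫ t in (0 : ℝ)..h, u (s, t) * (Real.sin (cutoff h n * t) : ℂ)

/-- The waveguide radiation condition: for each mode,
`∂uₙ/∂|x₁| - i ξₙ uₙ → 0` as `|x₁| → ∞` (in both directions). -/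
def IsRadiating (k h : ℝ) (u : ℝ × ℝ → ℂ) : Prop :=
  ∀ n : ℕ,
    Filter.Tendsto (fun s : ℝ => deriv (modeCoeff h u n) s -
        Complex.I * axialWaveNumber k h n * modeCoeff h u n s) Filter.atTop (nhds 0) ∧
    Filter.Tendsto (fun s : ℝ => -deriv (modeCoeff h u n) s -
        Complex.I * axialWaveNumber k h n * modeCoeff h u n s) Filter.atBot (nhds 0)

/-- Test functions for the waveguide problem: smooth, with compact support in the plane (the
support may meet the walls), `φ = 0` on `x₂ = 0` and `∂φ/∂x₂ = 0` on `x₂ = h`. -/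
structure IsTestFunction (h : ℝ) (φ : ℝ × ℝ → ℂ) : Prop where
  smooth : ContDiff ℝ ∞ φ
  compact_support : HasCompactSupport φ
  dirichlet : ∀ s : ℝ, φ (s, 0) = 0
  neumann : ∀ s : ℝ, deriv (fun t : ℝ => φ (s, t)) h = 0

/-- `u` is the Green function `N(·, y)` of the waveguide with source at `y`, i.e. the radiating
solution of `Δu + k²u = -δ_y` in the waveguide, `u = 0` on `x₂ = 0`, `∂u/∂x₂ = 0` on `x₂ = h`.

The equation is understood in the sense of distributions, up to the walls: for a function `u` that
is regular away from `y` and satisfies the two boundary conditions, Green's formula against a test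
function `φ` as above has no boundary terms and gives `∫ u (Δφ + k²φ) = -φ(y)`. Test functions with
compact support inside the open waveguide are included. -/
structure IsWaveguideGreen (k h : ℝ) (y : ℝ × ℝ) (u : ℝ × ℝ → ℂ) : Prop where
  continuous_off_source : ContinuousOn u (closedStrip h \ {y})
  integrable : ∀ R : ℝ,
    MeasureTheory.IntegrableOn u (Set.Icc (-R) R ×ˢ Set.Icc 0 h) MeasureTheory.volume
  equation : ∀ φ : ℝ × ℝ → ℂ, IsTestFunction h φ →
    ∫ x in strip h, u x * (laplacian φ x + (k : ℂ) ^ 2 * φ x) = -φ y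
  dirichlet : ∀ s : ℝ, u (s, 0) = 0
  neumann : ∀ s : ℝ, HasDerivWithinAt (fun t : ℝ => u (s, t)) 0 (Set.Iic h) h
  radiating : IsRadiating k h u

/-- The geometric conditions on the search domain `Ω ⊆ (-d, d) × (0, h)`. -/
structure CondOmega (k h d c₀ c₁ c₂ : ℝ) (Ω : Set (ℝ × ℝ)) : Prop where
  subset : Ω ⊆ Set.Ioo (-d) d ×ˢ Set.Ioo 0 h
  horizontal : ∀ y ∈ Ω, |y.1| ≤ c₀ * d
  vertical : ∀ y ∈ Ω, |y.2| ≤ c₁ * h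
  width : ∀ y ∈ Ω, ∀ z ∈ Ω, k * |y.1 - z.1| ≤ c₂ * √(k * h)

end Waveguide

end

noncomputable section
namespace Waveguide
open Complex MeasureTheory Set Filter Topology

/-! Representation. Along the path with cosine `c = 1 + ip²` and sine `q = pω(p)` one has `q² + c² =
1` and `dq/c = -2i dp/ω`. The plane-wave representation of the Hankel function becomes `(i/4)
H₀⁽¹⁾(k√(x² + z²)) = (1/2π) ∫ exp(ik(zc - xq))/ω dp` for `z > 0` (`hankelH0_eq_integral_sdExp`),
with Gaussian decay `exp(-kzp²)`. Reflecting the source in both walls and summing the geometric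
series of images suggests that `N - G` is the integral of `-4 exp(2ikhc)/(1 + exp(2ikhc)) ·
sin(kcy₂) sin(kcx₂) exp(-ik(x₁ - y₁)q)/ω`, up to `1/2π`. This closed form is taken as the definition
`regPart`; no series of images is ever summed.

Estimate. The denominator is at least `|cos(kh)|` (`abs_cos_le_norm_periodDenom`). The sines grow at
most like `exp(k(x₂ + y₂)p²)`, which loses against `exp(-2khp²)` because `x₂, y₂ ≤ c₁h`; the
horizontal factor grows at most like `exp(k|x₁ - y₁||p|)`, and `k|x₁ - y₁| ≤ c₂√(kh)`. In the
variable `u = √(kh) p` the integrand is dominated by a fixed Gaussian, and `dp = du/√(kh)` gives the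
rate (`kernelBound_le`, `norm_integral_le_boundIntegral`). A derivative costs one more factor `k`.

Identification. `N` is known only through its equation, wall conditions and radiation condition, so
`N = S + G` is a uniqueness statement, proved mode by mode. Testing the equation with `χ(x₁)
sin(μₙx₂)` shows that each mode of `N` solves a one-dimensional Helmholtz equation with a point
source; the radiation condition then fixes it (`modeCoeff_eq_greenMode`). The modes of `S + G` are
computed by Fubini, the Green function of the cross-section (`integral_sectionGreen_mul_sin`) and a
residue (`integral_mode`), and they agree (`modeCoeff_modelGreen`). Completeness of the sines
(`ae_eq_zero_of_modes_eq_zero`) and continuity off the source conclude (`eq_modelGreen`). -/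

/-! ### The path of steepest descent -/

/-- The cosine `c(p) = 1 + i p²` along the path of steepest descent. -/
def sdCos (p : ℝ) : ℂ := 1 + I * (p : ℂ) ^ 2

/-- The root `ω(p) = √(p² - 2i)`, in the fourth quadrant. -/
def sdRoot (p : ℝ) : ℂ := ((p : ℂ) ^ 2 - 2 * I) ^ ((2 : ℂ)⁻¹)

/-- The sine `q(p) = p ω(p)` along the path of steepest descent: `q² + c² = 1`. -/
def sdSin (p : ℝ) : ℂ := p * sdRoot p

lemma sdRoot_arg_mem_slitPlane (p : ℝ) : ((p : ℂ) ^ 2 - 2 * I) ∈ slitPlane := by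
  right
  simp [pow_two]

lemma sdRoot_sq (p : ℝ) : sdRoot p ^ 2 = (p : ℂ) ^ 2 - 2 * I :=
  cpow_ofNat_inv_pow _ 2

lemma sdRoot_re_pos (p : ℝ) : 0 < (sdRoot p).re := by
  have h0 := slitPlane_ne_zero (sdRoot_arg_mem_slitPlane p)
  rw [sdRoot, cpow_def_of_ne_zero h0, exp_re]
  apply mul_pos (Real.exp_pos _)
  have h1 : (Complex.log ((p : ℂ) ^ 2 - 2 * I) * (2 : ℂ)⁻¹).im
      = arg ((p : ℂ) ^ 2 - 2 * I) / 2 := by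
    have : ((2 : ℂ)⁻¹) = ((2⁻¹ : ℝ) : ℂ) := by norm_num
    rw [this, im_mul_ofReal, log_im]; ring
  rw [h1]
  have h2 := neg_pi_lt_arg ((p : ℂ) ^ 2 - 2 * I)
  have h3 := lt_of_le_of_ne (arg_le_pi ((p : ℂ) ^ 2 - 2 * I))
    (slitPlane_arg_ne_pi (sdRoot_arg_mem_slitPlane p))
  exact Real.cos_pos_of_mem_Ioo ⟨by linarith, by linarith⟩

lemma sdRoot_re_mul_im (p : ℝ) : (sdRoot p).re * (sdRoot p).im = -1 := by
  have h := congrArg Complex.im (sdRoot_sq p)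
  simp [pow_two] at h
  linarith

lemma sdRoot_re_sq_sub (p : ℝ) : (sdRoot p).re ^ 2 - (sdRoot p).im ^ 2 = p ^ 2 := by
  have h := congrArg Complex.re (sdRoot_sq p)
  simp [pow_two] at h
  linarith

lemma sdRoot_im_neg (p : ℝ) : (sdRoot p).im < 0 := by
  have h1 := sdRoot_re_pos p
  have h2 := sdRoot_re_mul_im p
  by_contra h
  nlinarith [mul_nonneg h1.le (not_lt.1 h)]

/-- Both bounds follow from `Re ω · Im ω = -1` and `(Re ω)² - (Im ω)² = p²`: if `Re ω < 1`, then
`|Im ω| > 1` and the difference of squares would be negative. -/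
lemma sdRoot_re_ge (p : ℝ) : 1 ≤ (sdRoot p).re ∧ |p| ≤ (sdRoot p).re := by
  have h1 := sdRoot_re_pos p
  have h2 := sdRoot_re_mul_im p
  have h3 := sdRoot_re_sq_sub p
  constructor
  · by_contra h
    push Not at h
    have : 1 < -(sdRoot p).im := by nlinarith
    nlinarith [sq_nonneg p]
  · exact abs_le_of_sq_le_sq (by nlinarith [sq_nonneg (sdRoot p).im]) h1.le

lemma abs_sdRoot_im_le (p : ℝ) : |(sdRoot p).im| ≤ 1 := by
  have h1 := (sdRoot_re_ge p).1
  have h2 := sdRoot_re_mul_im p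
  have h3 := sdRoot_im_neg p
  rw [abs_of_neg h3]
  nlinarith

lemma abs_sdSin_im_le_abs (p : ℝ) : |(sdSin p).im| ≤ |p| := by
  rw [sdSin, im_ofReal_mul, abs_mul]
  exact mul_le_of_le_one_right (abs_nonneg _) (abs_sdRoot_im_le p)

/-- Since `Im q = -p / Re ω` and `|p| ≤ Re ω`. This uniform bound keeps the horizontal factor
bounded for any fixed `x₁`; the bound by `|p|` above is the one that scales correctly in the final
estimate. -/
lemma abs_sdSin_im_le_one (p : ℝ) : |(sdSin p).im| ≤ 1 := by
  have h1 := (sdRoot_re_ge p).2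
  have h2 := sdRoot_re_mul_im p
  have h3 := sdRoot_im_neg p
  rw [sdSin, im_ofReal_mul, abs_mul, abs_of_neg h3]
  nlinarith

lemma sdRoot_ne_zero (p : ℝ) : sdRoot p ≠ 0 := fun h => by
  have := sdRoot_re_pos p
  simp [h] at this

/-- The decay of `ω⁻¹` supplies half of the integrability in `p` that Fubini's theorem needs near
the height of the source. -/
lemma one_add_sq_le_norm_sdRoot (p : ℝ) : 1 + p ^ 2 ≤ 2 * ‖sdRoot p‖ ^ 2 := by
  rw [← normSq_eq_norm_sq, normSq_apply]
  have h := sdRoot_re_ge p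
  have h2 : p ^ 2 ≤ (sdRoot p).re ^ 2 := sq_le_sq' (by linarith [neg_abs_le p, h.2])
    ((le_abs_self p).trans h.2)
  nlinarith [sq_nonneg (sdRoot p).im]

lemma one_le_norm_sdRoot (p : ℝ) : 1 ≤ ‖sdRoot p‖ :=
  ((sdRoot_re_ge p).1.trans (le_abs_self _)).trans (abs_re_le_norm _)

lemma norm_inv_sdRoot_le_one (p : ℝ) : ‖(sdRoot p)⁻¹‖ ≤ 1 := by
  rw [norm_inv]
  exact inv_le_one_of_one_le₀ (one_le_norm_sdRoot p)

lemma sdRoot_neg (p : ℝ) : sdRoot (-p) = sdRoot p := by simp [sdRoot]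

lemma sdSin_neg (p : ℝ) : sdSin (-p) = -sdSin p := by simp [sdSin, sdRoot_neg]

lemma sdCos_neg (p : ℝ) : sdCos (-p) = sdCos p := by simp [sdCos]

lemma hasDerivAt_sdRoot (p : ℝ) : HasDerivAt sdRoot (p / sdRoot p) p := by
  have h1 : HasDerivAt (fun p : ℝ => (p : ℂ) ^ 2 - 2 * I) (2 * (p : ℂ)) p := by
    have h := ((hasDerivAt_id p).ofReal_comp.fun_pow 2).sub_const (2 * I)
    simpa using h
  have h2 := ((hasDerivAt_id _).cpow_const (c := (2 : ℂ)⁻¹)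
    (sdRoot_arg_mem_slitPlane p)).scomp p h1
  refine h2.congr_deriv ?_
  have h0 := slitPlane_ne_zero (sdRoot_arg_mem_slitPlane p)
  have h3 : ((p : ℂ) ^ 2 - 2 * I) ^ ((2 : ℂ)⁻¹ - 1) = (sdRoot p)⁻¹ := by
    rw [show (2 : ℂ)⁻¹ - 1 = -(2 : ℂ)⁻¹ by norm_num, cpow_neg, sdRoot]
  rw [id, h3, smul_eq_mul]
  field_simp

@[fun_prop]
lemma continuous_sdRoot : Continuous sdRoot :=
  continuous_iff_continuousAt.2 fun p => (hasDerivAt_sdRoot p).continuousAt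

@[fun_prop]
lemma continuous_sdSin : Continuous sdSin := by
  unfold sdSin; fun_prop

@[fun_prop]
lemma continuous_sdCos : Continuous sdCos := by
  unfold sdCos; fun_prop

@[fun_prop]
lemma continuous_inv_sdRoot : Continuous fun p => (sdRoot p)⁻¹ :=
  continuous_sdRoot.inv₀ sdRoot_ne_zero

lemma sdSin_sq (p : ℝ) : sdSin p ^ 2 = 1 - sdCos p ^ 2 := by
  rw [sdSin, mul_pow, sdRoot_sq, sdCos]
  linear_combination (p : ℂ) ^ 4 * I_sq

lemma hasDerivAt_sdSin (p : ℝ) :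
    HasDerivAt sdSin (-2 * I * sdCos p * (sdRoot p)⁻¹) p := by
  have h := (hasDerivAt_id p).ofReal_comp.mul (hasDerivAt_sdRoot p)
  refine h.congr_deriv ?_
  have := sdRoot_ne_zero p
  have h2 := sdRoot_sq p
  simp only [sdCos]
  field_simp
  simp
  linear_combination h2 + 2 * (p : ℂ) ^ 2 * I_sq

lemma hasDerivAt_sdCos (p : ℝ) : HasDerivAt sdCos (2 * I * p) p := by
  have h := (((hasDerivAt_id p).ofReal_comp.pow 2).const_mul I).const_add 1
  refine h.congr_deriv ?_
  simp
  ring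

lemma sdCos_im (p : ℝ) : (sdCos p).im = p ^ 2 := by
  simp [sdCos, pow_two]

lemma sdCos_re (p : ℝ) : (sdCos p).re = 1 := by
  simp [sdCos, pow_two]

lemma norm_sdCos_le (p : ℝ) : ‖sdCos p‖ ≤ 1 + p ^ 2 := by
  refine (norm_add_le _ _).trans ?_
  simp

/-- The exponential `exp (i (z c(p) - x q(p)))`. -/
def sdExp (x z p : ℝ) : ℂ := cexp (I * (z * sdCos p - x * sdSin p))

lemma norm_sdExp (x z p : ℝ) :
    ‖sdExp x z p‖ = Real.exp (x * (sdSin p).im) * Real.exp (-(z * p ^ 2)) := by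
  rw [sdExp, norm_exp, ← Real.exp_add]
  congr 1
  have := sdCos_im p
  simp [this]
  ring

lemma norm_sdExp_le (x z p : ℝ) :
    ‖sdExp x z p‖ ≤ Real.exp |x| * Real.exp (-(z * p ^ 2)) := by
  rw [norm_sdExp]
  refine mul_le_mul_of_nonneg_right (Real.exp_le_exp.2 ?_) (Real.exp_pos _).le
  calc x * (sdSin p).im ≤ |x * (sdSin p).im| := le_abs_self _
    _ = |x| * |(sdSin p).im| := abs_mul _ _
    _ ≤ |x| * 1 := mul_le_mul_of_nonneg_left (abs_sdSin_im_le_one p) (abs_nonneg _)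
    _ = |x| := mul_one _

@[fun_prop]
lemma continuous_sdExp : Continuous fun a : ℝ × ℝ × ℝ => sdExp a.1 a.2.1 a.2.2 := by
  unfold sdExp; fun_prop

lemma integrable_sdExp_div (x : ℝ) {z : ℝ} (hz : 0 < z) :
    Integrable fun p => sdExp x z p * (sdRoot p)⁻¹ := by
  have hg := (integrable_exp_neg_mul_sq hz).const_mul (Real.exp |x|)
  refine hg.mono' (Continuous.aestronglyMeasurable ?_) (ae_of_all _ fun p => ?_)
  · exact (continuous_sdExp.comp (g := fun a : ℝ × ℝ × ℝ => sdExp a.1 a.2.1 a.2.2)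
      (f := fun p : ℝ => (x, z, p)) (by fun_prop)).mul continuous_inv_sdRoot
  · rw [norm_mul]
    calc _ ≤ (Real.exp |x| * Real.exp (-(z * p ^ 2))) * 1 := by
          gcongr
          · exact norm_sdExp_le x z p
          · exact norm_inv_sdRoot_le_one p
      _ = _ := by simp

/-! ### Deformation of paths -/

/-- If `∂f/∂t = ∂e/∂p = D` is continuous, then the change of `∫ f dp` in `t` is a boundary term. -/
lemma integral_sub_of_hasDerivAt_eq {f e D : ℝ → ℝ → ℂ} {a b s t : ℝ}
    (hD : Continuous (Function.uncurry D)) (hf : ∀ t p, HasDerivAt (fun t => f t p) (D t p) t)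
    (he : ∀ t p, HasDerivAt (e t) (D t p) p) :
    ∫ p in a..b, (f t p - f s p) = ∫ t in s..t, (e t b - e t a) := by
  have h1 : ∀ p, f t p - f s p = ∫ t in s..t, D t p := fun p =>
    (intervalIntegral.integral_eq_sub_of_hasDerivAt (fun t _ => hf t p)
      (Continuous.intervalIntegrable (hD.comp (f := fun t => (t, p)) (by fun_prop)) _ _)).symm
  have h2 : ∀ t, e t b - e t a = ∫ p in a..b, D t p := fun t =>
    (intervalIntegral.integral_eq_sub_of_hasDerivAt (fun p _ => he t p)
      (Continuous.intervalIntegrable (hD.comp (f := fun p => (t, p)) (by fun_prop)) _ _)).symm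
  simp_rw [h1, h2]
  rw [MeasureTheory.intervalIntegral_intervalIntegral_swap]
  have h3 : IntegrableOn (Function.uncurry fun p t => D t p) (uIcc a b ×ˢ uIcc s t) :=
    (hD.comp continuous_swap).continuousOn.integrableOn_compact (isCompact_uIcc.prod isCompact_uIcc)
  exact h3.mono_set (Set.prod_mono uIoc_subset_uIcc uIoc_subset_uIcc)

/-- Rotation of the direction of observation does not change the integral of `exp / ω`. -/
lemma integral_sdExp_rotate {R φ : ℝ} (hR : 0 < R) (hφ : |φ| < Real.pi / 2) :
    ∫ p, sdExp (R * Real.sin φ) (R * Real.cos φ) p * (sdRoot p)⁻¹ =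
      ∫ p, sdExp 0 R p * (sdRoot p)⁻¹ := by
  have hcos : ∀ t, |t| ≤ |φ| → Real.cos φ ≤ Real.cos t := fun t ht => by
    rw [← Real.cos_abs φ, ← Real.cos_abs t]
    exact Real.cos_le_cos_of_nonneg_of_le_pi (abs_nonneg _) (by linarith [Real.pi_pos]) ht
  have hcφ : 0 < Real.cos φ := Real.cos_pos_of_mem_Ioo (abs_lt.1 hφ)
  -- With `c = cos ζ` and `q = sin ζ` the phase is `R cos(ζ + t)` and `dζ = -2i dp/ω`: rotating by
  -- `t` translates `ζ`. Hence `∂f/∂t` is the exact `p`-derivative of `e`, with the factor `i/2 =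
  -- 1/(-2i)`.
  let f : ℝ → ℝ → ℂ := fun t p => sdExp (R * Real.sin t) (R * Real.cos t) p * (sdRoot p)⁻¹
  let e : ℝ → ℝ → ℂ := fun t p => I / 2 * sdExp (R * Real.sin t) (R * Real.cos t) p
  let D : ℝ → ℝ → ℂ := fun t p => sdExp (R * Real.sin t) (R * Real.cos t) p *
    (I * R * (-Real.sin t * sdCos p - Real.cos t * sdSin p)) * (sdRoot p)⁻¹
  have hD : Continuous (Function.uncurry D) := by
    have h1 : Continuous fun a : ℝ × ℝ => (sdRoot a.2)⁻¹ :=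
      continuous_inv_sdRoot.comp continuous_snd
    have h2 : Continuous fun a : ℝ × ℝ => sdExp (R * Real.sin a.1) (R * Real.cos a.1) a.2 :=
      continuous_sdExp.comp (f := fun a : ℝ × ℝ => (R * Real.sin a.1, R * Real.cos a.1, a.2))
        (by fun_prop)
    exact (h2.mul (by fun_prop)).mul h1
  have hf : ∀ t p, HasDerivAt (fun t => f t p) (D t p) t := fun t p => by
    have h1 : HasDerivAt (fun t : ℝ => I * (((R * Real.cos t : ℝ) : ℂ) * sdCos p -
        ((R * Real.sin t : ℝ) : ℂ) * sdSin p))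
        (I * (((R * -Real.sin t : ℝ) : ℂ) * sdCos p -
        ((R * Real.cos t : ℝ) : ℂ) * sdSin p)) t :=
      (((((Real.hasDerivAt_cos t).const_mul R).ofReal_comp).mul_const _).sub
        ((((Real.hasDerivAt_sin t).const_mul R).ofReal_comp).mul_const _)).const_mul I
    refine (h1.cexp.mul_const (sdRoot p)⁻¹).congr_deriv ?_
    simp only [D, sdExp]
    push_cast
    ring
  have he : ∀ t p, HasDerivAt (e t) (D t p) p := fun t p => by
    have h1 := (((hasDerivAt_sdCos p).const_mul ((R * Real.cos t : ℝ) : ℂ)).sub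
      ((hasDerivAt_sdSin p).const_mul ((R * Real.sin t : ℝ) : ℂ))).const_mul I
    refine (h1.cexp.const_mul (I / 2)).congr_deriv ?_
    simp only [D, sdExp, Pi.sub_apply, sdSin]
    have := sdRoot_ne_zero p
    push_cast
    field_simp
    ring_nf
    simp only [I_sq]
    ring
  have hint : ∀ t, |t| < Real.pi / 2 → Integrable (f t) := fun t ht =>
    integrable_sdExp_div _ (mul_pos hR (Real.cos_pos_of_mem_Ioo (abs_lt.1 ht)))
  have h0 : Integrable (f 0) := hint 0 (by simp [Real.pi_pos])
  have hφi : Integrable (f φ) := hint φ hφ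
  have hlim : Tendsto (fun n : ℝ => ∫ p in (-n)..n, (f φ p - f 0 p)) atTop
      (𝓝 (∫ p, (f φ p - f 0 p))) :=
    intervalIntegral_tendsto_integral (hφi.sub h0) tendsto_neg_atTop_atBot tendsto_id
  -- The boundary terms at `p = ±n` vanish in the limit: between the directions `0` and `φ` the
  -- cosine stays above `cos φ > 0`, so the Gaussian decay is uniform in `t`.
  have hlim0 : Tendsto (fun n : ℝ => ∫ p in (-n)..n, (f φ p - f 0 p)) atTop (𝓝 0) := by
    have hb : ∀ n : ℝ, ‖∫ p in (-n)..n, (f φ p - f 0 p)‖ ≤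
        Real.exp R * Real.exp (-(R * Real.cos φ * n ^ 2)) * |φ - 0| := fun n => by
      rw [integral_sub_of_hasDerivAt_eq hD hf he]
      refine intervalIntegral.norm_integral_le_of_norm_le_const fun t ht => ?_
      have ht' : |t| ≤ |φ| := by
        have := abs_sub_left_of_mem_uIcc (uIoc_subset_uIcc ht)
        simpa using this
      have hn : ∀ m : ℝ, m ^ 2 = n ^ 2 → ‖e t m‖ ≤
          Real.exp R * Real.exp (-(R * Real.cos φ * n ^ 2)) / 2 := fun m hm => by
        simp only [e, norm_mul]
        have h1 := norm_sdExp_le (R * Real.sin t) (R * Real.cos t) m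
        have h2 : Real.exp |R * Real.sin t| ≤ Real.exp R := by
          apply Real.exp_le_exp.2
          rw [abs_mul, abs_of_pos hR]
          exact mul_le_of_le_one_right hR.le (Real.abs_sin_le_one t)
        have h3 : Real.exp (-(R * Real.cos t * m ^ 2)) ≤
            Real.exp (-(R * Real.cos φ * n ^ 2)) := by
          rw [hm]
          have := hcos t ht'
          gcongr
        have h4 : ‖I / 2‖ = 1 / 2 := by simp
        rw [h4]
        have h5 := mul_le_mul h2 h3 (Real.exp_pos _).le (Real.exp_pos _).le
        linarith
      refine (norm_sub_le _ _).trans ?_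
      linarith [hn n rfl, hn (-n) (by ring)]
    refine squeeze_zero_norm hb ?_
    have h1 : Tendsto (fun n : ℝ => R * Real.cos φ * n ^ 2) atTop atTop :=
      (tendsto_pow_atTop two_ne_zero).const_mul_atTop (mul_pos hR hcφ)
    have h2 := ((Real.tendsto_exp_neg_atTop_nhds_zero.comp h1).const_mul
      (Real.exp R)).mul_const |φ - 0|
    simpa using h2
  have h := tendsto_nhds_unique hlim hlim0
  rw [integral_sub hφi h0, sub_eq_zero] at h
  simpa [f] using h

/-! ### The Hankel function as an integral along the path of steepest descent -/

/-- The integrand `exp(i r u) / √(1 - u²)`. -/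
def hankelIntegrand (r : ℝ) (u : ℂ) : ℂ := cexp (I * r * u) * ((1 - u ^ 2) ^ (2 : ℂ)⁻¹)⁻¹

/-- The real part of `1 - u²` is positive there. The region contains the half strip up to and
including the line `Re u = 1`, except for the branch point `u = 1`. -/
lemma one_sub_sq_mem_slitPlane {a y : ℝ} (h : a ^ 2 < 1 + y ^ 2) :
    1 - ((a : ℂ) + y * I) ^ 2 ∈ slitPlane := by
  left
  simp [pow_two]
  nlinarith

lemma differentiableAt_hankelIntegrand (r : ℝ) {u : ℂ} (h : 1 - u ^ 2 ∈ slitPlane) :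
    DifferentiableAt ℂ (hankelIntegrand r) u := by
  have h1 : DifferentiableAt ℂ (fun u : ℂ => (1 - u ^ 2) ^ (2 : ℂ)⁻¹) u :=
    (((differentiableAt_id.pow 2).const_sub 1).cpow_const h)
  have h2 : (1 - u ^ 2) ^ (2 : ℂ)⁻¹ ≠ 0 := by
    rw [Ne, cpow_eq_zero_iff]
    exact fun h' => slitPlane_ne_zero h h'.1
  exact ((differentiableAt_id.const_mul (I * r)).cexp).mul (h1.inv h2)

/-- From `1 - u² = (1 - u)(1 + u)` with `|1 - u| ≥ y` and `|1 + u| ≥ 1`. The bound is independent of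
`a`, hence dominates in the limit `a → 1`, and its singularity `y^(-1/2)` is integrable. -/
lemma norm_hankelIntegrand_le {r : ℝ} {a y : ℝ} (ha : 0 ≤ a) (hy : 0 < y) :
    ‖hankelIntegrand r (a + y * I)‖ ≤ Real.exp (-(r * y)) * y ^ (-(1 / 2) : ℝ) := by
  rw [hankelIntegrand, norm_mul, norm_inv, norm_exp]
  have h1 : (I * r * ((a : ℂ) + y * I)).re = -(r * y) := by simp
  rw [h1]
  gcongr
  have h2 : (2 : ℂ)⁻¹ = ((1 / 2 : ℝ) : ℂ) := by norm_num
  rw [h2, norm_cpow_real, Real.rpow_neg hy.le]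
  gcongr
  have h3 : (1 : ℂ) - ((a : ℂ) + y * I) ^ 2 = (1 - (a + y * I)) * (1 + (a + y * I)) := by ring
  rw [h3, norm_mul]
  have h4 : y ≤ ‖(1 : ℂ) - (a + y * I)‖ := by
    refine le_trans ?_ (abs_im_le_norm _)
    simp [abs_of_pos hy]
  have h5 : 1 ≤ ‖(1 : ℂ) + (a + y * I)‖ := by
    refine le_trans ?_ (abs_re_le_norm _)
    simp
    rw [abs_of_nonneg (by linarith)]
    linarith
  nlinarith

lemma integrableOn_hankelBound {r : ℝ} (hr : 0 < r) :
    IntegrableOn (fun y : ℝ => Real.exp (-(r * y)) * y ^ (-(1 / 2) : ℝ)) (Ioi 0) := by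
  have h := integrableOn_rpow_mul_exp_neg_mul_rpow (p := 1) (s := -(1 / 2)) (by norm_num)
    one_pos hr
  refine h.congr_fun (fun y _ => ?_) measurableSet_Ioi
  simp [mul_comm]

lemma aestronglyMeasurable_hankelIntegrand (r : ℝ) {a : ℝ} (ha : a ≤ 1) (ha0 : 0 ≤ a) :
    AEStronglyMeasurable (fun y : ℝ => hankelIntegrand r (a + y * I))
      (volume.restrict (Ioi 0)) := by
  refine ContinuousOn.aestronglyMeasurable (fun y hy => ?_) measurableSet_Ioi
  have hy : 0 < y := hy
  have h1 := (differentiableAt_hankelIntegrand r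
    (one_sub_sq_mem_slitPlane (a := a) (y := y) (by nlinarith))).continuousAt
  exact (ContinuousAt.comp (f := fun y : ℝ => (a : ℂ) + y * I) h1
    (by fun_prop)).continuousWithinAt

lemma integrableOn_hankelIntegrand {r : ℝ} (hr : 0 < r) {a : ℝ} (ha : a ≤ 1) (ha0 : 0 ≤ a) :
    IntegrableOn (fun y : ℝ => hankelIntegrand r (a + y * I)) (Ioi 0) :=
  (integrableOn_hankelBound hr).mono' (aestronglyMeasurable_hankelIntegrand r ha ha0)
    ((ae_restrict_iff' measurableSet_Ioi).2 (ae_of_all _ fun _ hy =>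
      norm_hankelIntegrand_le ha0 hy))

/-- Cauchy's theorem for `exp(i r u) / √(1 - u²)` on the half strip `0 ≤ Re u ≤ a`. -/
lemma hankelIntegrand_halfStrip {r : ℝ} (hr : 0 < r) {a : ℝ} (ha : a < 1) (ha0 : 0 ≤ a) :
    (∫ x in (0 : ℝ)..a, hankelIntegrand r x) - I * (∫ y in Ioi (0 : ℝ), hankelIntegrand r (y * I))
      = -I * ∫ y in Ioi (0 : ℝ), hankelIntegrand r (a + y * I) := by
  have h1 : ∀ M : ℝ, (∫ x in (0 : ℝ)..a, hankelIntegrand r x) -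
      (∫ x in (0 : ℝ)..a, hankelIntegrand r (x + M * I)) +
      I * (∫ y in (0 : ℝ)..M, hankelIntegrand r (a + y * I)) -
      I * (∫ y in (0 : ℝ)..M, hankelIntegrand r (y * I)) = 0 := fun M => by
    have h := integral_boundary_rect_eq_zero_of_differentiableOn (hankelIntegrand r) 0
      (a + M * I) (fun u hu => by
        refine (differentiableAt_hankelIntegrand r ?_).differentiableWithinAt
        have hu1 := hu.1
        simp [uIcc_of_le ha0] at hu1
        rw [← re_add_im u]
        exact one_sub_sq_mem_slitPlane (by nlinarith [sq_nonneg u.im]))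
    simpa using h
  have hz := intervalIntegral_tendsto_integral_Ioi 0
    (integrableOn_hankelIntegrand hr (a := 0) zero_le_one le_rfl) tendsto_id
  have hA := intervalIntegral_tendsto_integral_Ioi 0
    (integrableOn_hankelIntegrand hr ha.le ha0) tendsto_id
  -- The top edge of the rectangle contributes at most `a M^(-1/2)`.
  have htop : Tendsto (fun M : ℝ => ∫ x in (0 : ℝ)..a, hankelIntegrand r (x + M * I)) atTop
      (𝓝 0) := by
    have hb : ∀ᶠ M : ℝ in atTop, ‖∫ x in (0 : ℝ)..a, hankelIntegrand r (x + M * I)‖ ≤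
        M ^ (-(1 / 2) : ℝ) * |a - 0| := by
      filter_upwards [eventually_gt_atTop 0] with M hM
      refine intervalIntegral.norm_integral_le_of_norm_le_const fun x hx => ?_
      rw [uIoc_of_le ha0] at hx
      refine (norm_hankelIntegrand_le hx.1.le hM).trans ?_
      refine mul_le_of_le_one_left (by positivity) ?_
      rw [Real.exp_le_one_iff]
      nlinarith
    refine squeeze_zero_norm' hb ?_
    simpa using (tendsto_rpow_neg_atTop (y := 1 / 2) (by norm_num)).mul_const |a - 0|
  have hlim := (((tendsto_const_nhds (x := ∫ x in (0 : ℝ)..a, hankelIntegrand r x)).sub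
    htop).add (hA.const_mul I)).sub (hz.const_mul I)
  simp only [ofReal_zero, zero_add, id, h1] at hlim
  have := tendsto_nhds_unique hlim tendsto_const_nhds
  linear_combination this

lemma hankelIntegrand_sin (r : ℝ) {θ : ℝ} (h0 : 0 < Real.cos θ) :
    hankelIntegrand r (Real.sin θ) = cexp (I * r * Real.sin θ) * ((Real.cos θ : ℝ) : ℂ)⁻¹ := by
  rw [hankelIntegrand]
  have h : (1 : ℂ) - ((Real.sin θ : ℝ) : ℂ) ^ 2 = ((Real.cos θ : ℝ) : ℂ) ^ 2 := by
    rw [← ofReal_pow, ← ofReal_pow, Real.cos_sq']; simp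
  rw [h, sq_cpow_two_inv (by rwa [ofReal_re])]

lemma integral_hankelIntegrand_sin (r : ℝ) {α : ℝ} (h0 : 0 ≤ α) (h1 : α < Real.pi / 2) :
    ∫ x in (0 : ℝ)..Real.sin α, hankelIntegrand r x =
      ∫ θ in (0 : ℝ)..α, cexp (I * r * Real.sin θ) := by
  have hmem : ∀ θ ∈ uIcc 0 α, 0 < Real.cos θ := fun θ hθ => by
    rw [uIcc_of_le h0] at hθ
    exact Real.cos_pos_of_mem_Ioo ⟨by linarith [Real.pi_pos, hθ.1], by linarith [hθ.2]⟩
  have h := intervalIntegral.integral_deriv_smul_comp' (a := 0) (b := α) (f := Real.sin)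
    (f' := Real.cos) (g := fun x : ℝ => hankelIntegrand r x)
    (fun θ _ => Real.hasDerivAt_sin θ) Real.continuous_cos.continuousOn (by
      rintro _ ⟨θ, hθ, rfl⟩
      have h2 := (differentiableAt_hankelIntegrand r (one_sub_sq_mem_slitPlane
        (a := Real.sin θ) (y := 0) (by nlinarith [hmem θ hθ, Real.sin_sq_add_cos_sq θ])))
      simp only [ofReal_zero, zero_mul, add_zero] at h2
      exact (ContinuousAt.comp (f := fun x : ℝ => (x : ℂ)) h2.continuousAt
        (by fun_prop)).continuousWithinAt)
  rw [Real.sin_zero] at h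
  rw [← h]
  refine intervalIntegral.integral_congr fun θ hθ => ?_
  have hc := hmem θ hθ
  simp only [Function.comp, hankelIntegrand_sin r hc, real_smul]
  have : ((Real.cos θ : ℝ) : ℂ) ≠ 0 := ofReal_ne_zero.2 hc.ne'
  field_simp

lemma integral_hankelIntegrand_sinh (r : ℝ) :
    ∫ y in Ioi (0 : ℝ), hankelIntegrand r (y * I) =
      ((∫ t in Ioi (0 : ℝ), Real.exp (-(r * Real.sinh t)) : ℝ) : ℂ) := by
  have himg : Real.sinh '' Ioi 0 = Ioi 0 := by
    ext y
    constructor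
    · rintro ⟨t, ht, rfl⟩
      exact Real.sinh_pos_iff.2 ht
    · intro hy
      exact ⟨Real.arsinh y, Real.arsinh_pos_iff.2 hy, Real.sinh_arsinh y⟩
  have h := integral_image_eq_integral_abs_deriv_smul (s := Ioi (0 : ℝ)) measurableSet_Ioi
    (fun t _ => (Real.hasDerivAt_sinh t).hasDerivWithinAt)
    Real.sinh_injective.injOn (fun y : ℝ => hankelIntegrand r (y * I))
  rw [himg] at h
  rw [h, ← integral_complex_ofReal]
  refine setIntegral_congr_fun measurableSet_Ioi fun t _ => ?_
  have hc := Real.cosh_pos t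
  have hs : (1 : ℂ) - (((Real.sinh t : ℝ) : ℂ) * I) ^ 2 = ((Real.cosh t : ℝ) : ℂ) ^ 2 := by
    rw [mul_pow, I_sq, ← ofReal_pow, ← ofReal_pow, Real.cosh_sq]; push_cast; ring
  simp only [hankelIntegrand, hs]
  rw [sq_cpow_two_inv (by rwa [ofReal_re]), abs_of_pos hc, real_smul]
  have : ((Real.cosh t : ℝ) : ℂ) ≠ 0 := ofReal_ne_zero.2 hc.ne'
  have he : I * r * (((Real.sinh t : ℝ) : ℂ) * I) = ((-(r * Real.sinh t) : ℝ) : ℂ) := by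
    push_cast
    linear_combination (r : ℂ) * Complex.sinh t * I_sq
  rw [he, ofReal_exp]
  field_simp

/-- The half strip cannot be taken with `a = 1` at once, because of the branch point. With `a = sin
α` and `α → π/2`, the real edge becomes Bessel's integral, the imaginary edge is Schläfli's, and the
right edge converges by domination. -/
lemma integral_hankelIntegrand_one {r : ℝ} (hr : 0 < r) :
    (∫ θ in (0 : ℝ)..(Real.pi / 2), cexp (I * r * Real.sin θ)) -
      I * ((∫ t in Ioi (0 : ℝ), Real.exp (-(r * Real.sinh t)) : ℝ) : ℂ)
      = -I * ∫ y in Ioi (0 : ℝ), hankelIntegrand r (1 + y * I) := by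
  have hcont : Continuous fun α : ℝ => ∫ θ in (0 : ℝ)..α, cexp (I * r * Real.sin θ) :=
    intervalIntegral.continuous_primitive
      (fun a b => Continuous.intervalIntegrable (by fun_prop) a b) 0
  have hev : ∀ᶠ α in 𝓝[<] (Real.pi / 2), 0 ≤ α ∧ α < Real.pi / 2 := by
    filter_upwards [Ioo_mem_nhdsLT (show (0 : ℝ) < Real.pi / 2 by positivity)] with α hα
    exact ⟨hα.1.le, hα.2⟩
  have hsin : ∀ α : ℝ, 0 ≤ α ∧ α < Real.pi / 2 → 0 ≤ Real.sin α ∧ Real.sin α < 1 := fun α hα =>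
    ⟨Real.sin_nonneg_of_nonneg_of_le_pi hα.1 (by linarith [Real.pi_pos, hα.2]), by
      rw [← Real.sin_pi_div_two]
      exact Real.sin_lt_sin_of_lt_of_le_pi_div_two (by linarith [Real.pi_pos, hα.1]) le_rfl hα.2⟩
  have h1 : Tendsto (fun α : ℝ => (∫ θ in (0 : ℝ)..α, cexp (I * r * Real.sin θ)) -
      I * ((∫ t in Ioi (0 : ℝ), Real.exp (-(r * Real.sinh t)) : ℝ) : ℂ)) (𝓝[<] (Real.pi / 2))
      (𝓝 ((∫ θ in (0 : ℝ)..(Real.pi / 2), cexp (I * r * Real.sin θ)) -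
      I * ((∫ t in Ioi (0 : ℝ), Real.exp (-(r * Real.sinh t)) : ℝ) : ℂ))) :=
    ((hcont.tendsto _).mono_left nhdsWithin_le_nhds).sub_const _
  have h2 : Tendsto (fun α : ℝ => -I * ∫ y in Ioi (0 : ℝ),
      hankelIntegrand r ((Real.sin α : ℝ) + y * I)) (𝓝[<] (Real.pi / 2))
      (𝓝 (-I * ∫ y in Ioi (0 : ℝ), hankelIntegrand r (1 + y * I))) := by
    refine Tendsto.const_mul _ ?_
    refine tendsto_integral_filter_of_dominated_convergence _ ?_ ?_
      (integrableOn_hankelBound hr) ?_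
    · filter_upwards [hev] with α hα
      exact aestronglyMeasurable_hankelIntegrand r (hsin α hα).2.le (hsin α hα).1
    · filter_upwards [hev] with α hα
      exact (ae_restrict_iff' measurableSet_Ioi).2 (ae_of_all _ fun _ hy =>
        norm_hankelIntegrand_le (hsin α hα).1 hy)
    · refine (ae_restrict_iff' measurableSet_Ioi).2 (ae_of_all _ fun y hy => ?_)
      have hy : 0 < y := hy
      have hc := (differentiableAt_hankelIntegrand r
        (one_sub_sq_mem_slitPlane (a := 1) (y := y) (by nlinarith))).continuousAt
      have hc2 : ContinuousAt (fun α : ℝ => ((Real.sin α : ℝ) : ℂ) + y * I) (Real.pi / 2) := by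
        fun_prop
      have hc3 : ContinuousAt (fun α : ℝ => hankelIntegrand r (((Real.sin α : ℝ) : ℂ) + y * I))
          (Real.pi / 2) :=
        ContinuousAt.comp (g := hankelIntegrand r)
          (f := fun α : ℝ => ((Real.sin α : ℝ) : ℂ) + y * I)
          (by rwa [Real.sin_pi_div_two]) hc2
      have := hc3.tendsto
      rw [Real.sin_pi_div_two, ofReal_one] at this
      exact this.mono_left nhdsWithin_le_nhds
  refine tendsto_nhds_unique (h1.congr' ?_) h2
  filter_upwards [hev] with α hα
  rw [← integral_hankelIntegrand_sin r hα.1 hα.2, ← integral_hankelIntegrand_sinh,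
    hankelIntegrand_halfStrip hr (hsin α hα).2 (hsin α hα).1]

lemma integral_eq_integral_Ioi_add_neg {f : ℝ → ℂ} (hf : Integrable f) :
    ∫ p, f p = ∫ p in Ioi (0 : ℝ), (f p + f (-p)) := by
  rw [integral_add hf.integrableOn hf.comp_neg.integrableOn, integral_comp_neg_Ioi, neg_zero,
    add_comm, intervalIntegral.integral_Iic_add_Ioi hf.integrableOn hf.integrableOn]

/-- The substitution `y = p²` turns `u = 1 + iy` into `c(p)` and removes the square-root
singularity: `√(1 - c²) = q = pω`, whose factor `p` cancels that of `dy = 2p dp`. The integrand is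
even in `p`, which unfolds the half line. -/
lemma integral_hankelIntegrand_eq_sdExp {r : ℝ} (hr : 0 < r) :
    ∫ y in Ioi (0 : ℝ), hankelIntegrand r (1 + y * I) = ∫ p, sdExp 0 r p * (sdRoot p)⁻¹ := by
  rw [← integral_comp_rpow_Ioi_of_pos (p := 2) (by norm_num),
    integral_eq_integral_Ioi_add_neg (integrable_sdExp_div 0 hr)]
  refine setIntegral_congr_fun measurableSet_Ioi fun p hp => ?_
  have hp : 0 < p := hp
  have h1 : sdExp 0 r (-p) = sdExp 0 r p := by simp [sdExp, sdCos_neg]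
  have h2 : (1 : ℂ) - (1 + ((p ^ 2 : ℝ) : ℂ) * I) ^ 2 = sdSin p ^ 2 := by
    rw [sdSin_sq, sdCos]; push_cast; ring
  have h3 : 0 < (sdSin p).re := by
    rw [sdSin, re_ofReal_mul]
    exact mul_pos hp (sdRoot_re_pos p)
  simp only [h1, sdRoot_neg]
  rw [show (2 : ℝ) - 1 = 1 by norm_num, Real.rpow_one, Real.rpow_two, hankelIntegrand, h2,
    sq_cpow_two_inv h3, sdSin, real_smul, sdExp, sdCos]
  have hp0 : (p : ℂ) ≠ 0 := ofReal_ne_zero.2 hp.ne'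
  have := sdRoot_ne_zero p
  have he : I * r * (1 + ((p ^ 2 : ℝ) : ℂ) * I) =
      I * (r * (1 + I * (p : ℂ) ^ 2) - (0 : ℝ) * (p * sdRoot p)) := by
    push_cast; ring
  rw [he]
  push_cast
  field_simp
  ring_nf

/-- `H₀⁽¹⁾(r) = (2 / (i π)) ∫ exp(i r c) / ω dp`. -/
lemma hankelH0_eq {r : ℝ} (hr : 0 < r) :
    hankelH0 r = 2 / (I * Real.pi) * ∫ p, sdExp 0 r p * (sdRoot p)⁻¹ := by
  have h1 := integral_hankelIntegrand_one hr
  rw [integral_hankelIntegrand_eq_sdExp hr] at h1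
  set Y := ∫ p, sdExp 0 r p * (sdRoot p)⁻¹
  have h2 : ∫ θ in (0 : ℝ)..Real.pi, cexp (I * r * Real.sin θ) =
      2 * ∫ θ in (0 : ℝ)..(Real.pi / 2), cexp (I * r * Real.sin θ) := by
    rw [← intervalIntegral.integral_add_adjacent_intervals (b := Real.pi / 2)
      (Continuous.intervalIntegrable (by fun_prop) _ _)
      (Continuous.intervalIntegrable (by fun_prop) _ _), two_mul]
    congr 1
    have h := intervalIntegral.integral_comp_sub_left
      (fun θ : ℝ => cexp (I * r * Real.sin θ)) Real.pi (a := 0) (b := Real.pi / 2)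
    rw [sub_zero, show Real.pi - Real.pi / 2 = Real.pi / 2 by ring] at h
    rw [← h]
    simp only [Real.sin_pi_sub]
  have h3 : ∫ θ in (0 : ℝ)..Real.pi, cexp (I * r * Real.sin θ) =
      ((∫ θ in (0 : ℝ)..Real.pi, Real.cos (r * Real.sin θ) : ℝ) : ℂ) +
        I * ((∫ θ in (0 : ℝ)..Real.pi, Real.sin (r * Real.sin θ) : ℝ) : ℂ) := by
    rw [← intervalIntegral.integral_ofReal, ← intervalIntegral.integral_ofReal,
      ← intervalIntegral.integral_const_mul, ← intervalIntegral.integral_add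
      (Continuous.intervalIntegrable (by fun_prop) _ _)
      (Continuous.intervalIntegrable (by fun_prop) _ _)]
    refine intervalIntegral.integral_congr fun θ _ => ?_
    rw [show I * r * (Real.sin θ : ℝ) = ((r * Real.sin θ : ℝ) : ℂ) * I by push_cast; ring,
      exp_mul_I, ofReal_cos, ofReal_sin (r * Real.sin θ)]
    ring
  rw [hankelH0, besselJ0, besselY0]
  rw [h3] at h2
  have hpi : (Real.pi : ℂ) ≠ 0 := ofReal_ne_zero.2 Real.pi_ne_zero
  push_cast at *
  field_simp
  linear_combination h2 * I + 2 * I * h1 -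
    2 * Y * I_sq

/-- `(i/4) H₀⁽¹⁾(k√(x² + z²)) = (1/2π) ∫ exp(i k (z c - x q)) / ω dp` for `z > 0`. -/
lemma hankelH0_eq_integral_sdExp {k x z : ℝ} (hk : 0 < k) (hz : 0 < z) :
    I / 4 * hankelH0 (k * √(x ^ 2 + z ^ 2)) =
      (2 * Real.pi : ℂ)⁻¹ * ∫ p, sdExp (k * x) (k * z) p * (sdRoot p)⁻¹ := by
  -- The polar form of `z + ix` supplies the radius and the angle of rotation; `z > 0` puts the
  -- angle strictly between `-π/2` and `π/2`.
  set w : ℂ := z + x * I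
  have hw : ‖w‖ = √(x ^ 2 + z ^ 2) := by
    rw [norm_add_mul_I, add_comm]
  have hre : 0 < w.re := by simp [w, hz]
  have harg : |arg w| < Real.pi / 2 := abs_arg_lt_pi_div_two_iff.2 (Or.inl hre)
  have hr : 0 < √(x ^ 2 + z ^ 2) := by positivity
  have hR : 0 < k * √(x ^ 2 + z ^ 2) := by positivity
  have h := integral_sdExp_rotate hR harg
  rw [mul_assoc, mul_assoc, ← hw, norm_mul_sin_arg, norm_mul_cos_arg,
    show w.im = x by simp [w], show w.re = z by simp [w], hw] at h
  rw [hankelH0_eq hR, ← h]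
  have hpi : (Real.pi : ℂ) ≠ 0 := ofReal_ne_zero.2 Real.pi_ne_zero
  generalize ∫ p, sdExp (k * x) (k * z) p * (sdRoot p)⁻¹ = Y
  field_simp
  norm_num

/-! ### A residue computation on the path of steepest descent -/

lemma sdSin_re (p : ℝ) : (sdSin p).re = p * (sdRoot p).re := by simp [sdSin]

lemma sdSin_im (p : ℝ) : (sdSin p).im = p * (sdRoot p).im := by simp [sdSin]

lemma sq_le_abs_sdSin_re (p : ℝ) : p ^ 2 ≤ |(sdSin p).re| := by
  rw [sdSin_re, abs_mul, abs_of_pos (sdRoot_re_pos p), ← sq_abs, pow_two]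
  exact mul_le_mul_of_nonneg_left (sdRoot_re_ge p).2 (abs_nonneg _)

/-- The path `q` runs through the second quadrant, the origin and the fourth quadrant. Translating
it downwards never meets a nonzero point `β` of the closed first quadrant, so no pole at `β` is
crossed. -/
lemma sdSin_sub_ne {β : ℂ} (h0 : β ≠ 0) (hre : 0 ≤ β.re) (him : 0 ≤ β.im) (p : ℝ) {M : ℝ}
    (hM : 0 ≤ M) : sdSin p - I * M - β ≠ 0 := fun h => by
  have h1 := congrArg Complex.re h
  have h2 := congrArg Complex.im h
  simp [sdSin_re, sdSin_im] at h1 h2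
  have h3 := sdRoot_re_pos p
  have h4 := sdRoot_im_neg p
  rcases lt_trichotomy p 0 with hp | hp | hp
  · nlinarith
  · subst hp
    apply h0
    apply Complex.ext
    · simp at h1 ⊢; exact h1
    · simp at h2 ⊢; linarith
  · nlinarith

lemma sdSin_sub_ne' {β : ℂ} (h0 : β ≠ 0) (hre : 0 ≤ β.re) (him : 0 ≤ β.im) (p : ℝ) :
    sdSin p - β ≠ 0 := by
  simpa using sdSin_sub_ne h0 hre him p le_rfl

lemma sdSin_add_ne {β : ℂ} (h0 : β ≠ 0) (hre : 0 ≤ β.re) (him : 0 ≤ β.im) (p : ℝ) :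
    sdSin p + β ≠ 0 := fun h => by
  apply sdSin_sub_ne' h0 hre him (-p)
  rw [sdSin_neg, ← neg_add', h, neg_zero]

/-- `(exp(-iAu) - exp(iAβ)) / (u² - β²)`, with the singularity at `-β` removed. -/
def residueFree (A : ℝ) (β u : ℂ) : ℂ := dslope (fun u => cexp (-I * A * u)) (-β) u * (u - β)⁻¹

lemma residueFree_of_ne (A : ℝ) {β u : ℂ} (h : u + β ≠ 0) :
    residueFree A β u = (cexp (-I * A * u) - cexp (I * A * β)) * ((u + β)⁻¹ * (u - β)⁻¹) := by
  rw [residueFree, dslope_of_ne _ (fun h' => h (by rw [h']; ring)), slope_def_field]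
  rw [sub_neg_eq_add, show -I * A * -β = I * A * β by ring]
  ring

lemma differentiableOn_residueFree (A : ℝ) (β : ℂ) :
    DifferentiableOn ℂ (residueFree A β) {β}ᶜ := by
  have h1 : Differentiable ℂ (dslope (fun u => cexp (-I * A * u)) (-β)) := by
    rw [← differentiableOn_univ, differentiableOn_dslope univ_mem]
    exact (by fun_prop : Differentiable ℂ fun u => cexp (-I * A * u)).differentiableOn
  exact h1.differentiableOn.mul ((differentiableOn_id.sub_const β).inv
    fun u hu => sub_ne_zero.2 hu)

lemma norm_residueFree_le {A : ℝ} (hA : 0 ≤ A) {β u : ℂ} (him : 0 ≤ β.im) {R : ℝ}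
    (hR : 2 * ‖β‖ ≤ R) (hR0 : 0 < R) (hu : R ≤ ‖u‖) (hu1 : u.im ≤ 1) :
    ‖residueFree A β u‖ ≤ 4 * (Real.exp A + 1) / R ^ 2 := by
  have h1 : R / 2 ≤ ‖u + β‖ := by
    have := norm_sub_norm_le u (-β)
    rw [sub_neg_eq_add, norm_neg] at this
    linarith
  have h2 : R / 2 ≤ ‖u - β‖ := by
    have := norm_sub_norm_le u β
    linarith
  have h3 : u + β ≠ 0 := norm_pos_iff.1 (by linarith)
  rw [residueFree_of_ne A h3, norm_mul, norm_mul, norm_inv, norm_inv]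
  have h4 : ‖cexp (-I * A * u) - cexp (I * A * β)‖ ≤ Real.exp A + 1 := by
    refine (norm_sub_le _ _).trans (add_le_add ?_ ?_)
    · rw [norm_exp]
      apply Real.exp_le_exp.2
      simp
      nlinarith
    · rw [norm_exp, Real.exp_le_one_iff]
      simp
      positivity
  calc _ ≤ (Real.exp A + 1) * ((R / 2)⁻¹ * (R / 2)⁻¹) := by gcongr
    _ = _ := by field_simp; norm_num

lemma norm_deriv_sdSin_le (p : ℝ) : ‖-2 * I * sdCos p * (sdRoot p)⁻¹‖ ≤ 2 * (1 + p ^ 2) := by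
  rw [norm_mul, norm_mul]
  have h1 := norm_inv_sdRoot_le_one p
  have h2 := norm_sdCos_le p
  have h3 : ‖-2 * I‖ = 2 := by simp
  rw [h3]
  calc _ ≤ 2 * (1 + p ^ 2) * 1 := by gcongr
    _ = _ := mul_one _

/-- The path is pushed down to infinity. There `exp(-iAu)` is bounded because `A ≥ 0`, the
denominator decays quadratically, and the only point at which a pole could be met, `-β`, is a
removable singularity of this quotient. -/
lemma tendsto_integral_residueFree {A : ℝ} (hA : 0 ≤ A) {β : ℂ} (h0 : β ≠ 0) (hre : 0 ≤ β.re)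
    (him : 0 ≤ β.im) :
    Tendsto (fun P : ℝ => ∫ p in (-P)..P, residueFree A β (sdSin p) *
      (-2 * I * sdCos p * (sdRoot p)⁻¹)) atTop (𝓝 0) := by
  let g := residueFree A β
  have hg : ∀ u ∈ ({β}ᶜ : Set ℂ), HasDerivAt g (deriv g u) u := fun u hu =>
    ((differentiableOn_residueFree A β).differentiableAt
      (isOpen_compl_singleton.mem_nhds hu)).hasDerivAt
  have hgc : ContinuousOn (deriv g) {β}ᶜ :=
    ((differentiableOn_residueFree A β).deriv isOpen_compl_singleton).continuousOn
  have hmem : ∀ t p : ℝ, sdSin p - I * (t ^ 2 : ℝ) ∈ ({β}ᶜ : Set ℂ) := fun t p h =>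
    sdSin_sub_ne h0 hre him p (sq_nonneg t) (sub_eq_zero.2 h)
  -- The downward shift is `t²` with `0 ≤ t ≤ P`, so that the total shift `P²` matches the lower
  -- bound `|Re q(±P)| ≥ P²`: on the bottom and on both sides `|u| ≥ P²/2`.
  let v : ℝ → ℂ := fun p => -2 * I * sdCos p * (sdRoot p)⁻¹
  have hv : Continuous v := by fun_prop
  have hu : Continuous fun a : ℝ × ℝ => sdSin a.2 - I * (a.1 ^ 2 : ℝ) := by fun_prop
  let D : ℝ → ℝ → ℂ := fun t p => -2 * I * t * deriv g (sdSin p - I * (t ^ 2 : ℝ)) * v p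
  have hD : Continuous (Function.uncurry D) := by
    have h1 : Continuous fun a : ℝ × ℝ => deriv g (sdSin a.2 - I * (a.1 ^ 2 : ℝ)) :=
      hgc.comp_continuous hu fun a => hmem a.1 a.2
    exact ((by fun_prop : Continuous fun a : ℝ × ℝ => -2 * I * (a.1 : ℂ)).mul h1).mul
      (hv.comp continuous_snd)
  have hf : ∀ t p, HasDerivAt (fun t : ℝ => g (sdSin p - I * (t ^ 2 : ℝ)) * v p) (D t p) t :=
    fun t p => by
      have h1 : HasDerivAt (fun t : ℝ => sdSin p - I * ((t ^ 2 : ℝ) : ℂ)) (-2 * I * t) t := by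
        have := ((((hasDerivAt_id t).fun_pow 2).ofReal_comp).const_mul I).const_sub (sdSin p)
        refine this.congr_deriv ?_
        simp; ring
      refine (((hg _ (hmem t p)).comp t h1).mul_const (v p)).congr_deriv ?_
      simp only [D]; ring
  have he : ∀ t p, HasDerivAt (fun p : ℝ => -2 * I * t * g (sdSin p - I * (t ^ 2 : ℝ)))
      (D t p) p := fun t p => by
    have h1 := (hasDerivAt_sdSin p).sub_const (I * ((t ^ 2 : ℝ) : ℂ))
    refine (((hg _ (hmem t p)).comp p h1).const_mul (-2 * I * t)).congr_deriv ?_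
    simp only [D, v]; ring
  have key := fun P : ℝ => integral_sub_of_hasDerivAt_eq (a := -P) (b := P) (s := 0) (t := P)
    hD hf he
  set C := 4 * (Real.exp A + 1)
  have hC : 0 < C := by positivity
  have hev : ∀ᶠ P : ℝ in atTop, ‖∫ p in (-P)..P, g (sdSin p) * v p‖ ≤ 40 * C * P⁻¹ := by
    filter_upwards [eventually_ge_atTop (max 2 (4 * ‖β‖))] with P hP
    have hP2 : 2 ≤ P := (le_max_left _ _).trans hP
    have hPβ : 4 * ‖β‖ ≤ P := (le_max_right _ _).trans hP
    have hPP : P ≤ P ^ 2 / 2 := by nlinarith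
    have hPos : 0 < P ^ 2 / 2 := by positivity
    have hcont : ∀ t : ℝ, Continuous fun p => g (sdSin p - I * (t ^ 2 : ℝ)) * v p := fun t =>
      ((differentiableOn_residueFree A β).continuousOn.comp_continuous
        (by fun_prop) (hmem t)).mul hv
    have k1 := key P
    rw [intervalIntegral.integral_sub ((hcont P).intervalIntegrable _ _)
      ((hcont 0).intervalIntegrable _ _)] at k1
    have k2 : ∫ p in (-P)..P, g (sdSin p) * v p =
        (∫ p in (-P)..P, g (sdSin p - I * (P ^ 2 : ℝ)) * v p) -
        ∫ t in (0 : ℝ)..P, (-2 * I * t * g (sdSin P - I * (t ^ 2 : ℝ)) -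
          -2 * I * t * g (sdSin (-P) - I * (t ^ 2 : ℝ))) := by
      rw [← k1]; simp
    have b1 : ‖∫ p in (-P)..P, g (sdSin p - I * (P ^ 2 : ℝ)) * v p‖ ≤
        C / (P ^ 2 / 2) ^ 2 * (4 * P ^ 2) * |P - -P| := by
      refine intervalIntegral.norm_integral_le_of_norm_le_const fun p hp => ?_
      rw [uIoc_of_le (by linarith)] at hp
      rw [norm_mul]
      have hi := abs_le.1 (abs_sdSin_im_le_one p)
      have him' : (sdSin p - I * (P ^ 2 : ℝ)).im = (sdSin p).im - P ^ 2 := by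
        simp [-ofReal_pow]
      refine mul_le_mul (norm_residueFree_le hA him (by linarith) hPos ?_ ?_) ?_
        (norm_nonneg _) (by positivity)
      · refine le_trans ?_ (abs_im_le_norm _)
        rw [him', abs_sub_comm]
        refine le_trans ?_ (le_abs_self _)
        nlinarith [hi.2]
      · rw [him']; nlinarith [hi.2]
      · refine (norm_deriv_sdSin_le p).trans ?_
        nlinarith [hp.1, hp.2]
    have b2 : ‖∫ t in (0 : ℝ)..P, (-2 * I * t * g (sdSin P - I * (t ^ 2 : ℝ)) -
          -2 * I * t * g (sdSin (-P) - I * (t ^ 2 : ℝ)))‖ ≤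
        (4 * P * (C / (P ^ 2 / 2) ^ 2)) * |P - 0| := by
      refine intervalIntegral.norm_integral_le_of_norm_le_const fun t ht => ?_
      rw [uIoc_of_le (by linarith)] at ht
      have hb : ∀ s : ℝ, s ^ 2 = P ^ 2 → ‖-2 * I * t * g (sdSin s - I * (t ^ 2 : ℝ))‖ ≤
          2 * P * (C / (P ^ 2 / 2) ^ 2) := fun s hs => by
        have hi := abs_le.1 (abs_sdSin_im_le_one s)
        have him' : (sdSin s - I * (t ^ 2 : ℝ)).im = (sdSin s).im - t ^ 2 := by
          simp [-ofReal_pow]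
        have hre' : (sdSin s - I * (t ^ 2 : ℝ)).re = (sdSin s).re := by
          simp [-ofReal_pow]
        rw [norm_mul]
        refine mul_le_mul ?_ (norm_residueFree_le hA him (by linarith) hPos ?_ ?_)
          (norm_nonneg _) (by positivity)
        · simp [abs_of_pos ht.1, ht.2]
        · refine le_trans ?_ (abs_re_le_norm _)
          rw [hre']
          refine le_trans ?_ (sq_le_abs_sdSin_re s)
          linarith
        · rw [him']; nlinarith [hi.2]
      refine (norm_sub_le _ _).trans ?_
      linarith [hb P rfl, hb (-P) (by ring)]
    rw [k2]
    refine (norm_sub_le _ _).trans ((add_le_add b1 b2).trans ?_)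
    rw [sub_neg_eq_add, sub_zero, abs_of_pos (by linarith), abs_of_pos (by linarith)]
    have hP0 : P ≠ 0 := by linarith
    have h5 : C / (P ^ 2 / 2) ^ 2 * (4 * P ^ 2) * (P + P) + 4 * P * (C / (P ^ 2 / 2) ^ 2) * P
        = 32 * C * P⁻¹ + 16 * C * P⁻¹ * P⁻¹ := by
      field_simp; ring
    rw [h5]
    have h6 : P⁻¹ ≤ 2⁻¹ := inv_anti₀ (by norm_num) hP2
    have h7 : 0 < C * P⁻¹ := by positivity
    nlinarith
  refine squeeze_zero_norm' hev ?_
  simpa using (tendsto_inv_atTop_zero (𝕜 := ℝ)).const_mul (40 * C)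

lemma tendsto_norm_sdSin : Tendsto (fun p => ‖sdSin p‖) atTop atTop :=
  tendsto_atTop_mono (fun p => (sq_le_abs_sdSin_re p).trans (abs_re_le_norm _))
    (tendsto_pow_atTop two_ne_zero)

/-- The integrand has the primitive `(2β)⁻¹ log r` with `r = (β - q)/(β + q)`. As `r(-p) = 1/r(p)`,
the integral is `β⁻¹ log r(P)`; and `r(P) → -1` from the upper half plane, where the principal
logarithm tends to `iπ`. -/
lemma tendsto_integral_inv_sdSin_sq_sub {β : ℂ} (h0 : β ≠ 0) (hre : 0 ≤ β.re) (him : 0 ≤ β.im) :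
    Tendsto (fun P : ℝ => ∫ p in (-P)..P, ((sdSin p + β)⁻¹ * (sdSin p - β)⁻¹) *
      (-2 * I * sdCos p * (sdRoot p)⁻¹)) atTop (𝓝 (I * Real.pi / β)) := by
  let r : ℝ → ℂ := fun p => (β - sdSin p) / (β + sdSin p)
  have hn : ∀ p, β + sdSin p ≠ 0 := fun p => by
    rw [add_comm]; exact sdSin_add_ne h0 hre him p
  have hn' : ∀ p, β - sdSin p ≠ 0 := fun p => by
    rw [← neg_sub, neg_ne_zero]; exact sdSin_sub_ne' h0 hre him p
  have hrneg : ∀ p, r (-p) = (r p)⁻¹ := fun p => by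
    simp only [r, sdSin_neg, inv_div, sub_neg_eq_add, ← sub_eq_add_neg]
  have hrpos : ∀ p, 0 < p → 0 < (r p).im := fun p hp => by
    have h1 : (r p).im = -2 * (sdSin p * starRingEnd ℂ β).im / normSq (β + sdSin p) := by
      simp only [r, div_im]
      simp
      ring
    rw [h1]
    refine div_pos ?_ (normSq_pos.2 (hn p))
    have h2 : (sdSin p * starRingEnd ℂ β).im < 0 := by
      have h3 := sdRoot_re_pos p
      have h4 := sdRoot_im_neg p
      simp [sdSin_re, sdSin_im]
      have h5 : 0 < p * (sdRoot p).re := mul_pos hp h3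
      have h6 : p * (sdRoot p).im < 0 := mul_neg_of_pos_of_neg hp h4
      rcases hre.eq_or_lt with h | h
      · have : 0 < β.im := him.lt_of_ne fun h' => h0 (Complex.ext h.symm h'.symm)
        rw [← h]; nlinarith
      · nlinarith
    linarith
  have hslit : ∀ p, r p ∈ slitPlane := fun p => by
    rcases lt_trichotomy p 0 with hp | hp | hp
    · right
      have h1 := hrpos (-p) (by linarith)
      rw [hrneg, inv_im] at h1
      intro h
      simp [h] at h1
    · left
      simp [r, hp, sdSin, h0]
    · right
      exact (hrpos p hp).ne'
  have hder : ∀ p, HasDerivAt (fun p => (2 * β)⁻¹ * log (r p)) (((sdSin p + β)⁻¹ *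
      (sdSin p - β)⁻¹) * (-2 * I * sdCos p * (sdRoot p)⁻¹)) p := fun p => by
    have h1 := (((hasDerivAt_sdSin p).const_sub β).div ((hasDerivAt_sdSin p).const_add β) (hn p))
    have h2 := (h1.clog_real (hslit p)).const_mul (2 * β)⁻¹
    refine h2.congr_deriv ?_
    have e1 := hn p
    have e2 := hn' p
    have e3 := sdSin_add_ne h0 hre him p
    have e4 := sdSin_sub_ne' h0 hre him p
    have e5 := sdRoot_ne_zero p
    simp only [Pi.div_apply]
    field_simp
    ring
  have hcont : Continuous fun p => ((sdSin p + β)⁻¹ *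
      (sdSin p - β)⁻¹) * (-2 * I * sdCos p * (sdRoot p)⁻¹) := by
    have c1 : Continuous fun p => (sdSin p + β)⁻¹ :=
      (continuous_sdSin.add continuous_const).inv₀ (sdSin_add_ne h0 hre him)
    have c2 : Continuous fun p => (sdSin p - β)⁻¹ :=
      (continuous_sdSin.sub continuous_const).inv₀ (sdSin_sub_ne' h0 hre him)
    fun_prop
  have hval : ∀ P : ℝ, ∫ p in (-P)..P, ((sdSin p + β)⁻¹ *
      (sdSin p - β)⁻¹) * (-2 * I * sdCos p * (sdRoot p)⁻¹) = β⁻¹ * log (r P) := fun P => by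
    rw [intervalIntegral.integral_eq_sub_of_hasDerivAt (fun p _ => hder p)
      (hcont.intervalIntegrable _ _), hrneg, log_inv _ (slitPlane_arg_ne_pi (hslit P))]
    field_simp
    ring
  simp_rw [hval]
  have hr : Tendsto r atTop (𝓝 (-1)) := by
    have h1 : ∀ p, r p = -1 + 2 * β * (β + sdSin p)⁻¹ := fun p => by
      have := hn p
      simp only [r]; field_simp; ring
    have h2 : Tendsto (fun p => (β + sdSin p)⁻¹) atTop (𝓝 0) := by
      refine tendsto_inv₀_cobounded.comp ?_
      rw [← tendsto_norm_atTop_iff_cobounded]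
      refine tendsto_atTop_mono (fun p => ?_) (tendsto_atTop_add_const_right _ (-‖β‖)
        tendsto_norm_sdSin)
      have := norm_sub_norm_le (sdSin p) (-β)
      rw [norm_neg, sub_neg_eq_add, add_comm _ β] at this
      linarith
    have h3 := (h2.const_mul (2 * β)).const_add (-1)
    simpa [← h1] using h3
  have hlog := tendsto_log_nhdsWithin_im_nonneg_of_re_neg_of_im_zero
    (z := -1) (by simp) (by simp)
  have hr' : Tendsto r atTop (𝓝[{z : ℂ | 0 ≤ z.im}] (-1)) :=
    tendsto_nhdsWithin_iff.2 ⟨hr, by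
      filter_upwards [eventually_gt_atTop 0] with p hp using (hrpos p hp).le⟩
  have h := (hlog.comp hr').const_mul β⁻¹
  simp only [norm_neg, norm_one, Real.log_one, ofReal_zero, zero_add] at h
  rw [show I * Real.pi / β = β⁻¹ * (Real.pi * I) by ring]
  exact h

/-- In `(c - m)(c + m)` the second factor is at least `|c|` since `Re c = 1` and `m > 0`; the first
is at least `|1 - m|` (real part) and at least `p²` (imaginary part). This gives the decay `1/(1 +
p²)` of the mode integrand. -/
lemma norm_sdCos_sq_sub_ge {m p : ℝ} (hm : 0 < m) :
    min 1 |1 - m| / 2 * (1 + p ^ 2) * ‖sdCos p‖ ≤ ‖sdCos p ^ 2 - m ^ 2‖ := by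
  rw [show sdCos p ^ 2 - (m : ℂ) ^ 2 = (sdCos p - m) * (sdCos p + m) by ring, norm_mul]
  have h1 : ‖sdCos p‖ ≤ ‖sdCos p + m‖ := by
    rw [norm_def, norm_def, normSq_apply, normSq_apply]
    apply Real.sqrt_le_sqrt
    simp [sdCos_re, sdCos_im]
    nlinarith
  have h2 : |1 - m| ≤ ‖sdCos p - m‖ := by
    have := abs_re_le_norm (sdCos p - m)
    simpa [sdCos_re] using this
  have h3 : p ^ 2 ≤ ‖sdCos p - m‖ := by
    have := abs_im_le_norm (sdCos p - m)
    simpa [sdCos_im] using this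
  refine mul_le_mul ?_ h1 (norm_nonneg _) (norm_nonneg _)
  have h4 := min_le_left 1 |1 - m|
  have h5 := min_le_right 1 |1 - m|
  nlinarith [sq_nonneg p]

lemma sdCos_sq_sub_ne {m : ℝ} (hm : 0 < m) (hm1 : m ≠ 1) (p : ℝ) :
    sdCos p ^ 2 - (m : ℂ) ^ 2 ≠ 0 := by
  refine norm_pos_iff.1 (lt_of_lt_of_le ?_ (norm_sdCos_sq_sub_ge (p := p) hm))
  have h1 : 0 < |1 - m| := abs_pos.2 (sub_ne_zero.2 hm1.symm)
  have h2 : 0 < ‖sdCos p‖ := norm_pos_iff.2 fun h => by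
    have := sdCos_re p
    simp [h] at this
  positivity

lemma integrable_mode {A m : ℝ} (hm : 0 < m) (hm1 : m ≠ 1) :
    Integrable fun p => sdExp A 0 p * (sdRoot p)⁻¹ * (2 * I * sdCos p / (sdCos p ^ 2 - m ^ 2)) := by
  set δ := min 1 |1 - m| / 2
  have hδ : 0 < δ := by
    have h1 : 0 < |1 - m| := abs_pos.2 (sub_ne_zero.2 hm1.symm)
    positivity
  have hc : Continuous fun p => (sdCos p ^ 2 - (m : ℂ) ^ 2)⁻¹ :=
    Continuous.inv₀ (by fun_prop) (sdCos_sq_sub_ne hm hm1)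
  have hc2 : Continuous fun p => sdExp A 0 p :=
    continuous_sdExp.comp (f := fun p : ℝ => (A, 0, p)) (by fun_prop)
  refine (integrable_inv_one_add_sq.const_mul (Real.exp |A| * (2 * δ⁻¹))).mono'
    (Continuous.aestronglyMeasurable (by simp only [div_eq_mul_inv]; fun_prop))
    (ae_of_all _ fun p => ?_)
  have h1 : ‖sdExp A 0 p‖ ≤ Real.exp |A| := by simpa using norm_sdExp_le A 0 p
  have h2 := norm_inv_sdRoot_le_one p
  have h3 : ‖2 * I * sdCos p / (sdCos p ^ 2 - m ^ 2)‖ ≤ 2 * δ⁻¹ * (1 + p ^ 2)⁻¹ := by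
    have h4 := norm_sdCos_sq_sub_ge (p := p) hm
    have h5 := norm_pos_iff.2 (sdCos_sq_sub_ne hm hm1 p)
    rw [norm_div, div_le_iff₀ h5]
    have h6 : 2 * δ⁻¹ * (1 + p ^ 2)⁻¹ * (δ * (1 + p ^ 2) * ‖sdCos p‖) = ‖2 * I * sdCos p‖ := by
      have : 1 + p ^ 2 ≠ 0 := by positivity
      simp
      field_simp
    rw [← h6]
    gcongr
  rw [norm_mul, norm_mul]
  calc _ ≤ Real.exp |A| * 1 * (2 * δ⁻¹ * (1 + p ^ 2)⁻¹) := by gcongr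
    _ = _ := by ring

/-- The residue formula for the modes of the waveguide. -/
lemma integral_mode {A m : ℝ} (hA : 0 ≤ A) (hm : 0 < m) (hm1 : m ≠ 1) {β : ℂ}
    (hβ : β ^ 2 = 1 - m ^ 2) (hre : 0 ≤ β.re) (him : 0 ≤ β.im) :
    ∫ p, sdExp A 0 p * (sdRoot p)⁻¹ * (2 * I * sdCos p / (sdCos p ^ 2 - m ^ 2)) =
      I * Real.pi / β * cexp (I * A * β) := by
  have h0 : β ≠ 0 := fun h => by
    rw [h] at hβ
    have : (m : ℂ) ^ 2 = 1 := by linear_combination hβ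
    have : m ^ 2 = 1 := by exact_mod_cast this
    exact hm1 (by nlinarith)
  have h1 := intervalIntegral_tendsto_integral (integrable_mode (A := A) hm hm1)
    tendsto_neg_atTop_atBot tendsto_id
  -- Split `exp(-iAq)` as `(exp(-iAq) - exp(iAβ)) + exp(iAβ)`: the bracket has no pole at `-β` and
  -- contributes nothing, the constant contributes the whole value. The denominators match because
  -- `q² - β² = -(c² - m²)`.
  have h2 := (tendsto_integral_residueFree hA h0 hre him).add
    ((tendsto_integral_inv_sdSin_sq_sub h0 hre him).const_mul (cexp (I * A * β)))
  refine (tendsto_nhds_unique h1 (h2.congr fun P => ?_)).trans (by ring)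
  have c1 : Continuous fun p => (sdSin p + β)⁻¹ :=
    (continuous_sdSin.add continuous_const).inv₀ (sdSin_add_ne h0 hre him)
  have c2 : Continuous fun p => (sdSin p - β)⁻¹ :=
    (continuous_sdSin.sub continuous_const).inv₀ (sdSin_sub_ne' h0 hre him)
  simp_rw [residueFree_of_ne A (sdSin_add_ne h0 hre him _)]
  rw [← intervalIntegral.integral_const_mul, ← intervalIntegral.integral_add
    (Continuous.intervalIntegrable (by fun_prop) _ _)
    (Continuous.intervalIntegrable (by fun_prop) _ _)]
  refine intervalIntegral.integral_congr fun p _ => ?_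
  have e3 := sdSin_add_ne h0 hre him p
  have e4 := sdSin_sub_ne' h0 hre him p
  have e5 := sdCos_sq_sub_ne hm hm1 p
  have e6 : (sdSin p + β) * (sdSin p - β) = -(sdCos p ^ 2 - m ^ 2) := by
    linear_combination sdSin_sq p - hβ
  rw [← mul_inv, e6, sdExp]
  rw [show I * (((0 : ℝ) : ℂ) * sdCos p - A * sdSin p) = -I * A * sdSin p by push_cast; ring]
  have := sdRoot_ne_zero p
  field_simp
  ring

/-! ### The regular part of the Green function -/

lemma norm_exp_mul_I_le (z : ℂ) : ‖cexp (z * I)‖ ≤ Real.exp |z.im| := by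
  rw [norm_exp]
  apply Real.exp_le_exp.2
  simp
  exact neg_le_abs _

lemma norm_exp_neg_mul_I_le (z : ℂ) : ‖cexp (-z * I)‖ ≤ Real.exp |z.im| := by
  rw [norm_exp]
  apply Real.exp_le_exp.2
  simp
  exact le_abs_self _

lemma norm_sin_le_exp (z : ℂ) : ‖Complex.sin z‖ ≤ Real.exp |z.im| := by
  have h1 := norm_exp_mul_I_le z
  have h2 := norm_exp_neg_mul_I_le z
  have h3 := norm_sub_le (cexp (-z * I)) (cexp (z * I))
  rw [Complex.sin, norm_div, norm_mul, norm_I, mul_one]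
  simp only [Complex.norm_ofNat]
  linarith

lemma norm_cos_le_exp (z : ℂ) : ‖Complex.cos z‖ ≤ Real.exp |z.im| := by
  have h1 := norm_exp_mul_I_le z
  have h2 := norm_exp_neg_mul_I_le z
  have h3 := norm_add_le (cexp (z * I)) (cexp (-z * I))
  rw [Complex.cos, norm_div]
  simp only [Complex.norm_ofNat]
  linarith

lemma integrable_one_add_sq_mul_exp {b : ℝ} (hb : 0 < b) :
    Integrable fun p : ℝ => (1 + p ^ 2) * Real.exp (-(b * p ^ 2)) := by
  have h1 := integrable_exp_neg_mul_sq hb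
  have h2 := integrable_rpow_mul_exp_neg_mul_sq hb (s := 2) (by norm_num)
  refine (h1.add h2).congr (ae_of_all _ fun p => ?_)
  simp
  ring_nf

/-- `1 + exp(2 i k h c(p))`. -/
def periodDenom (k h p : ℝ) : ℂ := 1 + sdExp 0 (2 * (k * h)) p

/-- Here `exp(2ikhc) = ρw` with `ρ = exp(-2khp²) ≤ 1` and `w = exp(2ikh)` of modulus one. Then
`2|cos(kh)| = |1 + w| ≤ |1 + ρw| + (1 - ρ)`, and `1 - ρ ≤ |1 + ρw|` as well. This is the source of
the factor `1/|cos(kh)|`. -/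
lemma abs_cos_le_norm_periodDenom {k h : ℝ} (hkh : 0 ≤ k * h) (p : ℝ) :
    |Real.cos (k * h)| ≤ ‖periodDenom k h p‖ := by
  set ρ := Real.exp (-(2 * (k * h) * p ^ 2)) with hρ
  have hρ1 : ρ ≤ 1 := by
    rw [hρ, Real.exp_le_one_iff]
    have := mul_nonneg hkh (sq_nonneg p)
    nlinarith
  have hρ0 : 0 < ρ := Real.exp_pos _
  set w := cexp ((2 * (k * h) : ℝ) * I) with hw
  have hw1 : ‖w‖ = 1 := norm_exp_ofReal_mul_I _
  have hE : sdExp 0 (2 * (k * h)) p = ρ * w := by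
    rw [sdExp, hρ, hw, ofReal_exp, ← Complex.exp_add]
    congr 1
    simp only [sdCos]
    push_cast
    linear_combination (2 * k * h * p ^ 2 : ℂ) * I_sq
  rw [periodDenom, hE]
  have h1 : ‖1 + w‖ = 2 * |Real.cos (k * h)| := by
    have : 1 + w = cexp ((k * h : ℝ) * I) * (2 * ((Real.cos (k * h) : ℝ) : ℂ)) := by
      rw [ofReal_cos, Complex.two_cos, mul_add, ← Complex.exp_add, ← Complex.exp_add, hw]
      rw [show (((k * h : ℝ) : ℂ) * I + -((k * h : ℝ) : ℂ) * I) = 0 by ring, Complex.exp_zero,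
        add_comm]
      congr 2
      push_cast; ring
    rw [this, norm_mul, norm_exp_ofReal_mul_I]
    simp only [norm_mul, norm_real, Real.norm_eq_abs, Complex.norm_ofNat, one_mul]
  have h2 : ‖1 + w‖ ≤ ‖1 + ρ * w‖ + (1 - ρ) := by
    have : 1 + w = (1 + ρ * w) + (1 - ρ : ℝ) * w := by push_cast; ring
    rw [this]
    refine (norm_add_le _ _).trans ?_
    rw [norm_mul, hw1, mul_one, norm_real, Real.norm_of_nonneg (by linarith)]
  have h3 : 1 - ρ ≤ ‖1 + ρ * w‖ := by
    have := norm_sub_norm_le (1 : ℂ) (-(ρ * w))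
    rw [norm_neg, norm_mul, hw1, norm_real, Real.norm_of_nonneg hρ0.le, norm_one,
      sub_neg_eq_add] at this
    linarith
  linarith

lemma periodDenom_ne_zero {k h : ℝ} (hkh : 0 ≤ k * h) (hc : Real.cos (k * h) ≠ 0) (p : ℝ) :
    periodDenom k h p ≠ 0 :=
  norm_pos_iff.1 ((abs_pos.2 hc).trans_le (abs_cos_le_norm_periodDenom hkh p))

/-- The part of the kernel of the regular part that does not depend on `x₂`. -/
def baseKernel (k h : ℝ) (y : ℝ × ℝ) (s p : ℝ) : ℂ :=
  -4 * sdExp (k * (s - y.1)) (2 * (k * h)) p * (periodDenom k h p)⁻¹ *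
    Complex.sin (k * sdCos p * y.2) * (sdRoot p)⁻¹

/-- The kernel of the regular part of the Green function. -/
def regKernel (k h : ℝ) (y x : ℝ × ℝ) (p : ℝ) : ℂ :=
  baseKernel k h y x.1 p * Complex.sin (k * sdCos p * x.2)

/-- `∂/∂x₁` of the kernel. -/
def regKernelD₁ (k h : ℝ) (y x : ℝ × ℝ) (p : ℝ) : ℂ :=
  -I * k * sdSin p * regKernel k h y x p

/-- `∂/∂x₂` of the kernel. -/
def regKernelD₂ (k h : ℝ) (y x : ℝ × ℝ) (p : ℝ) : ℂ :=
  baseKernel k h y x.1 p * (k * sdCos p * Complex.cos (k * sdCos p * x.2))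

/-- The regular part `S(x, y)` of the Green function of the waveguide. -/
def regPart (k h : ℝ) (x y : ℝ × ℝ) : ℂ := (2 * Real.pi : ℂ)⁻¹ * ∫ p, regKernel k h y x p

/-- The derivative of the kernel. -/
def regKernelD (k h : ℝ) (y x : ℝ × ℝ) (p : ℝ) : ℝ × ℝ →L[ℝ] ℂ :=
  (ContinuousLinearMap.fst ℝ ℝ ℝ).smulRight (regKernelD₁ k h y x p) +
    (ContinuousLinearMap.snd ℝ ℝ ℝ).smulRight (regKernelD₂ k h y x p)

lemma hasFDerivAt_regKernel (k h : ℝ) (y x : ℝ × ℝ) (p : ℝ) :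
    HasFDerivAt (fun x => regKernel k h y x p) (regKernelD k h y x p) x := by
  have h1 : HasDerivAt (fun s : ℝ => baseKernel k h y s p)
      (-I * k * sdSin p * baseKernel k h y x.1 p) x.1 := by
    have e1 : HasDerivAt (fun s : ℝ => I * (((2 * (k * h) : ℝ) : ℂ) * sdCos p -
        ((k * (s - y.1) : ℝ) : ℂ) * sdSin p)) (I * -(((k * 1 : ℝ) : ℂ) * sdSin p)) x.1 :=
      ((((((hasDerivAt_id x.1).sub_const y.1).const_mul k).ofReal_comp).mul_const
        _).const_sub _).const_mul I
    have e2 := (((e1.cexp.const_mul (-4)).mul_const (periodDenom k h p)⁻¹).mul_const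
      (Complex.sin (k * sdCos p * y.2))).mul_const (sdRoot p)⁻¹
    refine e2.congr_deriv ?_
    simp only [baseKernel, sdExp]
    push_cast
    ring
  have h2 : HasDerivAt (fun t : ℝ => Complex.sin (k * sdCos p * t))
      (k * sdCos p * Complex.cos (k * sdCos p * x.2)) x.2 := by
    have e1 := ((hasDerivAt_id x.2).ofReal_comp).const_mul (k * sdCos p)
    have e2 := (Complex.hasDerivAt_sin _).comp x.2 e1
    refine e2.congr_deriv ?_
    simp
    ring
  have h3 := (h1.hasFDerivAt.comp x hasFDerivAt_fst).mul (h2.hasFDerivAt.comp x hasFDerivAt_snd)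
  refine h3.congr_fderiv ?_
  ext
  · simp [regKernelD, regKernelD₁, regKernel, Function.comp]
    ring
  · simp [regKernelD, regKernelD₂, Function.comp]

lemma sdCos_mul_im (k t p : ℝ) : (k * sdCos p * t).im = k * t * p ^ 2 := by
  rw [im_mul_ofReal, im_ofReal_mul, sdCos_im]; ring

lemma norm_baseKernel_le {k h : ℝ} (hk : 0 < k) (hh : 0 < h) (hc : Real.cos (k * h) ≠ 0)
    {y : ℝ × ℝ} (hy : 0 ≤ y.2) (s p : ℝ) :
    ‖baseKernel k h y s p‖ ≤ 4 / |Real.cos (k * h)| * Real.exp (k * (s - y.1) * (sdSin p).im) *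
      Real.exp (-(k * (2 * h - y.2) * p ^ 2)) * ‖(sdRoot p)⁻¹‖ := by
  have h1 := norm_sdExp (k * (s - y.1)) (2 * (k * h)) p
  have h2 : ‖(periodDenom k h p)⁻¹‖ ≤ |Real.cos (k * h)|⁻¹ := by
    rw [norm_inv]
    exact inv_anti₀ (abs_pos.2 hc) (abs_cos_le_norm_periodDenom (by positivity) p)
  have h3 : ‖Complex.sin (k * sdCos p * y.2)‖ ≤ Real.exp (k * y.2 * p ^ 2) := by
    have := norm_sin_le_exp (k * sdCos p * y.2)
    rwa [sdCos_mul_im, abs_of_nonneg (by positivity)] at this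
  rw [baseKernel, norm_mul, norm_mul, norm_mul, norm_mul, h1]
  have h4 : ‖(-4 : ℂ)‖ = 4 := by simp
  rw [h4]
  calc _ ≤ 4 * (Real.exp (k * (s - y.1) * (sdSin p).im) * Real.exp (-(2 * (k * h) * p ^ 2))) *
        |Real.cos (k * h)|⁻¹ * Real.exp (k * y.2 * p ^ 2) * ‖(sdRoot p)⁻¹‖ := by gcongr
    _ = 4 / |Real.cos (k * h)| * Real.exp (k * (s - y.1) * (sdSin p).im) *
      (Real.exp (-(2 * (k * h) * p ^ 2)) * Real.exp (k * y.2 * p ^ 2)) * ‖(sdRoot p)⁻¹‖ := by ring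
    _ = _ := by
      rw [← Real.exp_add]
      congr 3
      ring

/-- A common bound of the kernel and its derivatives. -/
def kernelBound (k h : ℝ) (y x : ℝ × ℝ) (p : ℝ) : ℝ :=
  4 / |Real.cos (k * h)| * Real.exp (k * (x.1 - y.1) * (sdSin p).im) *
    ((1 + p ^ 2) * Real.exp (-(k * (2 * h - x.2 - y.2) * p ^ 2)))

/-- `∂₁` brings down `kq = kpω`, whose `ω` cancels the factor `ω⁻¹` kept in the bound of the base
kernel; `∂₂` brings down `kc`. Either way the price is `k` and a polynomial factor at most `1 + p²`.
-/
lemma kernel_bounds {k h : ℝ} (hk : 0 < k) (hh : 0 < h) (hc : Real.cos (k * h) ≠ 0)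
    {y x : ℝ × ℝ} (hy : 0 ≤ y.2) (hx : 0 ≤ x.2) (p : ℝ) :
    ‖regKernel k h y x p‖ ≤ kernelBound k h y x p ∧
    ‖regKernelD₁ k h y x p‖ ≤ k * kernelBound k h y x p ∧
    ‖regKernelD₂ k h y x p‖ ≤ k * kernelBound k h y x p := by
  have h1 := norm_baseKernel_le hk hh hc hy x.1 p
  have h2 : ‖Complex.sin (k * sdCos p * x.2)‖ ≤ Real.exp (k * x.2 * p ^ 2) := by
    have := norm_sin_le_exp (k * sdCos p * x.2)
    rwa [sdCos_mul_im, abs_of_nonneg (by positivity)] at this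
  have h3 : ‖Complex.cos (k * sdCos p * x.2)‖ ≤ Real.exp (k * x.2 * p ^ 2) := by
    have := norm_cos_le_exp (k * sdCos p * x.2)
    rwa [sdCos_mul_im, abs_of_nonneg (by positivity)] at this
  have h0 : 0 < |Real.cos (k * h)| := abs_pos.2 hc
  have h4 := norm_inv_sdRoot_le_one p
  have he : Real.exp (-(k * (2 * h - y.2) * p ^ 2)) * Real.exp (k * x.2 * p ^ 2) =
      Real.exp (-(k * (2 * h - x.2 - y.2) * p ^ 2)) := by
    rw [← Real.exp_add]; congr 1; ring
  set X := Real.exp (k * (x.1 - y.1) * (sdSin p).im)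
  have hX : 0 < X := Real.exp_pos _
  have hK : ‖regKernel k h y x p‖ ≤ 4 / |Real.cos (k * h)| * X *
      Real.exp (-(k * (2 * h - x.2 - y.2) * p ^ 2)) * ‖(sdRoot p)⁻¹‖ := by
    rw [regKernel, norm_mul]
    calc _ ≤ (4 / |Real.cos (k * h)| * X * Real.exp (-(k * (2 * h - y.2) * p ^ 2)) *
          ‖(sdRoot p)⁻¹‖) * Real.exp (k * x.2 * p ^ 2) := by gcongr
      _ = 4 / |Real.cos (k * h)| * X * (Real.exp (-(k * (2 * h - y.2) * p ^ 2)) *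
          Real.exp (k * x.2 * p ^ 2)) * ‖(sdRoot p)⁻¹‖ := by ring
      _ = _ := by rw [he]
  set E := Real.exp (-(k * (2 * h - x.2 - y.2) * p ^ 2))
  have hE : 0 < E := Real.exp_pos _
  have hp1 : |p| ≤ 1 + p ^ 2 := by
    rw [← sq_abs p]; nlinarith [sq_nonneg (|p| - 1), abs_nonneg p]
  have hkb : kernelBound k h y x p = 4 / |Real.cos (k * h)| * X * ((1 + p ^ 2) * E) := rfl
  rw [hkb]
  refine ⟨?_, ?_, ?_⟩
  · calc _ ≤ 4 / |Real.cos (k * h)| * X * E * 1 := hK.trans (by gcongr)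
      _ ≤ 4 / |Real.cos (k * h)| * X * E * (1 + p ^ 2) := by
        gcongr; linarith [sq_nonneg p]
      _ = _ := by ring
  · rw [regKernelD₁, norm_mul]
    have h5 : ‖-I * k * sdSin p‖ = k * (|p| * ‖sdRoot p‖) := by
      simp [sdSin, abs_of_pos hk]
    rw [h5]
    have h6 : ‖sdRoot p‖ * ‖(sdRoot p)⁻¹‖ = 1 := by
      rw [norm_inv]; exact mul_inv_cancel₀ (norm_ne_zero_iff.2 (sdRoot_ne_zero p))
    calc _ ≤ k * (|p| * ‖sdRoot p‖) * (4 / |Real.cos (k * h)| * X * E * ‖(sdRoot p)⁻¹‖) := by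
          gcongr
      _ = k * (4 / |Real.cos (k * h)| * X * (|p| * E)) * (‖sdRoot p‖ * ‖(sdRoot p)⁻¹‖) := by ring
      _ ≤ k * (4 / |Real.cos (k * h)| * X * ((1 + p ^ 2) * E)) := by
        rw [h6, mul_one]; gcongr
  · rw [regKernelD₂, norm_mul, norm_mul, norm_mul, norm_real, Real.norm_of_nonneg hk.le]
    have h7 := norm_sdCos_le p
    calc _ ≤ (4 / |Real.cos (k * h)| * X * Real.exp (-(k * (2 * h - y.2) * p ^ 2)) * 1) *
          (k * (1 + p ^ 2) * Real.exp (k * x.2 * p ^ 2)) := by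
            gcongr; exact h1.trans (by gcongr)
      _ = k * (4 / |Real.cos (k * h)| * X * ((1 + p ^ 2) *
          (Real.exp (-(k * (2 * h - y.2) * p ^ 2)) * Real.exp (k * x.2 * p ^ 2)))) := by ring
      _ = _ := by rw [he]

/-! ### Joint continuity of the kernel and of its derivative -/

section continuity
variable {k h : ℝ} (hk : 0 < k) (hh : 0 < h) (hc : Real.cos (k * h) ≠ 0)
include hk hh hc

lemma continuous_inv_periodDenom : Continuous fun p => (periodDenom k h p)⁻¹ := by
  refine Continuous.inv₀ ?_ (periodDenom_ne_zero (by positivity) hc)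
  unfold periodDenom sdExp
  fun_prop

lemma continuous_baseKernel (y : ℝ × ℝ) :
    Continuous fun a : ℝ × ℝ => baseKernel k h y a.1 a.2 := by
  have h1 : Continuous fun a : ℝ × ℝ => (periodDenom k h a.2)⁻¹ :=
    (continuous_inv_periodDenom hk hh hc).comp continuous_snd
  have h2 : Continuous fun a : ℝ × ℝ => (sdRoot a.2)⁻¹ :=
    continuous_inv_sdRoot.comp continuous_snd
  unfold baseKernel sdExp
  fun_prop

lemma continuous_regKernel (y : ℝ × ℝ) :
    Continuous fun a : (ℝ × ℝ) × ℝ => regKernel k h y a.1 a.2 := by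
  have h1 : Continuous fun a : (ℝ × ℝ) × ℝ => baseKernel k h y a.1.1 a.2 :=
    (continuous_baseKernel hk hh hc y).comp
      (f := fun a : (ℝ × ℝ) × ℝ => (a.1.1, a.2)) (by fun_prop)
  unfold regKernel
  fun_prop

lemma continuous_regKernelD (y : ℝ × ℝ) :
    Continuous fun a : (ℝ × ℝ) × ℝ => regKernelD k h y a.1 a.2 := by
  have h1 : Continuous fun a : (ℝ × ℝ) × ℝ => baseKernel k h y a.1.1 a.2 :=
    (continuous_baseKernel hk hh hc y).comp
      (f := fun a : (ℝ × ℝ) × ℝ => (a.1.1, a.2)) (by fun_prop)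
  have h2 := continuous_regKernel hk hh hc y
  have h3 : Continuous fun a : (ℝ × ℝ) × ℝ => regKernelD₁ k h y a.1 a.2 := by
    unfold regKernelD₁; fun_prop
  have h4 : Continuous fun a : (ℝ × ℝ) × ℝ => regKernelD₂ k h y a.1 a.2 := by
    unfold regKernelD₂; fun_prop
  unfold regKernelD
  exact ((ContinuousLinearMap.smulRightL ℝ (ℝ × ℝ) ℂ
      (ContinuousLinearMap.fst ℝ ℝ ℝ)).continuous.comp h3).add
    ((ContinuousLinearMap.smulRightL ℝ (ℝ × ℝ) ℂ
      (ContinuousLinearMap.snd ℝ ℝ ℝ)).continuous.comp h4)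

end continuity

/-- A bound of the kernel that is locally uniform in `x`. -/
def localBound (k h : ℝ) (y : ℝ × ℝ) (A p : ℝ) : ℝ :=
  4 / |Real.cos (k * h)| * Real.exp (k * A) *
    ((1 + p ^ 2) * Real.exp (-(k * (h - y.2) * p ^ 2)))

/-- For a fixed source below the upper wall the exponent `2h - x₂ - y₂ ≥ h - y₂` stays positive up
to `x₂ = h`, and `|Im q| ≤ 1` bounds the horizontal factor. This is the dominating function for
differentiation under the integral. -/
lemma kernelBound_le_localBound {k h : ℝ} (hk : 0 < k) {y x : ℝ × ℝ}
    (hx : x.2 ≤ h) {A : ℝ} (hA : |x.1 - y.1| ≤ A) (p : ℝ) :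
    kernelBound k h y x p ≤ localBound k h y A p := by
  unfold kernelBound localBound
  have h1 : k * (x.1 - y.1) * (sdSin p).im ≤ k * A := by
    rw [mul_assoc]
    refine mul_le_mul_of_nonneg_left ?_ hk.le
    calc _ ≤ |(x.1 - y.1) * (sdSin p).im| := le_abs_self _
      _ = |x.1 - y.1| * |(sdSin p).im| := abs_mul _ _
      _ ≤ A * 1 := mul_le_mul hA (abs_sdSin_im_le_one p) (abs_nonneg _) ((abs_nonneg _).trans hA)
      _ = A := mul_one _
  have h2 : h - y.2 ≤ 2 * h - x.2 - y.2 := by linarith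
  gcongr

lemma integrable_localBound {k h : ℝ} (hk : 0 < k) {y : ℝ × ℝ} (hy : y.2 < h) (A : ℝ) :
    Integrable (localBound k h y A) :=
  (integrable_one_add_sq_mul_exp (mul_pos hk (sub_pos.2 hy))).const_mul _

lemma norm_regKernelD_le {k h : ℝ} (hk : 0 < k) (hh : 0 < h) (hc : Real.cos (k * h) ≠ 0)
    {y x : ℝ × ℝ} (hy : 0 ≤ y.2) (hx : 0 ≤ x.2) (p : ℝ) :
    ‖regKernelD k h y x p‖ ≤ 2 * k * kernelBound k h y x p := by
  obtain ⟨-, h1, h2⟩ := kernel_bounds hk hh hc hy hx p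
  unfold regKernelD
  refine (norm_add_le _ _).trans ?_
  rw [ContinuousLinearMap.norm_smulRight_apply, ContinuousLinearMap.norm_smulRight_apply]
  have h3 := ContinuousLinearMap.norm_fst_le ℝ ℝ ℝ
  have h4 := ContinuousLinearMap.norm_snd_le ℝ ℝ ℝ
  calc _ ≤ 1 * (k * kernelBound k h y x p) + 1 * (k * kernelBound k h y x p) := by gcongr
    _ = _ := by ring

/-! ### Differentiability of the regular part in the strip -/

section regularity
variable {k h : ℝ} (hk : 0 < k) (hh : 0 < h) (hc : Real.cos (k * h) ≠ 0)
  {y : ℝ × ℝ} (hy : y ∈ strip h)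
include hk hh hc hy

lemma integrable_regKernel {x : ℝ × ℝ} (hx0 : 0 ≤ x.2) (hx : x.2 ≤ h) :
    Integrable (regKernel k h y x) :=
  (integrable_localBound hk hy.2 |x.1 - y.1|).mono'
    ((continuous_regKernel hk hh hc y).comp (by fun_prop :
      Continuous fun p : ℝ => (x, p))).aestronglyMeasurable
    (ae_of_all _ fun p => (kernel_bounds hk hh hc hy.1.le hx0 p).1.trans
      (kernelBound_le_localBound hk hx le_rfl p))

lemma integrable_regKernelD {x : ℝ × ℝ} (hx0 : 0 ≤ x.2) (hx : x.2 ≤ h) :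
    Integrable (regKernelD k h y x) :=
  ((integrable_localBound hk hy.2 |x.1 - y.1|).const_mul (2 * k)).mono'
    ((continuous_regKernelD hk hh hc y).comp (by fun_prop :
      Continuous fun p : ℝ => (x, p))).aestronglyMeasurable
    (ae_of_all _ fun p => (norm_regKernelD_le hk hh hc hy.1.le hx0 p).trans
      (mul_le_mul_of_nonneg_left (kernelBound_le_localBound hk hx le_rfl p) (by positivity)))

omit hk hh hc hy in
lemma strip_inter_mem_nhds {x : ℝ × ℝ} (hx : x ∈ strip h) :
    {z : ℝ × ℝ | (0 < z.2 ∧ z.2 < h) ∧ |z.1 - y.1| < |x.1 - y.1| + 1} ∈ 𝓝 x := by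
  refine IsOpen.mem_nhds (IsOpen.inter (IsOpen.inter ?_ ?_) ?_) ⟨hx, by simp⟩
  · exact isOpen_lt continuous_const continuous_snd
  · exact isOpen_lt continuous_snd continuous_const
  · exact isOpen_lt (continuous_fst.sub continuous_const).abs continuous_const

lemma hasFDerivAt_regPart {x : ℝ × ℝ} (hx : x ∈ strip h) :
    HasFDerivAt (fun x => regPart k h x y)
      (((2 * Real.pi : ℂ)⁻¹) • ∫ p, regKernelD k h y x p) x := by
  have h1 := hasFDerivAt_integral_of_dominated_of_fderiv_le (𝕜 := ℝ) (μ := volume)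
    (F := fun x p => regKernel k h y x p) (F' := fun x p => regKernelD k h y x p)
    (bound := fun p => 2 * k * localBound k h y (|x.1 - y.1| + 1) p)
    (strip_inter_mem_nhds (y := y) hx)
    (Eventually.of_forall fun z => ((continuous_regKernel hk hh hc y).comp (by fun_prop :
      Continuous fun p : ℝ => (z, p))).aestronglyMeasurable)
    (integrable_regKernel hk hh hc hy hx.1.le hx.2.le)
    (((continuous_regKernelD hk hh hc y).comp (by fun_prop :
      Continuous fun p : ℝ => (x, p))).aestronglyMeasurable)
    (ae_of_all _ fun p z hz => (norm_regKernelD_le hk hh hc hy.1.le hz.1.1.le p).trans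
      (mul_le_mul_of_nonneg_left (kernelBound_le_localBound hk hz.1.2.le hz.2.le p)
        (by positivity)))
    ((integrable_localBound hk hy.2 _).const_mul (2 * k))
    (ae_of_all _ fun p z _ => hasFDerivAt_regKernel k h y z p)
  exact h1.const_mul ((2 * Real.pi : ℂ)⁻¹)

lemma continuousOn_fderiv_regPart :
    ContinuousOn (fun x => ∫ p, regKernelD k h y x p) (strip h) := fun x hx => by
  refine ContinuousAt.continuousWithinAt ?_
  refine continuousAt_of_dominated
    (bound := fun p => 2 * k * localBound k h y (|x.1 - y.1| + 1) p)
    (Eventually.of_forall fun z => ((continuous_regKernelD hk hh hc y).comp (by fun_prop :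
      Continuous fun p : ℝ => (z, p))).aestronglyMeasurable) ?_
    ((integrable_localBound hk hy.2 _).const_mul (2 * k)) ?_
  · filter_upwards [strip_inter_mem_nhds (y := y) hx] with z hz
    exact ae_of_all _ fun p => (norm_regKernelD_le hk hh hc hy.1.le hz.1.1.le p).trans
      (mul_le_mul_of_nonneg_left (kernelBound_le_localBound hk hz.1.2.le hz.2.le p)
        (by positivity))
  · exact ae_of_all _ fun p => ((continuous_regKernelD hk hh hc y).comp (by fun_prop :
      Continuous fun z : ℝ × ℝ => (z, p))).continuousAt

omit hk hh hc hy in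
lemma isOpen_strip : IsOpen (strip h) :=
  (isOpen_lt continuous_const continuous_snd).inter (isOpen_lt continuous_snd continuous_const)

lemma contDiffOn_regPart : ContDiffOn ℝ 1 (fun x => regPart k h x y) (strip h) := by
  rw [show (1 : WithTop ℕ∞) = 0 + 1 by simp, contDiffOn_succ_iff_fderiv_of_isOpen isOpen_strip]
  refine ⟨fun x hx => (hasFDerivAt_regPart hk hh hc hy hx).differentiableAt.differentiableWithinAt,
    by simp, ?_⟩
  rw [contDiffOn_zero]
  refine ContinuousOn.congr ?_ fun x hx => (hasFDerivAt_regPart hk hh hc hy hx).fderiv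
  exact (continuousOn_fderiv_regPart hk hh hc hy).const_smul ((2 * Real.pi : ℂ)⁻¹)

end regularity

/-! ### The estimate of the regular part on the search domain -/

/-- The constant of the estimates. -/
def boundIntegral (c₁ c₂ : ℝ) : ℝ :=
  ∫ u : ℝ, (1 + u ^ 2) * Real.exp (c₂ * |u| - 2 * (1 - c₁) * u ^ 2)

/-- Half of the Gaussian absorbs `c₂|u|` by completing the square, at the cost of the constant
`exp(c₂²/(4(1 - c₁)))`. -/
lemma integrable_boundIntegrand {c₁ : ℝ} (hc₁ : c₁ < 1) (c₂ : ℝ) :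
    Integrable fun u : ℝ => (1 + u ^ 2) * Real.exp (c₂ * |u| - 2 * (1 - c₁) * u ^ 2) := by
  have hb : 0 < 1 - c₁ := by linarith
  refine ((integrable_one_add_sq_mul_exp hb).const_mul
    (Real.exp (c₂ ^ 2 / (4 * (1 - c₁))))).mono' (Continuous.aestronglyMeasurable (by fun_prop))
    (ae_of_all _ fun u => ?_)
  rw [Real.norm_of_nonneg (by positivity)]
  have h1 : c₂ * |u| - 2 * (1 - c₁) * u ^ 2 ≤
      c₂ ^ 2 / (4 * (1 - c₁)) + -((1 - c₁) * u ^ 2) := by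
    have h2 : c₂ ^ 2 / (4 * (1 - c₁)) - c₂ * |u| + (1 - c₁) * u ^ 2 =
        (c₂ - 2 * (1 - c₁) * |u|) ^ 2 / (4 * (1 - c₁)) := by
      rw [← sq_abs u]
      field_simp
      ring
    have h3 : 0 ≤ (c₂ - 2 * (1 - c₁) * |u|) ^ 2 / (4 * (1 - c₁)) := by positivity
    linarith
  calc _ ≤ (1 + u ^ 2) * Real.exp (c₂ ^ 2 / (4 * (1 - c₁)) + -((1 - c₁) * u ^ 2)) := by gcongr
    _ = _ := by rw [Real.exp_add]; ring

section estimates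
variable {k h c₁ c₂ : ℝ} (hk : 0 < k) (hkh : 1 ≤ k * h)
  {x y : ℝ × ℝ} (hxy : k * |x.1 - y.1| ≤ c₂ * √(k * h))
  (hx2 : x.2 ≤ c₁ * h) (hy2 : y.2 ≤ c₁ * h)
include hk hkh hxy hx2 hy2

/-- The scaling `u = √(kh) p`: the width condition with `|Im q| ≤ |p|` bounds the horizontal
exponent by `c₂|u|`, the heights give the Gaussian `exp(-2(1 - c₁)u²)`, and `1 + p² ≤ 1 + u²`
because `kh ≥ 1`. -/
lemma kernelBound_le (p : ℝ) :
    kernelBound k h y x p ≤ 4 / |Real.cos (k * h)| * ((1 + (√(k * h) * p) ^ 2) *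
      Real.exp (c₂ * |√(k * h) * p| - 2 * (1 - c₁) * (√(k * h) * p) ^ 2)) := by
  have hs : (√(k * h)) ^ 2 = k * h := Real.sq_sqrt (by linarith)
  have hs0 := Real.sqrt_nonneg (k * h)
  unfold kernelBound
  rw [mul_pow, hs, abs_mul, abs_of_nonneg hs0, mul_assoc]
  refine mul_le_mul_of_nonneg_left ?_ (by positivity)
  rw [mul_left_comm, ← Real.exp_add]
  refine mul_le_mul ?_ (Real.exp_le_exp.2 ?_) (Real.exp_pos _).le (by positivity)
  · nlinarith [sq_nonneg p]
  · have h1 : k * (x.1 - y.1) * (sdSin p).im ≤ c₂ * (√(k * h) * |p|) := by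
      calc _ ≤ |k * (x.1 - y.1) * (sdSin p).im| := le_abs_self _
        _ = k * |x.1 - y.1| * |(sdSin p).im| := by rw [abs_mul, abs_mul, abs_of_pos hk]
        _ ≤ (c₂ * √(k * h)) * |p| := mul_le_mul hxy (abs_sdSin_im_le_abs p) (abs_nonneg _)
            (le_trans (by positivity) hxy)
        _ = _ := by ring
    have h2 : 2 * (1 - c₁) * (k * h * p ^ 2) ≤ k * (2 * h - x.2 - y.2) * p ^ 2 := by
      have : 2 * (1 - c₁) * h ≤ 2 * h - x.2 - y.2 := by linarith
      calc 2 * (1 - c₁) * (k * h * p ^ 2) = k * (2 * (1 - c₁) * h) * p ^ 2 := by ring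
        _ ≤ _ := by gcongr
    linarith

lemma norm_integral_le_boundIntegral (hc₁ : c₁ < 1) {f : ℝ → ℂ} {a : ℝ} (ha : 0 ≤ a)
    (hf : ∀ p, ‖f p‖ ≤ a * kernelBound k h y x p) :
    ‖∫ p, f p‖ ≤ a * (4 * boundIntegral c₁ c₂ / (|Real.cos (k * h)| * √(k * h))) := by
  set l := √(k * h) with hl
  have hl0 : 0 < l := Real.sqrt_pos.2 (by linarith)
  have hi := (((integrable_boundIntegrand hc₁ c₂).comp_mul_left' hl0.ne').const_mul
    (4 / |Real.cos (k * h)|)).const_mul a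
  refine (norm_integral_le_of_norm_le hi (ae_of_all _ fun p => (hf p).trans
    (mul_le_mul_of_nonneg_left (kernelBound_le hk hkh hxy hx2 hy2 p) ha))).trans (le_of_eq ?_)
  rw [integral_const_mul, integral_const_mul, Measure.integral_comp_mul_left
    (fun u : ℝ => (1 + u ^ 2) * Real.exp (c₂ * |u| - 2 * (1 - c₁) * u ^ 2)), ← boundIntegral,
    abs_of_pos (inv_pos.2 hl0), smul_eq_mul]
  rw [div_eq_mul_inv, div_eq_mul_inv, mul_inv]
  ring

omit hk hkh hxy hx2 hy2 in
lemma norm_inv_two_pi_mul_le (z : ℂ) : ‖(2 * Real.pi : ℂ)⁻¹ * z‖ ≤ ‖z‖ := by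
  rw [norm_mul]
  refine mul_le_of_le_one_left (norm_nonneg _) ?_
  rw [norm_inv]
  apply inv_le_one_of_one_le₀
  simp [abs_of_pos Real.pi_pos]
  linarith [Real.pi_gt_three]

lemma norm_regPart_le (hc₁ : c₁ < 1) (hc : Real.cos (k * h) ≠ 0) (hx : x ∈ strip h)
    (hy : y ∈ strip h) :
    ‖regPart k h x y‖ ≤ 4 * boundIntegral c₁ c₂ / (|Real.cos (k * h)| * √(k * h)) := by
  have hh : 0 < h := hx.1.trans hx.2
  have h1 := norm_integral_le_boundIntegral hk hkh hxy hx2 hy2 hc₁ zero_le_one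
    (f := regKernel k h y x)
    (fun p => by rw [one_mul]; exact (kernel_bounds hk hh hc hy.1.le hx.1.le p).1)
  rw [one_mul] at h1
  exact (norm_inv_two_pi_mul_le _).trans h1

lemma gradNorm_regPart_le (hc₁ : c₁ < 1) (hc : Real.cos (k * h) ≠ 0) (hx : x ∈ strip h)
    (hy : y ∈ strip h) :
    gradNorm (fun z => regPart k h z y) x ≤
      2 * (k * (4 * boundIntegral c₁ c₂ / (|Real.cos (k * h)| * √(k * h)))) := by
  have hh : 0 < h := hx.1.trans hx.2
  have hint := integrable_regKernelD hk hh hc hy hx.1.le hx.2.le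
  have h1 := norm_integral_le_boundIntegral hk hkh hxy hx2 hy2 hc₁ hk.le
    (f := regKernelD₁ k h y x) (fun p => (kernel_bounds hk hh hc hy.1.le hx.1.le p).2.1)
  have h2 := norm_integral_le_boundIntegral hk hkh hxy hx2 hy2 hc₁ hk.le
    (f := regKernelD₂ k h y x) (fun p => (kernel_bounds hk hh hc hy.1.le hx.1.le p).2.2)
  have e : ∀ v, fderiv ℝ (fun z => regPart k h z y) x v =
      (2 * Real.pi : ℂ)⁻¹ * ∫ p, regKernelD k h y x p v := fun v => by
    rw [(hasFDerivAt_regPart hk hh hc hy hx).fderiv, _root_.smul_apply,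
      ContinuousLinearMap.integral_apply hint, smul_eq_mul]
  have e1 : ‖fderiv ℝ (fun z => regPart k h z y) x (1, 0)‖ ≤
      k * (4 * boundIntegral c₁ c₂ / (|Real.cos (k * h)| * √(k * h))) := by
    rw [e]
    refine (norm_inv_two_pi_mul_le _).trans (le_trans (le_of_eq ?_) h1)
    simp [regKernelD]
  have e2 : ‖fderiv ℝ (fun z => regPart k h z y) x (0, 1)‖ ≤
      k * (4 * boundIntegral c₁ c₂ / (|Real.cos (k * h)| * √(k * h))) := by
    rw [e]
    refine (norm_inv_two_pi_mul_le _).trans (le_trans (le_of_eq ?_) h2)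
    simp [regKernelD]
  rw [gradNorm]
  refine Real.sqrt_le_iff.2 ⟨by linarith [(norm_nonneg _).trans e1], ?_⟩
  have n1 := norm_nonneg (fderiv ℝ (fun z => regPart k h z y) x (1, 0))
  have n2 := norm_nonneg (fderiv ℝ (fun z => regPart k h z y) x (0, 1))
  nlinarith

end estimates

/-! ### The one-dimensional Green function -/

/-- The Green function of `d²/dt² + κ²` on `(0, h)`, vanishing at `0` and with vanishing derivative
at `h`, multiplied by `2 i κ`. -/
def sectionGreen (κ : ℂ) (h y t : ℝ) : ℂ :=
  cexp (I * κ * |t - y|) - cexp (I * κ * (t + y)) -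
    4 * cexp (2 * I * κ * h) * (1 + cexp (2 * I * κ * h))⁻¹ * Complex.sin (κ * y) *
      Complex.sin (κ * t)

lemma sin_eq_exp (z : ℂ) : Complex.sin z = ((cexp (I * z))⁻¹ - cexp (I * z)) * I / 2 := by
  rw [Complex.sin, ← Complex.exp_neg]
  ring_nf

lemma cos_eq_exp (z : ℂ) : Complex.cos z = ((cexp (I * z))⁻¹ + cexp (I * z)) / 2 := by
  rw [Complex.cos, ← Complex.exp_neg]
  ring_nf

/-- The algebra of the next lemmas, for `a = exp(iκy)`, `b = exp(iκt)` and `H = exp(iκh)`. -/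
lemma sectionGreen_aux {a b H : ℂ} (ha : a ≠ 0) (hb : b ≠ 0) (hH : H ≠ 0) (hD : 1 + H ^ 2 ≠ 0) :
    a / b - b * a - 4 * H ^ 2 * (1 + H ^ 2)⁻¹ * ((a⁻¹ - a) * I / 2) * ((b⁻¹ - b) * I / 2) =
      -2 * I * (((H / a)⁻¹ + H / a) / 2) * ((H⁻¹ + H) / 2)⁻¹ * ((b⁻¹ - b) * I / 2) := by
  have hH2 : H⁻¹ + H ≠ 0 := by
    intro h
    apply hD
    field_simp at h
    linear_combination h
  field_simp
  rw [I_sq]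
  ring

lemma cos_ne_zero_of_one_add {κ : ℂ} {h : ℝ} (hD : 1 + cexp (2 * I * κ * h) ≠ 0) :
    Complex.cos (κ * h) ≠ 0 := by
  intro hc
  apply hD
  rw [cos_eq_exp] at hc
  have he := Complex.exp_ne_zero (I * (κ * h))
  have h2 : cexp (2 * I * κ * h) = cexp (I * (κ * h)) ^ 2 := by
    rw [← Complex.exp_nat_mul]; congr 1; push_cast; ring
  rw [h2]
  generalize cexp (I * (κ * h)) = H at *
  field_simp at hc
  linear_combination hc

/-- The image form collapses to the product form, in which the wall conditions are visible: a sine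
vanishing at `0` below the source and, by symmetry, a cosine flat at `h` above it. -/
lemma sectionGreen_of_le {κ : ℂ} {h y t : ℝ} (hD : 1 + cexp (2 * I * κ * h) ≠ 0) (hty : t ≤ y) :
    sectionGreen κ h y t = -2 * I * Complex.cos (κ * (h - y)) * (Complex.cos (κ * h))⁻¹ *
      Complex.sin (κ * t) := by
  have h2 : cexp (2 * I * κ * h) = cexp (I * (κ * h)) ^ 2 := by
    rw [← Complex.exp_nat_mul]; congr 1; push_cast; ring
  have h3 : cexp (I * (κ * (h - y))) = cexp (I * (κ * h)) / cexp (I * (κ * y)) := by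
    rw [← Complex.exp_sub]; congr 1; ring
  have h4 : cexp (I * κ * |t - y|) = cexp (I * (κ * y)) / cexp (I * (κ * t)) := by
    rw [← Complex.exp_sub, abs_of_nonpos (by linarith)]; congr 1; push_cast; ring
  have h5 : cexp (I * κ * (t + y)) = cexp (I * (κ * t)) * cexp (I * (κ * y)) := by
    rw [← Complex.exp_add]; congr 1; ring
  rw [h2] at hD
  rw [sectionGreen, cos_eq_exp, cos_eq_exp, sin_eq_exp (κ * t), sin_eq_exp (κ * y), h2, h3, h4, h5]
  exact sectionGreen_aux (Complex.exp_ne_zero _) (Complex.exp_ne_zero _) (Complex.exp_ne_zero _) hD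

lemma sectionGreen_symm (κ : ℂ) (h y t : ℝ) : sectionGreen κ h y t = sectionGreen κ h t y := by
  simp only [sectionGreen, abs_sub_comm t y, add_comm (t : ℂ) y]
  ring

/-- As `cos(mh) = 0`, `sin(mt)` is an eigenfunction of the cross-section, so the resolvent kernel
acts on it by the scalar `1/(κ² - m²)`. The check integrates explicitly on each side of `y`. -/
lemma integral_sectionGreen_mul_sin {κ : ℂ} {h y m : ℝ} (hy0 : 0 ≤ y) (hyh : y ≤ h)
    (hD : 1 + cexp (2 * I * κ * h) ≠ 0) (hm : Real.cos (m * h) = 0) (hκ : κ ^ 2 - m ^ 2 ≠ 0) :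
    ∫ t in (0 : ℝ)..h, sectionGreen κ h y t * (Real.sin (m * t) : ℂ) =
      2 * I * κ * (Real.sin (m * y) : ℂ) / (κ ^ 2 - m ^ 2) := by
  have hc := cos_ne_zero_of_one_add hD
  have hm' : (m : ℂ) ^ 2 - κ ^ 2 ≠ 0 := fun h' => hκ (by linear_combination -h')
  have d0 : ∀ t : ℝ, HasDerivAt (fun t : ℝ => κ * t) κ t := fun t => by
    simpa using ((hasDerivAt_id t).ofReal_comp).const_mul κ
  have d1 : ∀ t : ℝ, HasDerivAt (fun t : ℝ => (m : ℂ) * t) m t := fun t => by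
    simpa using ((hasDerivAt_id t).ofReal_comp).const_mul (m : ℂ)
  have d2 : ∀ t : ℝ, HasDerivAt (fun t : ℝ => κ * ((h : ℂ) - t)) (-κ) t := fun t => by
    simpa using (((hasDerivAt_id t).ofReal_comp).const_sub (h : ℂ)).const_mul κ
  have F1 : ∀ t : ℝ, HasDerivAt (fun t : ℝ => (κ * Complex.cos (κ * t) * Complex.sin (m * t) -
      m * Complex.sin (κ * t) * Complex.cos (m * t)) / (m ^ 2 - κ ^ 2))
      (Complex.sin (κ * t) * Complex.sin (m * t)) t := fun t => by
    have e := ((((((hasDerivAt_cos _).comp t (d0 t)).const_mul κ).mul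
      ((hasDerivAt_sin _).comp t (d1 t))).sub
      ((((hasDerivAt_sin _).comp t (d0 t)).const_mul (m : ℂ)).mul
      ((hasDerivAt_cos _).comp t (d1 t))))).div_const ((m : ℂ) ^ 2 - κ ^ 2)
    refine e.congr_deriv ?_
    simp only [Function.comp]
    field_simp
    ring
  have F2 : ∀ t : ℝ, HasDerivAt (fun t : ℝ => (κ * Complex.sin (κ * (h - t)) * Complex.sin (m * t) -
      m * Complex.cos (κ * (h - t)) * Complex.cos (m * t)) / (m ^ 2 - κ ^ 2))
      (Complex.cos (κ * (h - t)) * Complex.sin (m * t)) t := fun t => by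
    have e := ((((((hasDerivAt_sin _).comp t (d2 t)).const_mul κ).mul
      ((hasDerivAt_sin _).comp t (d1 t))).sub
      ((((hasDerivAt_cos _).comp t (d2 t)).const_mul (m : ℂ)).mul
      ((hasDerivAt_cos _).comp t (d1 t))))).div_const ((m : ℂ) ^ 2 - κ ^ 2)
    refine e.congr_deriv ?_
    simp only [Function.comp]
    field_simp
    ring
  have i1 := intervalIntegral.integral_eq_sub_of_hasDerivAt (a := 0) (b := y)
    (fun t _ => F1 t) (Continuous.intervalIntegrable (by fun_prop) _ _)
  have i2 := intervalIntegral.integral_eq_sub_of_hasDerivAt (a := y) (b := h)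
    (fun t _ => F2 t) (Continuous.intervalIntegrable (by fun_prop) _ _)
  have hcont : Continuous fun t : ℝ => sectionGreen κ h y t * (Real.sin (m * t) : ℂ) := by
    unfold sectionGreen; fun_prop
  rw [← intervalIntegral.integral_add_adjacent_intervals (b := y)
    (hcont.intervalIntegrable _ _) (hcont.intervalIntegrable _ _)]
  have j1 : ∫ t in (0 : ℝ)..y, sectionGreen κ h y t * (Real.sin (m * t) : ℂ) =
      (-2 * I * Complex.cos (κ * (h - y)) * (Complex.cos (κ * h))⁻¹) *
        ∫ t in (0 : ℝ)..y, Complex.sin (κ * t) * Complex.sin (m * t) := by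
    rw [← intervalIntegral.integral_const_mul]
    refine intervalIntegral.integral_congr fun t ht => ?_
    rw [uIcc_of_le hy0] at ht
    rw [sectionGreen_of_le hD ht.2]
    push_cast
    ring
  have j2 : ∫ t in y..h, sectionGreen κ h y t * (Real.sin (m * t) : ℂ) =
      (-2 * I * (Complex.cos (κ * h))⁻¹ * Complex.sin (κ * y)) *
        ∫ t in y..h, Complex.cos (κ * (h - t)) * Complex.sin (m * t) := by
    rw [← intervalIntegral.integral_const_mul]
    refine intervalIntegral.integral_congr fun t ht => ?_
    rw [uIcc_of_le hyh] at ht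
    rw [sectionGreen_symm, sectionGreen_of_le hD ht.1]
    push_cast
    ring
  have hmc : Complex.cos ((m : ℂ) * h) = 0 := by
    rw [← ofReal_mul, ← ofReal_cos, hm, ofReal_zero]
  rw [j1, j2, i1, i2]
  simp only [ofReal_zero, mul_zero, Complex.sin_zero, Complex.cos_zero, sub_self, hmc]
  -- The terms with `cos(my)` from the two sides cancel; those with `sin(my)` combine to `cos(κh)`,
  -- the Wronskian, by the addition formula.
  have hadd : Complex.cos (κ * (h - y)) * Complex.cos (κ * y) -
      Complex.sin (κ * (h - y)) * Complex.sin (κ * y) = Complex.cos (κ * h) := by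
    rw [← Complex.cos_add]; congr 1; ring
  push_cast
  generalize Complex.sin (m * y) = A
  generalize Complex.cos (m * y) = B
  field_simp
  linear_combination κ * A * (m ^ 2 - κ ^ 2) * hadd

/-! ### The modes of `S + G` -/

lemma sdExp_eq_mul (x z p : ℝ) : sdExp x z p = sdExp x 0 p * sdExp 0 z p := by
  rw [sdExp, sdExp, sdExp, ← Complex.exp_add]
  congr 1
  push_cast
  ring

lemma halfSpaceGreen_eq {k : ℝ} (hk : 0 < k) {x y : ℝ × ℝ} (hx : 0 ≤ x.2) (hy : 0 < y.2)
    (hxy : x.2 ≠ y.2) :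
    halfSpaceGreen k x y = (2 * Real.pi : ℂ)⁻¹ *
      ∫ p, (sdExp (k * (x.1 - y.1)) (k * |x.2 - y.2|) p -
        sdExp (k * (x.1 - y.1)) (k * (x.2 + y.2)) p) * (sdRoot p)⁻¹ := by
  have h1 : 0 < |x.2 - y.2| := abs_pos.2 (sub_ne_zero.2 hxy)
  have h2 : 0 < x.2 + y.2 := by linarith
  have e1 := hankelH0_eq_integral_sdExp (x := x.1 - y.1) hk h1
  have e2 := hankelH0_eq_integral_sdExp (x := x.1 - y.1) hk h2
  rw [sq_abs] at e1
  rw [halfSpaceGreen, euclDist, euclDist]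
  simp only [sub_neg_eq_add]
  rw [e1, e2, ← mul_sub, ← integral_sub (integrable_sdExp_div _ (mul_pos hk h1))
    (integrable_sdExp_div _ (mul_pos hk h2))]
  simp only [sub_mul]

lemma exp_sdCos_eq (z p : ℝ) (k : ℝ) : cexp (I * (k * sdCos p) * z) = sdExp 0 (k * z) p := by
  rw [sdExp]; congr 1; push_cast; ring

lemma exp_two_sdCos_eq (k h p : ℝ) :
    cexp (2 * I * (k * sdCos p) * h) = sdExp 0 (2 * (k * h)) p := by
  rw [sdExp]; congr 1; push_cast; ring

/-- The integrand of the path integral of `S + G`. -/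
def fullKernel (k h X y t p : ℝ) : ℂ :=
  sdExp (k * X) 0 p * (sdRoot p)⁻¹ * sectionGreen (k * sdCos p) h y t

lemma fullKernel_eq (k h : ℝ) (x y : ℝ × ℝ) (p : ℝ) :
    fullKernel k h (x.1 - y.1) y.2 x.2 p =
      (sdExp (k * (x.1 - y.1)) (k * |x.2 - y.2|) p -
        sdExp (k * (x.1 - y.1)) (k * (x.2 + y.2)) p) * (sdRoot p)⁻¹ + regKernel k h y x p := by
  rw [fullKernel, sectionGreen, exp_two_sdCos_eq, exp_sdCos_eq,
    show ((x.2 : ℂ) + y.2) = ((x.2 + y.2 : ℝ) : ℂ) by push_cast; ring, exp_sdCos_eq,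
    regKernel, baseKernel, periodDenom, sdExp_eq_mul (k * (x.1 - y.1)) (k * |x.2 - y.2|),
    sdExp_eq_mul (k * (x.1 - y.1)) (k * (x.2 + y.2)), sdExp_eq_mul (k * (x.1 - y.1)) (2 * (k * h))]
  ring

/-- The candidate for the Green function of the waveguide: `S + G`. -/
def modelGreen (k h : ℝ) (y x : ℝ × ℝ) : ℂ := regPart k h x y + halfSpaceGreen k x y

section modes
variable {k h : ℝ} (hk : 0 < k) (hh : 0 < h) (hc : Real.cos (k * h) ≠ 0)
  {y : ℝ × ℝ} (hy : y ∈ strip h)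
include hk hh hc hy

lemma modelGreen_eq {x : ℝ × ℝ} (hx0 : 0 ≤ x.2) (hx : x.2 ≤ h) (hxy : x.2 ≠ y.2) :
    modelGreen k h y x = (2 * Real.pi : ℂ)⁻¹ * ∫ p, fullKernel k h (x.1 - y.1) y.2 x.2 p := by
  have h1 : 0 < |x.2 - y.2| := abs_pos.2 (sub_ne_zero.2 hxy)
  have h2 : 0 < x.2 + y.2 := by linarith [hy.1]
  have hi : Integrable fun p => (sdExp (k * (x.1 - y.1)) (k * |x.2 - y.2|) p -
        sdExp (k * (x.1 - y.1)) (k * (x.2 + y.2)) p) * (sdRoot p)⁻¹ := by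
    simp only [sub_mul]
    exact (integrable_sdExp_div _ (mul_pos hk h1)).sub (integrable_sdExp_div _ (mul_pos hk h2))
  rw [modelGreen, halfSpaceGreen_eq hk hx0 hy.1 hxy, regPart, ← mul_add, add_comm,
    ← integral_add hi (integrable_regKernel hk hh hc hy hx0 hx)]
  simp only [fullKernel_eq]

/-- The vertical lengths in the three terms, `|t - y₂|`, `t + y₂` and `2h - t - y₂`, are all at
least `|t - y₂|`, so the direct wave has the worst decay. -/
lemma norm_sectionGreen_le {t : ℝ} (ht0 : 0 ≤ t) (ht : t ≤ h) (p : ℝ) :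
    ‖sectionGreen (k * sdCos p) h y.2 t‖ ≤
      (2 + 4 / |Real.cos (k * h)|) * Real.exp (-(k * |t - y.2| * p ^ 2)) := by
  have hy1 := hy.1
  have hy2 := hy.2
  have b : ∀ z, |t - y.2| ≤ z → ‖sdExp 0 (k * z) p‖ ≤ Real.exp (-(k * |t - y.2| * p ^ 2)) :=
    fun z hz => by
      have := norm_sdExp_le 0 (k * z) p
      rw [abs_zero, Real.exp_zero, one_mul] at this
      refine this.trans (Real.exp_le_exp.2 ?_)
      have : k * |t - y.2| * p ^ 2 ≤ k * z * p ^ 2 := by gcongr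
      linarith
  have h1 := b _ le_rfl
  have h2 := b (t + y.2) (abs_le.2 ⟨by linarith, by linarith⟩)
  have h3 : ‖(1 + cexp (2 * I * (k * sdCos p) * h))⁻¹‖ ≤ |Real.cos (k * h)|⁻¹ := by
    rw [exp_two_sdCos_eq, norm_inv]
    exact inv_anti₀ (abs_pos.2 hc) (abs_cos_le_norm_periodDenom (by positivity) p)
  have h4 : ∀ z : ℝ, 0 ≤ z → ‖Complex.sin (k * sdCos p * z)‖ ≤ Real.exp (k * z * p ^ 2) :=
    fun z hz => by
      have := norm_sin_le_exp (k * sdCos p * z)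
      rwa [sdCos_mul_im, abs_of_nonneg (by positivity)] at this
  have h5 : ‖cexp (2 * I * (k * sdCos p) * h)‖ = Real.exp (-(2 * (k * h) * p ^ 2)) := by
    rw [exp_two_sdCos_eq, norm_sdExp]
    simp
  rw [sectionGreen, exp_sdCos_eq, show ((t : ℂ) + y.2) = ((t + y.2 : ℝ) : ℂ) by push_cast; ring,
    exp_sdCos_eq]
  have h6 : ‖4 * cexp (2 * I * (k * sdCos p) * h) * (1 + cexp (2 * I * (k * sdCos p) * h))⁻¹ *
      Complex.sin (k * sdCos p * y.2) * Complex.sin (k * sdCos p * t)‖ ≤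
      4 / |Real.cos (k * h)| * Real.exp (-(k * |t - y.2| * p ^ 2)) := by
    rw [norm_mul, norm_mul, norm_mul, norm_mul, h5, Complex.norm_ofNat]
    calc _ ≤ 4 * Real.exp (-(2 * (k * h) * p ^ 2)) * |Real.cos (k * h)|⁻¹ *
          Real.exp (k * y.2 * p ^ 2) * Real.exp (k * t * p ^ 2) := by
          gcongr
          · exact h4 _ hy1.le
          · exact h4 _ ht0
      _ = 4 / |Real.cos (k * h)| * (Real.exp (-(2 * (k * h) * p ^ 2)) *
          Real.exp (k * y.2 * p ^ 2) * Real.exp (k * t * p ^ 2)) := by ring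
      _ ≤ _ := by
        rw [← Real.exp_add, ← Real.exp_add]
        have h7 : |t - y.2| ≤ 2 * h - t - y.2 := abs_le.2 ⟨by linarith, by linarith⟩
        have h8 : k * |t - y.2| * p ^ 2 ≤ k * (2 * h - t - y.2) * p ^ 2 := by gcongr
        gcongr
        linarith
  refine (norm_sub_le _ _).trans ?_
  have h9 := norm_sub_le (sdExp 0 (k * |t - y.2|) p) (sdExp 0 (k * (t + y.2)) p)
  linarith

omit hy hc in
-- The exponential is traded for `z^(-1/2) (1 + p²)^(-1/2)` through `1 + x ≤ exp x`, and `ω⁻¹` gives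
-- another `(1 + p²)^(-1/2)`. The resulting majorant is a product of functions integrable in `z` and
-- in `p`.
lemma exp_mul_norm_inv_sdRoot_le {z : ℝ} (hz : 0 < z) (hzh : z ≤ h) (hkh : 1 ≤ k * h) (p : ℝ) :
    Real.exp (-(k * z * p ^ 2)) * ‖(sdRoot p)⁻¹‖ ≤
      √(2 * h) * z ^ (-(1 / 2) : ℝ) * (1 + p ^ 2)⁻¹ := by
  refine abs_le_of_sq_le_sq ?_ (by positivity) |> (le_abs_self _).trans
  have h1 : (z ^ (-(1 / 2) : ℝ)) ^ 2 = z⁻¹ := by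
    rw [← Real.rpow_natCast, ← Real.rpow_mul hz.le, ← Real.rpow_neg_one]
    norm_num
  rw [mul_pow, mul_pow, mul_pow, h1, Real.sq_sqrt (by positivity), ← Real.exp_nat_mul, norm_inv]
  have h2 : Real.exp ((2 : ℕ) * -(k * z * p ^ 2)) ≤ h * z⁻¹ * (1 + p ^ 2)⁻¹ := by
    rw [show ((2 : ℕ) : ℝ) * -(k * z * p ^ 2) = -(2 * (k * z * p ^ 2)) by push_cast; ring,
      Real.exp_neg]
    rw [show h * z⁻¹ * (1 + p ^ 2)⁻¹ = (z / h * (1 + p ^ 2))⁻¹ by field_simp]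
    apply inv_anti₀ (by positivity)
    have h3 := Real.add_one_le_exp (2 * (k * z * p ^ 2))
    have h4 : z / h ≤ 1 := (div_le_one hh).2 hzh
    have h5 : z / h ≤ k * z := by
      rw [div_le_iff₀ hh]
      nlinarith
    have h6 : z / h * p ^ 2 ≤ k * z * p ^ 2 := by gcongr
    have h7 : 0 ≤ k * z * p ^ 2 := by positivity
    linarith
  have h8 : (‖sdRoot p‖⁻¹) ^ 2 ≤ 2 * (1 + p ^ 2)⁻¹ := by
    have h9 := one_add_sq_le_norm_sdRoot p
    have h10 := one_le_norm_sdRoot p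
    rw [inv_pow, ← div_eq_mul_inv, inv_eq_one_div, div_le_div_iff₀ (by positivity) (by positivity)]
    linarith
  calc _ ≤ (h * z⁻¹ * (1 + p ^ 2)⁻¹) * (2 * (1 + p ^ 2)⁻¹) := by gcongr
    _ = _ := by ring

omit hk hh hc in
lemma integrableOn_abs_sub_rpow :
    IntegrableOn (fun t : ℝ => |t - y.2| ^ (-(1 / 2) : ℝ)) (Ioc 0 h) := by
  have h1 : IntervalIntegrable (fun t : ℝ => t ^ (-(1 / 2) : ℝ)) volume 0 y.2 :=
    intervalIntegral.intervalIntegrable_rpow' (by norm_num)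
  have h2 : IntervalIntegrable (fun t : ℝ => t ^ (-(1 / 2) : ℝ)) volume 0 (h - y.2) :=
    intervalIntegral.intervalIntegrable_rpow' (by norm_num)
  have h3 := (h1.comp_sub_left y.2).symm
  have h4 := h2.comp_sub_right y.2
  rw [sub_zero, sub_self, intervalIntegrable_iff_integrableOn_Ioc_of_le hy.1.le] at h3
  rw [zero_add, sub_add_cancel, intervalIntegrable_iff_integrableOn_Ioc_of_le hy.2.le] at h4
  rw [← Ioc_union_Ioc_eq_Ioc hy.1.le hy.2.le]
  refine IntegrableOn.union (h3.congr_fun (fun t ht => ?_) measurableSet_Ioc)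
    (h4.congr_fun (fun t ht => ?_) measurableSet_Ioc)
  · simp only
    rw [abs_of_nonpos (by linarith [ht.2])]; ring_nf
  · simp only
    rw [abs_of_nonneg (by linarith [ht.1])]

/-- Needed for Fubini. At `t = y₂` the direct wave has no exponential decay in `p` and `ω⁻¹` alone
is not integrable; only the joint bound in `(t, p)` is. -/
lemma integrable_fullKernel (hkh : 1 ≤ k * h) (X : ℝ) {g : ℝ → ℂ} (hg : Continuous g)
    (hg1 : ∀ t, ‖g t‖ ≤ 1) :
    Integrable (Function.uncurry fun t p => fullKernel k h X y.2 t p * g t)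
      ((volume.restrict (Ioc 0 h)).prod volume) := by
  set C := Real.exp |k * X| * (2 + 4 / |Real.cos (k * h)|) * √(2 * h)
  have hb := ((integrableOn_abs_sub_rpow hy).integrable.mul_prod
    integrable_inv_one_add_sq).const_mul C
  refine hb.mono' ?_ ?_
  · have c1 : Continuous fun a : ℝ × ℝ => sdExp (k * X) 0 a.2 * (sdRoot a.2)⁻¹ :=
      (continuous_sdExp.comp (f := fun a : ℝ × ℝ => (k * X, 0, a.2)) (by fun_prop)).mul
        (continuous_inv_sdRoot.comp continuous_snd)
    have c2 : Continuous fun a : ℝ × ℝ => (1 + cexp (2 * I * (k * sdCos a.2) * h))⁻¹ := by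
      simp only [exp_two_sdCos_eq]
      exact (continuous_inv_periodDenom hk hh hc).comp continuous_snd
    have c3 : Continuous fun a : ℝ × ℝ => sectionGreen (k * sdCos a.2) h y.2 a.1 := by
      unfold sectionGreen
      fun_prop
    exact ((c1.mul c3).mul (hg.comp continuous_fst)).aestronglyMeasurable
  · have hne : ∀ᵐ a : ℝ × ℝ ∂((volume.restrict (Ioc 0 h)).prod volume), a.1 ∈ Ioc 0 h ∧ a.1 ≠ y.2 := by
      have h1 : ∀ᵐ t : ℝ ∂(volume.restrict (Ioc 0 h)), t ∈ Ioc 0 h ∧ t ≠ y.2 := by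
        filter_upwards [ae_restrict_mem measurableSet_Ioc,
          ae_restrict_of_ae (Measure.ae_ne volume y.2)] with t h1 h2 using ⟨h1, h2⟩
      exact Measure.quasiMeasurePreserving_fst.ae h1
    filter_upwards [hne] with a ha
    obtain ⟨ha1, ha2⟩ := ha
    have hz : 0 < |a.1 - y.2| := abs_pos.2 (sub_ne_zero.2 ha2)
    have hzh : |a.1 - y.2| ≤ h := abs_le.2 ⟨by linarith [ha1.1, hy.2], by linarith [ha1.2, hy.1]⟩
    have e1 := norm_sectionGreen_le hk hh hc hy ha1.1.le ha1.2 a.2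
    have e2 := exp_mul_norm_inv_sdRoot_le hk hh hz hzh hkh a.2
    have e3 := norm_sdExp_le (k * X) 0 a.2
    rw [zero_mul, neg_zero, Real.exp_zero, mul_one] at e3
    simp only [Function.uncurry]
    rw [fullKernel, norm_mul, norm_mul, norm_mul]
    calc _ ≤ Real.exp |k * X| * ‖(sdRoot a.2)⁻¹‖ * ((2 + 4 / |Real.cos (k * h)|) *
          Real.exp (-(k * |a.1 - y.2| * a.2 ^ 2))) * 1 := by
          gcongr; exact hg1 _
      _ = Real.exp |k * X| * (2 + 4 / |Real.cos (k * h)|) *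
          (Real.exp (-(k * |a.1 - y.2| * a.2 ^ 2)) * ‖(sdRoot a.2)⁻¹‖) := by ring
      _ ≤ Real.exp |k * X| * (2 + 4 / |Real.cos (k * h)|) *
          (√(2 * h) * |a.1 - y.2| ^ (-(1 / 2) : ℝ) * (1 + a.2 ^ 2)⁻¹) := by gcongr
      _ = _ := by simp only [C]; ring

end modes

/-! ### Cut-off frequencies -/

lemma cutoff_pos {h : ℝ} (hh : 0 < h) (n : ℕ) : 0 < cutoff h n := by
  unfold cutoff; positivity

lemma cutoff_mul {h : ℝ} (hh : 0 < h) (n : ℕ) : cutoff h n * h = n * Real.pi + Real.pi / 2 := by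
  unfold cutoff; field_simp

lemma cos_cutoff_mul {h : ℝ} (hh : 0 < h) (n : ℕ) : Real.cos (cutoff h n * h) = 0 := by
  rw [cutoff_mul hh, Real.cos_add_pi_div_two, Real.sin_nat_mul_pi, neg_zero]

lemma cos_ne_zero_of_ne_cutoff {k h : ℝ} (hk : 0 < k) (hh : 0 < h)
    (hkn : ∀ n : ℕ, k ≠ cutoff h n) : Real.cos (k * h) ≠ 0 := by
  intro hc
  obtain ⟨m, hm⟩ := Real.cos_eq_zero_iff.1 hc
  have hm0 : 0 ≤ m := by
    by_contra hneg
    have : (m : ℝ) ≤ -1 := by exact_mod_cast (by omega : m ≤ -1)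
    have hpos : 0 < k * h := by positivity
    nlinarith [Real.pi_pos]
  obtain ⟨n, rfl⟩ := Int.eq_ofNat_of_zero_le hm0
  apply hkn n
  unfold cutoff
  push_cast at hm
  field_simp
  linarith

lemma axialWaveNumber_sq (k h : ℝ) (hk : 0 < k) (hh : 0 < h) (n : ℕ) :
    axialWaveNumber k h n ^ 2 = (k : ℂ) ^ 2 - cutoff h n ^ 2 := by
  have hc := cutoff_pos hh n
  unfold axialWaveNumber
  split_ifs with hlt
  · rw [← ofReal_pow, Real.sq_sqrt (by nlinarith)]; push_cast; ring
  · rw [mul_pow, I_sq, ← ofReal_pow, Real.sq_sqrt (by nlinarith)]; push_cast; ring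

lemma axialWaveNumber_re_nonneg (k h : ℝ) (n : ℕ) : 0 ≤ (axialWaveNumber k h n).re := by
  unfold axialWaveNumber
  split_ifs <;> simp [Real.sqrt_nonneg]

lemma axialWaveNumber_im_nonneg (k h : ℝ) (n : ℕ) : 0 ≤ (axialWaveNumber k h n).im := by
  unfold axialWaveNumber
  split_ifs <;> simp [Real.sqrt_nonneg]

lemma axialWaveNumber_ne_zero {k h : ℝ} (hk : 0 < k) (hh : 0 < h) {n : ℕ}
    (hkn : k ≠ cutoff h n) : axialWaveNumber k h n ≠ 0 := by
  intro h0
  have h1 := axialWaveNumber_sq k h hk hh n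
  rw [h0] at h1
  have h2 : k ^ 2 = cutoff h n ^ 2 := by
    have : (k : ℂ) ^ 2 = (cutoff h n : ℂ) ^ 2 := by linear_combination -h1
    exact_mod_cast this
  exact hkn (by nlinarith [cutoff_pos hh n])

/-- The modes of the Green function. -/
def greenMode (k h : ℝ) (y : ℝ × ℝ) (n : ℕ) (s : ℝ) : ℂ :=
  I / (h * axialWaveNumber k h n) * Real.sin (cutoff h n * y.2) *
    cexp (I * axialWaveNumber k h n * |s - y.1|)

/-- The residue computation needs `A ≥ 0`; the reflection `p ↦ -p` changes the sign of `q` and so of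
`A`. -/
lemma integral_mode_abs {A m : ℝ} (hm : 0 < m) (hm1 : m ≠ 1) {β : ℂ}
    (hβ : β ^ 2 = 1 - m ^ 2) (hre : 0 ≤ β.re) (him : 0 ≤ β.im) :
    ∫ p, sdExp A 0 p * (sdRoot p)⁻¹ * (2 * I * sdCos p / (sdCos p ^ 2 - m ^ 2)) =
      I * Real.pi / β * cexp (I * |A| * β) := by
  rcases le_total 0 A with hA | hA
  · rw [abs_of_nonneg hA, integral_mode hA hm hm1 hβ hre him]
  · rw [abs_of_nonpos hA, ← integral_mode (neg_nonneg.2 hA) hm hm1 hβ hre him,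
      ← integral_neg_eq_self]
    refine integral_congr_ae (ae_of_all _ fun p => ?_)
    simp only [sdRoot_neg, sdCos_neg]
    have : sdExp A 0 (-p) = sdExp (-A) 0 p := by
      simp [sdExp, sdSin_neg]
    rw [this]

/-- After exchanging the integrals, the cross-section integral at `κ = kc` leaves `2ic/(c² - m²)`
with `m = μₙ/k`, which is the integrand of the residue formula with `β = ξₙ/k`. The height `t = y₂`,
where the path integral is not available, is a null set. -/
lemma modeCoeff_modelGreen {k h : ℝ} (hk : 0 < k) (hh : 0 < h) (hkh : 1 ≤ k * h)
    (hkn : ∀ n : ℕ, k ≠ cutoff h n) {y : ℝ × ℝ} (hy : y ∈ strip h) (n : ℕ) (s : ℝ) :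
    modeCoeff h (modelGreen k h y) n s = greenMode k h y n s := by
  have hc := cos_ne_zero_of_ne_cutoff hk hh hkn
  set μ := cutoff h n with hμ
  have hμ0 := cutoff_pos hh n
  have hkc : (k : ℂ) ≠ 0 := ofReal_ne_zero.2 hk.ne'
  have hm : 0 < μ / k := div_pos hμ0 hk
  have hm1 : μ / k ≠ 1 := fun h' => hkn n ((div_eq_one_iff_eq hk.ne').1 h').symm
  set ξ := axialWaveNumber k h n with hξ
  have hξ0 : ξ ≠ 0 := axialWaveNumber_ne_zero hk hh (hkn n)
  have hβ : (ξ / k) ^ 2 = 1 - ((μ / k : ℝ) : ℂ) ^ 2 := by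
    rw [div_pow, hξ, axialWaveNumber_sq k h hk hh n, ← hμ]
    push_cast
    field_simp
  have hre : 0 ≤ (ξ / k).re := by
    rw [div_ofReal_re]; exact div_nonneg (axialWaveNumber_re_nonneg _ _ _) hk.le
  have him : 0 ≤ (ξ / k).im := by
    rw [div_ofReal_im]; exact div_nonneg (axialWaveNumber_im_nonneg _ _ _) hk.le
  have h1 : ∫ t in (0 : ℝ)..h, modelGreen k h y (s, t) * (Real.sin (μ * t) : ℂ) =
      (2 * Real.pi : ℂ)⁻¹ * ∫ t in (0 : ℝ)..h,
        ∫ p, fullKernel k h (s - y.1) y.2 t p * (Real.sin (μ * t) : ℂ) := by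
    rw [← intervalIntegral.integral_const_mul]
    refine intervalIntegral.integral_congr_ae ?_
    filter_upwards [Measure.ae_ne volume y.2] with t ht hmem
    rw [uIoc_of_le hh.le] at hmem
    rw [modelGreen_eq hk hh hc hy hmem.1.le hmem.2 ht, integral_mul_const, mul_assoc]
  have h2 := integrable_fullKernel hk hh hc hy hkh (s - y.1)
    (g := fun t => (Real.sin (μ * t) : ℂ)) (by fun_prop)
    (fun t => by rw [norm_real]; exact Real.abs_sin_le_one _)
  have h3 : ∀ p, ∫ t in (0 : ℝ)..h, fullKernel k h (s - y.1) y.2 t p * (Real.sin (μ * t) : ℂ) =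
      (sdExp (k * (s - y.1)) 0 p * (sdRoot p)⁻¹ *
        (2 * I * sdCos p / (sdCos p ^ 2 - (μ / k : ℝ) ^ 2))) *
        ((Real.sin (μ * y.2) : ℂ) / k) := fun p => by
    have e0 := sdCos_sq_sub_ne hm hm1 p
    have e1 : (k * sdCos p) ^ 2 - (μ : ℂ) ^ 2 = k ^ 2 * (sdCos p ^ 2 - ((μ / k : ℝ) : ℂ) ^ 2) := by
      push_cast; field_simp
    have e2 := integral_sectionGreen_mul_sin (κ := k * sdCos p) (m := μ) hy.1.le hy.2.le
      (by rw [exp_two_sdCos_eq]; exact periodDenom_ne_zero (by positivity) hc p)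
      (cos_cutoff_mul hh n) (by rw [e1]; exact mul_ne_zero (pow_ne_zero _ hkc) e0)
    simp only [fullKernel, mul_assoc]
    simp only [mul_assoc] at e2
    rw [intervalIntegral.integral_const_mul, intervalIntegral.integral_const_mul, e2, e1]
    field_simp
  rw [modeCoeff, ← hμ, h1, intervalIntegral_integral_swap (by rwa [uIoc_of_le hh.le])]
  simp_rw [h3]
  rw [integral_mul_const, integral_mode_abs hm hm1 hβ hre him, greenMode, ← hξ, ← hμ]
  rw [show I * ((|k * (s - y.1)| : ℝ) : ℂ) * (ξ / k) = I * ξ * |s - y.1| by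
    rw [abs_mul, abs_of_pos hk]; push_cast; field_simp]
  have hhc : (h : ℂ) ≠ 0 := ofReal_ne_zero.2 hh.ne'
  have hpi : (Real.pi : ℂ) ≠ 0 := ofReal_ne_zero.2 Real.pi_ne_zero
  field_simp

lemma intervalIntegrable_modelGreen {k h : ℝ} (hk : 0 < k) (hh : 0 < h) (hkh : 1 ≤ k * h)
    (hc : Real.cos (k * h) ≠ 0) {y : ℝ × ℝ} (hy : y ∈ strip h) (s : ℝ) :
    IntegrableOn (fun t => modelGreen k h y (s, t)) (Ioc 0 h) := by
  have h2 := (integrable_fullKernel hk hh hc hy hkh (s - y.1)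
    (g := fun _ => 1) continuous_const (by simp)).integral_prod_left.const_mul
    ((2 * Real.pi : ℂ)⁻¹)
  refine h2.congr ?_
  filter_upwards [ae_restrict_mem measurableSet_Ioc,
    ae_restrict_of_ae (Measure.ae_ne volume y.2)] with t ht1 ht2
  rw [modelGreen_eq hk hh hc hy ht1.1.le ht1.2 ht2]
  simp [Function.uncurry]

/-! ### Continuity of `S + G` off the source -/

lemma continuousOn_hankelH0 : ContinuousOn hankelH0 (Ioi 0) := by
  refine ContinuousOn.congr (f := fun r => 2 / (I * Real.pi) * ∫ p, sdExp 0 r p * (sdRoot p)⁻¹)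
    (fun r hr => ?_) fun r hr => hankelH0_eq hr
  have hr : 0 < r := hr
  refine ContinuousAt.continuousWithinAt (ContinuousAt.mul continuousAt_const ?_)
  have hev : ∀ᶠ z in 𝓝 r, r / 2 < z := eventually_gt_nhds (by linarith)
  refine continuousAt_of_dominated (bound := fun p => Real.exp (-(r / 2) * p ^ 2)) ?_ ?_
    (integrable_exp_neg_mul_sq (by linarith)) ?_
  · filter_upwards [hev] with z hz
    exact (integrable_sdExp_div 0 (by linarith)).aestronglyMeasurable
  · filter_upwards [hev] with z hz
    refine ae_of_all _ fun p => ?_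
    rw [norm_mul]
    have h1 := norm_sdExp_le 0 z p
    rw [abs_zero, Real.exp_zero, one_mul] at h1
    calc _ ≤ Real.exp (-(z * p ^ 2)) * 1 := by
          gcongr; exact norm_inv_sdRoot_le_one p
      _ ≤ _ := by
        rw [mul_one]
        apply Real.exp_le_exp.2
        nlinarith [sq_nonneg p]
  · refine ae_of_all _ fun p => ?_
    exact ((continuous_sdExp.comp (f := fun z : ℝ => (0, z, p)) (by fun_prop)).mul
      continuous_const).continuousAt

lemma euclDist_pos {x y : ℝ × ℝ} (h : x ≠ y) : 0 < euclDist x y := by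
  refine Real.sqrt_pos.2 ?_
  by_contra h0
  have h1 : x.1 - y.1 = 0 := by nlinarith [sq_nonneg (x.1 - y.1), sq_nonneg (x.2 - y.2)]
  have h2 : x.2 - y.2 = 0 := by nlinarith [sq_nonneg (x.1 - y.1), sq_nonneg (x.2 - y.2)]
  exact h (Prod.ext (sub_eq_zero.1 h1) (sub_eq_zero.1 h2))

lemma continuousAt_modelGreen {k h : ℝ} (hk : 0 < k) (hh : 0 < h)
    (hc : Real.cos (k * h) ≠ 0) {x y : ℝ × ℝ} (hy : y ∈ strip h) (hx : x ∈ strip h)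
    (hxy : x ≠ y) : ContinuousAt (modelGreen k h y) x := by
  have h1 : ∀ w : ℝ × ℝ, x ≠ w → ContinuousAt (fun x => hankelH0 (k * euclDist x w)) x :=
    fun w hw => by
      have e1 : ContinuousAt (fun x => k * euclDist x w) x := by
        unfold euclDist; fun_prop
      exact ContinuousAt.comp (f := fun x => k * euclDist x w) (continuousOn_hankelH0.continuousAt
        (Ioi_mem_nhds (mul_pos hk (euclDist_pos hw)))) e1
  have h2 : x ≠ (y.1, -y.2) := fun h' => by
    have := congrArg Prod.snd h'
    have := hx.1
    have := hy.1
    simp at *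
    linarith
  exact (hasFDerivAt_regPart hk hh hc hy hx).continuousAt.add
    ((continuousAt_const.mul (h1 y hxy)).sub (continuousAt_const.mul (h1 _ h2)))

/-! ### Completeness of the transverse modes -/

lemma cutoff_eq (h : ℝ) (n : ℕ) (t : ℝ) :
    cutoff h n * t = (2 * n + 1) * (Real.pi * t / (2 * h)) := by
  unfold cutoff; ring

lemma two_mul_cos_mul_sin_cutoff_succ {h : ℝ} (n : ℕ) (t : ℝ) :
    2 * Real.cos (Real.pi * t / h) * Real.sin (cutoff h (n + 1) * t) =
      Real.sin (cutoff h (n + 2) * t) + Real.sin (cutoff h n * t) := by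
  set u := Real.pi * t / (2 * h) with hu
  have h1 : Real.pi * t / h = 2 * u := by rw [hu]; field_simp
  simp only [cutoff_eq, ← hu, h1]
  push_cast
  rw [show (2 * ((n : ℝ) + 2) + 1) * u = (2 * (n + 1) + 1) * u + 2 * u by ring,
    show (2 * (n : ℝ) + 1) * u = (2 * (n + 1) + 1) * u - 2 * u by ring,
    Real.sin_add, Real.sin_sub]
  ring

lemma two_mul_cos_mul_sin_cutoff_zero {h : ℝ} (t : ℝ) :
    2 * Real.cos (Real.pi * t / h) * Real.sin (cutoff h 0 * t) =
      Real.sin (cutoff h 1 * t) - Real.sin (cutoff h 0 * t) := by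
  set u := Real.pi * t / (2 * h) with hu
  have h1 : Real.pi * t / h = 2 * u := by rw [hu]; field_simp
  simp only [cutoff_eq, ← hu, h1]
  push_cast
  rw [show (2 * (0 : ℝ) + 1) * u = u by ring, show (2 * (1 : ℝ) + 1) * u = 2 * u + u by ring,
    Real.sin_add]
  have : Real.sin u = Real.sin (2 * u - u) := by congr 1; ring
  have h2 := Real.sin_sub (2 * u) u
  rw [← this] at h2
  linarith

/-- Consecutive cut-off frequencies differ by `π/h`, so multiplication by `cos(πt/h)` maps the span
of the sines into itself, and orthogonality to all sines propagates to all powers. -/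
lemma integral_cos_pow_mul_sin_cutoff {h : ℝ} {w : ℝ → ℂ}
    (hw : IntervalIntegrable w volume 0 h)
    (hm : ∀ n, ∫ t in (0 : ℝ)..h, w t * (Real.sin (cutoff h n * t) : ℂ) = 0) (j n : ℕ) :
    ∫ t in (0 : ℝ)..h, ((Real.cos (Real.pi * t / h) ^ j * Real.sin (cutoff h n * t) : ℝ) : ℂ) * w t
      = 0 := by
  have hint : ∀ g : ℝ → ℝ, Continuous g → IntervalIntegrable (fun t => ((g t : ℝ) : ℂ) * w t)
      volume 0 h := fun g hg => hw.continuousOn_mul (by fun_prop)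
  induction j generalizing n with
  | zero =>
    rw [← hm n]
    refine intervalIntegral.integral_congr fun t _ => ?_
    simp only [pow_zero, one_mul]
    ring
  | succ j ih =>
    -- At `n = 0` the lower neighbour has frequency `-μ₀`; it folds back onto `μ₀` with the sign `σ
    -- = -1`.
    have key : ∀ n, ∃ σ : ℝ, ∃ a b : ℕ, ∀ t, Real.cos (Real.pi * t / h) *
        Real.sin (cutoff h n * t) = (Real.sin (cutoff h a * t) +
          σ * Real.sin (cutoff h b * t)) / 2 := fun n => by
      rcases n with _ | n
      · exact ⟨-1, 1, 0, fun t => by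
          have := two_mul_cos_mul_sin_cutoff_zero (h := h) t
          linarith⟩
      · exact ⟨1, n + 2, n, fun t => by
          have := two_mul_cos_mul_sin_cutoff_succ (h := h) n t
          linarith⟩
    obtain ⟨σ, a, b, hab⟩ := key n
    have e : ∀ t, ((Real.cos (Real.pi * t / h) ^ (j + 1) * Real.sin (cutoff h n * t) : ℝ) : ℂ) *
        w t = (1 / 2 : ℂ) * (((Real.cos (Real.pi * t / h) ^ j * Real.sin (cutoff h a * t) : ℝ) : ℂ)
          * w t) + (σ / 2 : ℂ) * (((Real.cos (Real.pi * t / h) ^ j *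
            Real.sin (cutoff h b * t) : ℝ) : ℂ) * w t) := fun t => by
      rw [pow_succ, mul_assoc, hab t]
      push_cast
      ring
    simp_rw [e]
    rw [intervalIntegral.integral_add ((hint _ (by fun_prop)).const_mul _)
      ((hint _ (by fun_prop)).const_mul _), intervalIntegral.integral_const_mul,
      intervalIntegral.integral_const_mul, ih, ih]
    simp

lemma integral_polynomial_cos_mul_sin_cutoff {h : ℝ} {w : ℝ → ℂ}
    (hw : IntervalIntegrable w volume 0 h)
    (hm : ∀ n, ∫ t in (0 : ℝ)..h, w t * (Real.sin (cutoff h n * t) : ℂ) = 0)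
    (P : Polynomial ℝ) :
    ∫ t in (0 : ℝ)..h, ((P.eval (Real.cos (Real.pi * t / h)) * Real.sin (cutoff h 0 * t) : ℝ) : ℂ)
      * w t = 0 := by
  have hint : ∀ g : ℝ → ℝ, Continuous g → IntervalIntegrable (fun t => ((g t : ℝ) : ℂ) * w t)
      volume 0 h := fun g hg => hw.continuousOn_mul (by fun_prop)
  induction P using Polynomial.induction_on' with
  | add p q hp hq =>
    have e : ∀ t, (((p + q).eval (Real.cos (Real.pi * t / h)) * Real.sin (cutoff h 0 * t) : ℝ) : ℂ)
        * w t = ((p.eval (Real.cos (Real.pi * t / h)) * Real.sin (cutoff h 0 * t) : ℝ) : ℂ) * w t +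
        ((q.eval (Real.cos (Real.pi * t / h)) * Real.sin (cutoff h 0 * t) : ℝ) : ℂ) * w t :=
      fun t => by rw [Polynomial.eval_add]; push_cast; ring
    simp_rw [e]
    rw [intervalIntegral.integral_add (hint _ (by fun_prop)) (hint _ (by fun_prop)), hp, hq,
      add_zero]
  | monomial j a =>
    have e : ∀ t, (((Polynomial.monomial j a).eval (Real.cos (Real.pi * t / h)) *
        Real.sin (cutoff h 0 * t) : ℝ) : ℂ) * w t = (a : ℂ) *
        (((Real.cos (Real.pi * t / h) ^ j * Real.sin (cutoff h 0 * t) : ℝ) : ℂ) * w t) :=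
      fun t => by rw [Polynomial.eval_monomial]; push_cast; ring
    simp_rw [e]
    rw [intervalIntegral.integral_const_mul, integral_cos_pow_mul_sin_cutoff hw hm, mul_zero]

/-- On `[0, h]` the function `cos(πt/h)` is an injective coordinate, so by Weierstrass its
polynomials are uniformly dense in the continuous functions. -/
lemma integral_continuous_mul_sin_cutoff {h : ℝ} (hh : 0 < h) {w : ℝ → ℂ}
    (hw : IntervalIntegrable w volume 0 h)
    (hm : ∀ n, ∫ t in (0 : ℝ)..h, w t * (Real.sin (cutoff h n * t) : ℂ) = 0)
    {g : ℝ → ℝ} (hg : Continuous g) :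
    ∫ t in (0 : ℝ)..h, ((g t * Real.sin (cutoff h 0 * t) : ℝ) : ℂ) * w t = 0 := by
  have hint : ∀ g : ℝ → ℝ, Continuous g → IntervalIntegrable (fun t => ((g t : ℝ) : ℂ) * w t)
      volume 0 h := fun g hg => hw.continuousOn_mul (by fun_prop)
  set B := ∫ t in (0 : ℝ)..h, ‖w t‖ with hB
  have hB0 : 0 ≤ B := intervalIntegral.integral_nonneg hh.le fun _ _ => norm_nonneg _
  rw [← norm_le_zero_iff]
  refine le_of_forall_pos_le_add fun ε hε => ?_
  rw [zero_add]
  obtain ⟨P, hP⟩ := exists_polynomial_near_of_continuousOn (-1) 1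
    (fun x => g (h / Real.pi * Real.arccos x)) (by fun_prop) (ε / (B + 1)) (by positivity)
  have hsub : ∫ t in (0 : ℝ)..h, ((g t * Real.sin (cutoff h 0 * t) : ℝ) : ℂ) * w t =
      ∫ t in (0 : ℝ)..h, (((g t - P.eval (Real.cos (Real.pi * t / h))) *
        Real.sin (cutoff h 0 * t) : ℝ) : ℂ) * w t := by
    have e : ∀ t, (((g t - P.eval (Real.cos (Real.pi * t / h))) *
        Real.sin (cutoff h 0 * t) : ℝ) : ℂ) * w t =
        ((g t * Real.sin (cutoff h 0 * t) : ℝ) : ℂ) * w t -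
        ((P.eval (Real.cos (Real.pi * t / h)) * Real.sin (cutoff h 0 * t) : ℝ) : ℂ) * w t :=
      fun t => by push_cast; ring
    simp_rw [e]
    rw [intervalIntegral.integral_sub (hint _ (by fun_prop)) (hint _ (by fun_prop)),
      integral_polynomial_cos_mul_sin_cutoff hw hm, sub_zero]
  rw [hsub]
  calc _ ≤ ∫ t in (0 : ℝ)..h, ε / (B + 1) * ‖w t‖ := by
        refine intervalIntegral.norm_integral_le_of_norm_le hh.le (ae_of_all _ fun t ht => ?_)
          (hw.norm.const_mul _)
        rw [norm_mul, norm_real, norm_mul]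
        refine mul_le_mul_of_nonneg_right ?_ (norm_nonneg _)
        have h1 : Real.arccos (Real.cos (Real.pi * t / h)) = Real.pi * t / h := by
          refine Real.arccos_cos (by have := ht.1; positivity) ?_
          rw [div_le_iff₀ hh]
          exact mul_le_mul_of_nonneg_left ht.2 Real.pi_pos.le
        have h2 := hP (Real.cos (Real.pi * t / h)) ⟨Real.neg_one_le_cos _, Real.cos_le_one _⟩
        simp only [h1] at h2
        rw [show h / Real.pi * (Real.pi * t / h) = t by
          have := Real.pi_ne_zero
          field_simp, abs_sub_comm] at h2
        calc _ ≤ ε / (B + 1) * 1 :=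
              mul_le_mul h2.le (Real.abs_sin_le_one _) (abs_nonneg _) (by positivity)
          _ = _ := mul_one _
    _ = ε / (B + 1) * B := by rw [intervalIntegral.integral_const_mul]
    _ ≤ ε := by
      rw [div_mul_eq_mul_div, div_le_iff₀ (by positivity)]
      nlinarith

/-- A function all of whose transverse modes vanish is zero. -/
lemma ae_eq_zero_of_modes_eq_zero {h : ℝ} (hh : 0 < h) {w : ℝ → ℂ}
    (hw : IntegrableOn w (Ioc 0 h))
    (hm : ∀ n, ∫ t in (0 : ℝ)..h, w t * (Real.sin (cutoff h n * t) : ℂ) = 0) :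
    ∀ᵐ t, t ∈ Ioo 0 h → w t = 0 := by
  have hwi : IntervalIntegrable w volume 0 h :=
    (intervalIntegrable_iff_integrableOn_Ioc_of_le hh.le).2 hw
  have h1 : ∀ᵐ t, t ∈ Ioo 0 h → ((Real.sin (cutoff h 0 * t) : ℝ) : ℂ) * w t = 0 := by
    refine isOpen_Ioo.ae_eq_zero_of_integral_contDiff_smul_eq_zero ?_ fun g hg _ hgs => ?_
    · refine IntegrableOn.locallyIntegrableOn ?_
      have h2 : IntervalIntegrable (fun t => ((Real.sin (cutoff h 0 * t) : ℝ) : ℂ) * w t)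
          volume 0 h := hwi.continuousOn_mul (by fun_prop)
      exact ((intervalIntegrable_iff_integrableOn_Ioc_of_le hh.le).1 h2).mono_set Ioo_subset_Ioc_self
    · rw [← intervalIntegral.integral_eq_integral_of_support_subset (a := 0) (b := h),
        ← integral_continuous_mul_sin_cutoff hh hwi hm hg.continuous]
      · refine intervalIntegral.integral_congr fun t _ => ?_
        simp only [real_smul]
        push_cast
        ring
      · intro t ht
        have : g t ≠ 0 := fun h0 => ht (by simp [h0])
        exact Ioo_subset_Ioc_self (hgs (subset_tsupport _ this))
  filter_upwards [h1] with t ht hmem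
  have h2 := ht hmem
  -- The weight can be divided out: `μ₀h = π/2`, so `sin(μ₀t) > 0` on `(0, h)`.
  refine (mul_eq_zero.1 h2).resolve_left (ofReal_ne_zero.2 (Real.sin_pos_of_pos_of_lt_pi ?_ ?_).ne')
  · exact mul_pos (cutoff_pos hh 0) hmem.1
  · have h3 := cutoff_mul hh 0
    have h4 := mul_lt_mul_of_pos_left hmem.2 (cutoff_pos hh 0)
    simp at h3
    linarith [Real.pi_pos]

/-! ### Weak solutions of `v'' + ξ² v = 0` on the line -/

lemma exists_primitive_of_integral_eq_zero {ψ : ℝ → ℂ} (hψ : ContDiff ℝ ∞ ψ)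
    (hs : HasCompactSupport ψ) (h0 : ∫ s, ψ s = 0) :
    ∃ P : ℝ → ℂ, ContDiff ℝ ∞ P ∧ HasCompactSupport P ∧ ∀ s, HasDerivAt P (ψ s) s := by
  obtain ⟨R, hR⟩ := hs.isCompact.isBounded.subset_closedBall 0
  have hz : ∀ s, R < |s| → ψ s = 0 := fun s hs' => by
    by_contra hne
    have := hR (subset_tsupport ψ hne)
    rw [mem_closedBall_zero_iff, Real.norm_eq_abs] at this
    linarith
  have hc := hψ.continuous
  set a := -(|R| + 1) with ha
  have hd : ∀ s, HasDerivAt (fun s => ∫ t in a..s, ψ t) (ψ s) s := fun s =>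
    intervalIntegral.integral_hasDerivAt_right (hc.intervalIntegrable _ _)
      (hc.stronglyMeasurableAtFilter _ _) hc.continuousAt
  refine ⟨fun s => ∫ t in a..s, ψ t, ?_, ?_, hd⟩
  · rw [contDiff_infty_iff_deriv]
    refine ⟨fun s => (hd s).differentiableAt, ?_⟩
    rwa [show deriv (fun s => ∫ t in a..s, ψ t) = ψ from funext fun s => (hd s).deriv]
  · refine HasCompactSupport.intro (isCompact_Icc (a := a) (b := |R| + 1)) fun s hs' => ?_
    rw [mem_Icc, not_and_or, not_le, not_le] at hs'
    have hR' := le_abs_self R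
    rcases hs' with h1 | h1
    · rw [← intervalIntegral.integral_zero (a := a) (b := s) (μ := volume)]
      refine intervalIntegral.integral_congr fun t ht => hz t ?_
      rw [uIcc_of_ge h1.le] at ht
      have := neg_le_abs t
      have := ht.2
      linarith
    · rw [← h0]
      refine intervalIntegral.integral_eq_integral_of_support_subset fun t ht => ?_
      have h2 : |t| ≤ R := not_lt.1 fun h' => ht (hz t h')
      have h3 := abs_le.1 h2
      exact ⟨by linarith, by linarith⟩

/-- The space of smooth compactly supported functions on the line. -/
def testSpace : Submodule ℂ (ℝ → ℂ) where
  carrier := {ψ | ContDiff ℝ ∞ ψ ∧ HasCompactSupport ψ}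
  add_mem' ha hb := ⟨ha.1.add hb.1, ha.2.add hb.2⟩
  zero_mem' := ⟨contDiff_const, HasCompactSupport.zero⟩
  smul_mem' c _ hψ := ⟨contDiff_const.smul hψ.1, hψ.2.smul_left (f := fun _ => c)⟩

lemma integrable_mul_test {v ψ : ℝ → ℂ} (hv : LocallyIntegrable v) (hψ : Continuous ψ)
    (hs : HasCompactSupport ψ) : Integrable fun s => v s * ψ s := by
  simpa [mul_comm] using hv.integrable_smul_left_of_hasCompactSupport hψ hs

/-- Integration against a locally integrable function. -/
def testFunctional (v : ℝ → ℂ) (hv : LocallyIntegrable v) : testSpace →ₗ[ℂ] ℂ where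
  toFun ψ := ∫ s, v s * (ψ : ℝ → ℂ) s
  map_add' a b := by
    rw [← integral_add (integrable_mul_test hv a.2.1.continuous a.2.2)
      (integrable_mul_test hv b.2.1.continuous b.2.2)]
    simp [mul_add]
  map_smul' c a := by
    rw [RingHom.id_apply, smul_eq_mul, ← integral_const_mul]
    simp [mul_left_comm]

lemma hasDerivAt_cexp_mul (a : ℂ) (s : ℝ) :
    HasDerivAt (fun s : ℝ => cexp (a * s)) (a * cexp (a * s)) s := by
  have h1 : HasDerivAt (fun s : ℝ => a * (s : ℂ)) a s := by
    simpa using ((hasDerivAt_id s).ofReal_comp).const_mul a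
  simpa [mul_comm] using h1.cexp

lemma contDiff_cexp_mul (a : ℂ) : ContDiff ℝ ∞ fun s : ℝ => cexp (a * s) :=
  (contDiff_const.mul ofRealCLM.contDiff).cexp

lemma iteratedDeriv_two_eq {f f' f'' : ℝ → ℂ} (h1 : ∀ s, HasDerivAt f (f' s) s)
    (h2 : ∀ s, HasDerivAt f' (f'' s) s) (s : ℝ) : iteratedDeriv 2 f s = f'' s := by
  rw [iteratedDeriv_succ, iteratedDeriv_one, show deriv f = f' from funext fun s => (h1 s).deriv,
    (h2 s).deriv]

/-- Weak solutions of `v'' + ξ² v = 0` are combinations of exponentials. -/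
lemma exists_ae_eq_of_weak_solution {ξ : ℂ} (hξ : ξ ≠ 0) {v : ℝ → ℂ} (hv : LocallyIntegrable v)
    (h : ∀ χ : ℝ → ℂ, ContDiff ℝ ∞ χ → HasCompactSupport χ →
      ∫ s, v s * (iteratedDeriv 2 χ s + ξ ^ 2 * χ s) = 0) :
    ∃ A B : ℂ, ∀ᵐ s : ℝ, v s = A * cexp (I * ξ * s) + B * cexp (-(I * ξ) * s) := by
  have hloc : ∀ a : ℂ, LocallyIntegrable fun s : ℝ => cexp (a * s) := fun a =>
    (contDiff_cexp_mul a).continuous.locallyIntegrable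
  let L : Fin 2 → (testSpace →ₗ[ℂ] ℂ) :=
    ![testFunctional _ (hloc (I * ξ)), testFunctional _ (hloc (-(I * ξ)))]
  have hspan : testFunctional v hv ∈ Submodule.span ℂ (range L) := by
    -- A functional vanishing on the common kernel of finitely many functionals is a combination of
    -- them. So it suffices that every test function orthogonal to both exponentials has the form
    -- `χ'' + ξ²χ` with `χ` a test function.
    refine mem_span_of_iInf_ker_le_ker fun ψ hψ => ?_
    rw [Submodule.mem_iInf] at hψ
    have h1 := hψ 0
    have h2 := hψ 1
    simp only [L, LinearMap.mem_ker, Matrix.cons_val_zero, Matrix.cons_val_one] at h1 h2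
    obtain ⟨ψ, hψd, hψs⟩ := ψ
    have h1' : ∫ s : ℝ, cexp (I * ξ * s) * ψ s = 0 := h1
    have h2' : ∫ s : ℝ, cexp (-(I * ξ) * s) * ψ s = 0 := h2
    obtain ⟨Q, hQd, hQs, hQ⟩ := exists_primitive_of_integral_eq_zero
      ((contDiff_cexp_mul (I * ξ)).mul hψd) hψs.mul_left h1'
    obtain ⟨P, hPd, hPs, hP⟩ := exists_primitive_of_integral_eq_zero
      ((contDiff_cexp_mul (-(I * ξ))).mul hψd) hψs.mul_left h2'
    have hmul : ∀ s : ℝ, cexp (I * ξ * s) * cexp (-(I * ξ) * s) = 1 := fun s => by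
      rw [← Complex.exp_add, show I * ξ * s + -(I * ξ) * s = 0 by ring, Complex.exp_zero]
    -- Variation of constants. Orthogonality makes the primitives `P` and `Q` compactly supported,
    -- hence `χ` too.
    let χ : ℝ → ℂ := fun s => (2 * I * ξ)⁻¹ * (cexp (I * ξ * s) * P s - cexp (-(I * ξ) * s) * Q s)
    have d1 : ∀ s : ℝ, HasDerivAt χ
        ((1 / 2) * (cexp (I * ξ * s) * P s + cexp (-(I * ξ) * s) * Q s)) s := fun s => by
      have e := (((hasDerivAt_cexp_mul (I * ξ) s).mul (hP s)).sub
        ((hasDerivAt_cexp_mul (-(I * ξ)) s).mul (hQ s))).const_mul (2 * I * ξ)⁻¹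
      refine e.congr_deriv ?_
      have hinv : (2 * I * ξ)⁻¹ * (I * ξ) = 1 / 2 := by
        have hI := I_ne_zero
        field_simp
      linear_combination (cexp (I * ξ * s) * P s + cexp (-(I * ξ) * s) * Q s) * hinv
    have d2 : ∀ s, HasDerivAt (fun s : ℝ =>
        (1 / 2) * (cexp (I * ξ * s) * P s + cexp (-(I * ξ) * s) * Q s))
        (ψ s - ξ ^ 2 * χ s) s := fun s => by
      have e := (((hasDerivAt_cexp_mul (I * ξ) s).mul (hP s)).add
        ((hasDerivAt_cexp_mul (-(I * ξ)) s).mul (hQ s))).const_mul (1 / 2)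
      refine e.congr_deriv ?_
      have := hmul s
      have h3 : ξ ^ 2 * χ s = -(I * ξ) / 2 * (cexp (I * ξ * s) * P s -
          cexp (-(I * ξ) * s) * Q s) := by
        simp only [χ]
        have hI := I_ne_zero
        generalize cexp (I * ξ * s) = a
        generalize cexp (-(I * ξ) * s) = b
        field_simp
        linear_combination (a * P s - b * Q s) * I_sq
      rw [h3]
      linear_combination ψ s * this
    have hχd : ContDiff ℝ ∞ χ := contDiff_const.mul
      (((contDiff_cexp_mul (I * ξ)).mul hPd).sub ((contDiff_cexp_mul (-(I * ξ))).mul hQd))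
    have hχs : HasCompactSupport χ := (hPs.mul_left.sub hQs.mul_left).mul_left
    have h4 := h χ hχd hχs
    simp_rw [iteratedDeriv_two_eq d1 d2, sub_add_cancel] at h4
    exact h4
  rw [Submodule.mem_span_range_iff_exists_fun] at hspan
  obtain ⟨c, hc⟩ := hspan
  rw [Fin.sum_univ_two] at hc
  refine ⟨c 0, c 1, ?_⟩
  have hloc2 : LocallyIntegrable fun s : ℝ =>
      c 0 * cexp (I * ξ * s) + c 1 * cexp (-(I * ξ) * s) :=
    Continuous.locallyIntegrable (by fun_prop)
  refine ae_eq_of_integral_contDiff_smul_eq hv hloc2 fun g hg hgs => ?_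
  have hgd : ContDiff ℝ ∞ fun s => (g s : ℂ) := ofRealCLM.contDiff.comp hg
  have hgs' : HasCompactSupport fun s => (g s : ℂ) := hgs.comp_left (g := fun x : ℝ => (x : ℂ)) rfl
  have h5 := LinearMap.congr_fun hc ⟨_, hgd, hgs'⟩
  have h6 : c 0 * (∫ s : ℝ, cexp (I * ξ * s) * (g s : ℂ)) +
      c 1 * (∫ s : ℝ, cexp (-(I * ξ) * s) * (g s : ℂ)) = ∫ s, v s * (g s : ℂ) := h5
  simp only [real_smul]
  rw [← integral_const_mul, ← integral_const_mul, ← integral_add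
    ((integrable_mul_test (hloc _) hgd.continuous hgs').const_mul _)
    ((integrable_mul_test (hloc _) hgd.continuous hgs').const_mul _)] at h6
  simp_rw [mul_comm ((g _ : ℝ) : ℂ)]
  rw [← h6]
  refine integral_congr_ae (ae_of_all _ fun s => ?_)
  simp only
  ring

lemma deriv_eq_zero_of_notMem_tsupport {χ : ℝ → ℂ} {s : ℝ} (h1 : s ∉ tsupport χ) :
    χ s = 0 ∧ deriv χ s = 0 ∧ iteratedDeriv 2 χ s = 0 := by
  have h2 : χ =ᶠ[𝓝 s] 0 := notMem_tsupport_iff_eventuallyEq.1 h1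
  have h3 : deriv χ =ᶠ[𝓝 s] 0 := by
    have := h2.deriv
    simpa using this
  have h4 : deriv (deriv χ) =ᶠ[𝓝 s] 0 := by
    have := h3.deriv
    simpa using this
  refine ⟨h2.eq_of_nhds, h3.eq_of_nhds, ?_⟩
  rw [iteratedDeriv_succ, iteratedDeriv_one]
  exact h4.eq_of_nhds

lemma hasDerivAt_of_contDiff {χ : ℝ → ℂ} (hχ : ContDiff ℝ ∞ χ) :
    (∀ s, HasDerivAt χ (deriv χ s) s) ∧ (∀ s, HasDerivAt (deriv χ) (iteratedDeriv 2 χ s) s) ∧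
      Continuous (iteratedDeriv 2 χ) := by
  have hχ1 : ContDiff ℝ ∞ (deriv χ) := (contDiff_infty_iff_deriv.1 hχ).2
  have e : iteratedDeriv 2 χ = deriv (deriv χ) := by rw [iteratedDeriv_succ, iteratedDeriv_one]
  rw [e]
  exact ⟨fun s => (hχ.differentiable (by simp) s).hasDerivAt,
    fun s => (hχ1.differentiable (by simp) s).hasDerivAt, (contDiff_infty_iff_deriv.1 hχ1).2.continuous⟩

/-- `exp(iξ|s - a|)` is a multiple of the fundamental solution. -/
lemma integral_cexp_abs_mul {ξ : ℂ} (a : ℝ) {χ : ℝ → ℂ} (hχ : ContDiff ℝ ∞ χ)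
    (hs : HasCompactSupport χ) :
    ∫ s : ℝ, cexp (I * ξ * |s - a|) * (iteratedDeriv 2 χ s + ξ ^ 2 * χ s) = 2 * I * ξ * χ a := by
  obtain ⟨d1, d2, c2⟩ := hasDerivAt_of_contDiff hχ
  obtain ⟨R, hR⟩ := hs.isCompact.isBounded.subset_closedBall 0
  have hz : ∀ s, R < |s| → χ s = 0 ∧ deriv χ s = 0 ∧ iteratedDeriv 2 χ s = 0 := fun s hs' => by
    refine deriv_eq_zero_of_notMem_tsupport fun h' => ?_
    have := hR h'
    rw [mem_closedBall_zero_iff, Real.norm_eq_abs] at this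
    linarith
  set M := max |R| |a| + 1
  have hM1 : |R| < M := lt_of_le_of_lt (le_max_left _ _) (lt_add_one _)
  have hM2 : |a| < M := lt_of_le_of_lt (le_max_right _ _) (lt_add_one _)
  have hM0 : 0 < M := (abs_nonneg _).trans_lt hM1
  have ha := abs_lt.1 hM2
  have hRM : R < M := (le_abs_self R).trans_lt hM1
  have hzp := hz M (by rwa [abs_of_pos hM0])
  have hzm := hz (-M) (by rwa [abs_neg, abs_of_pos hM0])
  have hcont : Continuous fun s : ℝ => cexp (I * ξ * |s - a|) *
      (iteratedDeriv 2 χ s + ξ ^ 2 * χ s) := by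
    have := hχ.continuous
    fun_prop
  rw [← intervalIntegral.integral_eq_integral_of_support_subset (a := -M) (b := M),
    ← intervalIntegral.integral_add_adjacent_intervals (b := a)
      (hcont.intervalIntegrable _ _) (hcont.intervalIntegrable _ _)]
  swap
  · intro s hs'
    have h1 : |s| ≤ R := not_lt.1 fun h' => hs' (by simp [hz s h'])
    have := abs_le.1 h1
    exact ⟨by linarith, by linarith⟩
  have dexp : ∀ (b : ℂ) (s : ℝ), HasDerivAt (fun s : ℝ => cexp (b * (s - a)))
      (b * cexp (b * (s - a))) s := fun b s => by
    have h1 : HasDerivAt (fun s : ℝ => b * ((s : ℂ) - a)) b s := by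
      simpa using (((hasDerivAt_id s).ofReal_comp).sub_const (a : ℂ)).const_mul b
    simpa [mul_comm] using h1.cexp
  -- Two integrations by parts in one primitive, used with `b = -iξ` to the left of `a` and `b = iξ`
  -- to the right. At `a` the terms `χ'(a)` cancel and `2iξχ(a)` remains.
  have F : ∀ (b : ℂ) (s : ℝ), b ^ 2 = -ξ ^ 2 → HasDerivAt
      (fun s : ℝ => cexp (b * (s - a)) * (deriv χ s - b * χ s))
      (cexp (b * (s - a)) * (iteratedDeriv 2 χ s + ξ ^ 2 * χ s)) s := fun b s hb => by
    have e := (dexp b s).mul ((d2 s).sub ((d1 s).const_mul b))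
    refine e.congr_deriv ?_
    simp only [Pi.sub_apply]
    linear_combination (-cexp (b * (s - a)) * χ s) * hb
  have hci : ∀ b : ℂ, Continuous fun s : ℝ => cexp (b * (s - a)) *
      (iteratedDeriv 2 χ s + ξ ^ 2 * χ s) := fun b => by
    have := hχ.continuous
    fun_prop
  have i1 : ∫ s in (-M)..a, cexp (I * ξ * |s - a|) * (iteratedDeriv 2 χ s + ξ ^ 2 * χ s) =
      deriv χ a + I * ξ * χ a := by
    have := intervalIntegral.integral_eq_sub_of_hasDerivAt (a := -M) (b := a)
      (fun s _ => F (-(I * ξ)) s (by rw [neg_sq, mul_pow, I_sq]; ring))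
      ((hci _).intervalIntegrable _ _)
    rw [hzm.1, hzm.2.1] at this
    simp only [sub_self, mul_zero, Complex.exp_zero, sub_zero, one_mul] at this
    rw [show deriv χ a + I * ξ * χ a = deriv χ a - -(I * ξ) * χ a by ring, ← this]
    refine intervalIntegral.integral_congr fun s hs' => ?_
    rw [uIcc_of_le ha.1.le] at hs'
    rw [abs_of_nonpos (by linarith [hs'.2])]
    push_cast
    congr 2
    ring
  have i2 : ∫ s in a..M, cexp (I * ξ * |s - a|) * (iteratedDeriv 2 χ s + ξ ^ 2 * χ s) =
      -(deriv χ a - I * ξ * χ a) := by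
    have := intervalIntegral.integral_eq_sub_of_hasDerivAt (a := a) (b := M)
      (fun s _ => F (I * ξ) s (by rw [mul_pow, I_sq]; ring))
      ((hci _).intervalIntegrable _ _)
    rw [hzp.1, hzp.2.1] at this
    simp only [sub_self, mul_zero, Complex.exp_zero, zero_sub, one_mul] at this
    rw [← this]
    refine intervalIntegral.integral_congr fun s hs' => ?_
    rw [uIcc_of_le ha.2.le] at hs'
    rw [abs_of_nonneg (by linarith [hs'.1])]
    push_cast
    rfl
  rw [i1, i2]
  ring

/-! ### The modes of the Green function of the waveguide -/

lemma strip_eq_prod (h : ℝ) : strip h = univ ×ˢ Ioo 0 h := by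
  ext x; simp [strip]

lemma modeCoeff_eq {h : ℝ} (hh : 0 < h) (u : ℝ × ℝ → ℂ) (n : ℕ) (s : ℝ) :
    modeCoeff h u n s =
      (2 / h : ℂ) * ∫ t in Icc 0 h, u (s, t) * (Real.sin (cutoff h n * t) : ℂ) := by
  rw [modeCoeff, intervalIntegral.integral_of_le hh.le, integral_Icc_eq_integral_Ioc]

section green
variable {k h : ℝ} (hk : 0 < k) (hh : 0 < h) {y : ℝ × ℝ} {u : ℝ × ℝ → ℂ}
  (hu : IsWaveguideGreen k h y u)
include hh hu

lemma locallyIntegrable_modeCoeff (n : ℕ) : LocallyIntegrable (modeCoeff h u n) := by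
  have h1 : ∀ R : ℝ, IntegrableOn (modeCoeff h u n) (Icc (-R) R) := fun R => by
    have h2 : IntegrableOn (fun x : ℝ × ℝ => u x * (Real.sin (cutoff h n * x.2) : ℂ))
        (Icc (-R) R ×ˢ Icc 0 h) :=
      (hu.integrable R).mul_continuousOn (by fun_prop) (isCompact_Icc.prod isCompact_Icc)
    rw [IntegrableOn, Measure.volume_eq_prod, ← Measure.prod_restrict] at h2
    refine (h2.integral_prod_left.const_mul (2 / h : ℂ)).congr (ae_of_all _ fun s => ?_)
    rw [modeCoeff_eq hh]
  intro s
  refine ⟨Icc (-(|s| + 1)) (|s| + 1), Icc_mem_nhds ?_ ?_, h1 _⟩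
  · linarith [neg_abs_le s]
  · linarith [le_abs_self s]

/-- For `s` near a value other than `y₁` the closed cross-sections stay in a compact set that avoids
the source, where `u` is continuous and bounded. -/
lemma continuousAt_modeCoeff (n : ℕ) {s : ℝ} (hs : s ≠ y.1) :
    ContinuousAt (modeCoeff h u n) s := by
  set δ := |s - y.1| / 2
  have hδ : 0 < δ := half_pos (abs_pos.2 (sub_ne_zero.2 hs))
  set K := Icc (s - δ) (s + δ) ×ˢ Icc 0 h
  have hK : IsCompact K := isCompact_Icc.prod isCompact_Icc
  have hKy : ∀ x ∈ K, x ∈ closedStrip h \ {y} := fun x hx => by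
    refine ⟨hx.2, fun hxy => ?_⟩
    rw [mem_singleton_iff] at hxy
    have h1 := hx.1
    rw [hxy] at h1
    have h2 : |s - y.1| ≤ δ := abs_le.2 ⟨by linarith [h1.2], by linarith [h1.1]⟩
    have h3 : δ = |s - y.1| / 2 := rfl
    linarith
  have hc : ContinuousOn (fun x : ℝ × ℝ => u x * (Real.sin (cutoff h n * x.2) : ℂ)) K :=
    (hu.continuous_off_source.mono hKy).mul (by fun_prop)
  obtain ⟨C, hC⟩ := hK.exists_bound_of_continuousOn hc
  have hev : ∀ᶠ z in 𝓝 s, z ∈ Ioo (s - δ) (s + δ) :=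
    Ioo_mem_nhds (by linarith) (by linarith)
  rw [show modeCoeff h u n = fun s => (2 / h : ℂ) * ∫ t in Icc 0 h, u (s, t) *
    (Real.sin (cutoff h n * t) : ℂ) from funext fun s => modeCoeff_eq hh u n s]
  refine continuousAt_const.mul (continuousAt_of_dominated (bound := fun _ => C) ?_ ?_ ?_ ?_)
  · filter_upwards [hev] with z hz
    refine ContinuousOn.aestronglyMeasurable ?_ measurableSet_Icc
    exact hc.comp (f := fun t : ℝ => (z, t)) (by fun_prop)
      fun t ht => ⟨Ioo_subset_Icc_self hz, ht⟩
  · filter_upwards [hev] with z hz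
    filter_upwards [ae_restrict_mem measurableSet_Icc] with t ht
    exact hC (z, t) ⟨Ioo_subset_Icc_self hz, ht⟩
  · exact integrableOn_const (by simp)
  · filter_upwards [ae_restrict_mem measurableSet_Icc] with t ht
    have h1 : ContinuousOn (fun z : ℝ => u (z, t) * (Real.sin (cutoff h n * t) : ℂ))
        (Ioo (s - δ) (s + δ)) :=
      hc.comp (f := fun z : ℝ => (z, t)) (by fun_prop)
        fun z hz => ⟨Ioo_subset_Icc_self hz, ht⟩
    exact h1.continuousAt hev

omit hh hu in
lemma hasDerivAt_sin_mul (m t : ℝ) : HasDerivAt (fun t : ℝ => (Real.sin (m * t) : ℂ))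
    ((m * Real.cos (m * t) : ℝ) : ℂ) t := by
  have h1 : HasDerivAt (fun t : ℝ => m * t) m t := by
    simpa using (hasDerivAt_id t).const_mul m
  refine h1.sin.ofReal_comp.congr_deriv ?_
  push_cast; ring

omit hh hu in
lemma hasDerivAt_cos_mul (m t : ℝ) : HasDerivAt (fun t : ℝ => ((m * Real.cos (m * t) : ℝ) : ℂ))
    ((-m ^ 2 * Real.sin (m * t) : ℝ) : ℂ) t := by
  have h1 : HasDerivAt (fun t : ℝ => m * t) m t := by
    simpa using (hasDerivAt_id t).const_mul m
  refine (h1.cos.const_mul m).ofReal_comp.congr_deriv ?_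
  push_cast; ring

omit hu in
-- Test functions must have compact support in the plane, which a sine in `x₂` has not. The cut-off
-- changes it only away from the closed interval, so derivatives at the walls are unaffected.
lemma exists_cutoff_sin (m : ℝ) : ∃ c : ℝ → ℂ, ContDiff ℝ ∞ c ∧ HasCompactSupport c ∧ c 0 = 0 ∧
    ∀ t ∈ Icc 0 h, c =ᶠ[𝓝 t] fun t => (Real.sin (m * t) : ℂ) := by
  let η : ContDiffBump (h / 2) := ⟨h, 2 * h, hh, by linarith⟩
  refine ⟨fun t => (Real.sin (m * t) : ℂ) * (η t : ℂ),
    (ofRealCLM.contDiff.comp (Real.contDiff_sin.comp (contDiff_const.mul contDiff_id))).mul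
      (ofRealCLM.contDiff.comp η.contDiff), ?_, by simp, fun t ht => ?_⟩
  · exact (η.hasCompactSupport.comp_left ofReal_zero).mul_left
  · have h1 : t ∈ Metric.ball (h / 2) η.rIn := by
      rw [Metric.mem_ball, Real.dist_eq]
      exact abs_lt.2 ⟨by change -h < _; linarith [ht.1], by change _ < h; linarith [ht.2]⟩
    filter_upwards [η.eventuallyEq_one_of_mem_ball h1] with z hz
    simp only [hz, Pi.one_apply, ofReal_one, mul_one]

omit hu in
lemma isTestFunction_mul {n : ℕ} {χ c : ℝ → ℂ} (hχ : ContDiff ℝ ∞ χ) (hχs : HasCompactSupport χ)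
    (hc : ContDiff ℝ ∞ c) (hcs : HasCompactSupport c) (hc0 : c 0 = 0)
    (hch : c =ᶠ[𝓝 h] fun t => (Real.sin (cutoff h n * t) : ℂ)) :
    IsTestFunction h fun x => χ x.1 * c x.2 := by
  refine ⟨(hχ.comp contDiff_fst).mul (hc.comp contDiff_snd), ?_, fun s => by simp [hc0], ?_⟩
  · refine HasCompactSupport.intro (hχs.isCompact.prod hcs.isCompact) fun x hx => ?_
    by_cases hx1 : x.1 ∈ tsupport χ
    · rw [image_eq_zero_of_notMem_tsupport fun h' => hx ⟨hx1, h'⟩, mul_zero]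
    · rw [image_eq_zero_of_notMem_tsupport hx1, zero_mul]
  · intro s
    have h1 : (fun t => χ s * c t) =ᶠ[𝓝 h] fun t => χ s * (Real.sin (cutoff h n * t) : ℂ) := by
      filter_upwards [hch] with t ht
      rw [ht]
    rw [h1.deriv_eq, ((hasDerivAt_sin_mul (cutoff h n) h).const_mul (χ s)).deriv,
      cos_cutoff_mul hh n]
    simp

omit hh hu in
lemma laplacian_mul {m : ℝ} {χ c : ℝ → ℂ} (hχ : ContDiff ℝ ∞ χ) {x : ℝ × ℝ}
    (hc : c =ᶠ[𝓝 x.2] fun t => (Real.sin (m * t) : ℂ)) :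
    laplacian (fun x => χ x.1 * c x.2) x =
      (iteratedDeriv 2 χ x.1 - (m : ℂ) ^ 2 * χ x.1) * (Real.sin (m * x.2) : ℂ) := by
  obtain ⟨d1, d2, -⟩ := hasDerivAt_of_contDiff hχ
  have e1 : iteratedDeriv 2 (fun s : ℝ => χ s * c x.2) x.1 = iteratedDeriv 2 χ x.1 * c x.2 :=
    iteratedDeriv_two_eq (fun s => (d1 s).mul_const _) (fun s => (d2 s).mul_const _) x.1
  have e2 : iteratedDeriv 2 (fun t : ℝ => χ x.1 * c t) x.2 =
      χ x.1 * ((-m ^ 2 * Real.sin (m * x.2) : ℝ) : ℂ) := by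
    have h1 : (fun t => χ x.1 * c t) =ᶠ[𝓝 x.2] fun t => χ x.1 * (Real.sin (m * t) : ℂ) := by
      filter_upwards [hc] with t ht
      rw [ht]
    rw [h1.iteratedDeriv_eq]
    exact iteratedDeriv_two_eq (fun t => (hasDerivAt_sin_mul m t).const_mul _)
      (fun t => (hasDerivAt_cos_mul m t).const_mul _) x.2
  have e3 : c x.2 = (Real.sin (m * x.2) : ℂ) := hc.eq_of_nhds
  rw [laplacian, e1, e2, e3]
  push_cast
  ring

lemma integral_strip_mul (n : ℕ) {θ : ℝ → ℂ} (hθ : Continuous θ) (hs : HasCompactSupport θ) :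
    ∫ x in strip h, u x * (Real.sin (cutoff h n * x.2) : ℂ) * θ x.1 =
      (h / 2 : ℂ) * ∫ s, modeCoeff h u n s * θ s := by
  rw [strip_eq_prod, Measure.volume_eq_prod, setIntegral_prod, setIntegral_univ,
    ← integral_const_mul]
  · congr 1
    funext s
    dsimp only
    rw [integral_mul_const, modeCoeff_eq hh, integral_Icc_eq_integral_Ioo]
    have : (h : ℂ) ≠ 0 := ofReal_ne_zero.2 hh.ne'
    field_simp
  · obtain ⟨R, hR⟩ := hs.isCompact.isBounded.subset_closedBall 0
    rw [← Measure.volume_eq_prod]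
    have h1 : IntegrableOn (fun x : ℝ × ℝ => u x * (Real.sin (cutoff h n * x.2) : ℂ) * θ x.1)
        (Icc (-R) R ×ˢ Icc 0 h) :=
      ((hu.integrable R).mul_continuousOn (by fun_prop)
        (isCompact_Icc.prod isCompact_Icc)).mul_continuousOn (by fun_prop)
        (isCompact_Icc.prod isCompact_Icc)
    refine h1.of_forall_sdiff_eq_zero (MeasurableSet.univ.prod measurableSet_Ioo) fun x hx => ?_
    have hx1 : x.1 ∉ tsupport θ := fun h' => by
      have h2 := hR h'
      rw [mem_closedBall_zero_iff, Real.norm_eq_abs] at h2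
      exact hx.2 ⟨abs_le.1 h2, Ioo_subset_Icc_self hx.1.2⟩
    rw [image_eq_zero_of_notMem_tsupport hx1, mul_zero]

include hk in
-- Separation of variables in weak form: `χ(x₁) sin(μₙx₂)` satisfies both wall conditions, and `Δ +
-- k²` acts on it as `χ'' + ξₙ²χ` times the sine.
lemma integral_modeCoeff_mul (hy : y ∈ strip h) (n : ℕ) {χ : ℝ → ℂ} (hχ : ContDiff ℝ ∞ χ)
    (hs : HasCompactSupport χ) :
    ∫ s, modeCoeff h u n s * (iteratedDeriv 2 χ s + axialWaveNumber k h n ^ 2 * χ s) =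
      -(2 / h : ℂ) * Real.sin (cutoff h n * y.2) * χ y.1 := by
  obtain ⟨c, hc, hcs, hc0, hce⟩ := exists_cutoff_sin hh (cutoff h n)
  obtain ⟨-, -, c2⟩ := hasDerivAt_of_contDiff hχ
  have hθ : Continuous fun s => iteratedDeriv 2 χ s + axialWaveNumber k h n ^ 2 * χ s :=
    c2.add (continuous_const.mul hχ.continuous)
  have hθs : HasCompactSupport fun s => iteratedDeriv 2 χ s + axialWaveNumber k h n ^ 2 * χ s :=
    HasCompactSupport.intro hs.isCompact fun s hs => by
      obtain ⟨z1, -, z2⟩ := deriv_eq_zero_of_notMem_tsupport hs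
      rw [z1, z2, mul_zero, add_zero]
  have heq := hu.equation _ (isTestFunction_mul hh hχ hs hc hcs hc0 (hce h ⟨hh.le, le_rfl⟩))
  rw [setIntegral_congr_fun isOpen_strip.measurableSet
    (g := fun x => u x * (Real.sin (cutoff h n * x.2) : ℂ) *
      (iteratedDeriv 2 χ x.1 + axialWaveNumber k h n ^ 2 * χ x.1)) fun x hx => ?_,
    integral_strip_mul hh hu n hθ hθs, (hce y.2 ⟨hy.1.le, hy.2.le⟩).eq_of_nhds] at heq
  · have hhc : (h : ℂ) ≠ 0 := ofReal_ne_zero.2 hh.ne'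
    generalize ∫ s, modeCoeff h u n s * (iteratedDeriv 2 χ s + axialWaveNumber k h n ^ 2 * χ s)
      = Z at heq ⊢
    field_simp
    linear_combination 2 * heq
  · have hx2 := hce x.2 ⟨hx.1.le, hx.2.le⟩
    simp only [laplacian_mul hχ hx2, hx2.eq_of_nhds, axialWaveNumber_sq k h hk hh n]
    ring

omit hh hu in
lemma continuous_greenMode (n : ℕ) : Continuous (greenMode k h y n) := by
  unfold greenMode; fun_prop

include hk in
-- `greenMode` has the same point source, so the difference solves the homogeneous equation weakly.
-- Equality almost everywhere becomes equality off `y₁`, where both sides are continuous.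
lemma exists_modeCoeff_eq (hkn : ∀ n : ℕ, k ≠ cutoff h n) (hy : y ∈ strip h) (n : ℕ) :
    ∃ A B : ℂ, ∀ s, s ≠ y.1 → modeCoeff h u n s = greenMode k h y n s +
      (A * cexp (I * axialWaveNumber k h n * s) + B * cexp (-(I * axialWaveNumber k h n) * s)) := by
  set ξ := axialWaveNumber k h n with hξ
  have hξ0 : ξ ≠ 0 := axialWaveNumber_ne_zero hk hh (hkn n)
  have hl1 := locallyIntegrable_modeCoeff hh hu n
  have hl2 : LocallyIntegrable (greenMode k h y n) := (continuous_greenMode n).locallyIntegrable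
  obtain ⟨A, B, hAB⟩ := exists_ae_eq_of_weak_solution hξ0 (hl1.sub hl2) fun χ hχ hχs => by
    obtain ⟨-, -, c2⟩ := hasDerivAt_of_contDiff hχ
    have hθ : Continuous fun s => iteratedDeriv 2 χ s + ξ ^ 2 * χ s := by
      have := hχ.continuous
      fun_prop
    have hθs : HasCompactSupport fun s => iteratedDeriv 2 χ s + ξ ^ 2 * χ s :=
      HasCompactSupport.intro hχs.isCompact fun s hs => by
        obtain ⟨z1, -, z2⟩ := deriv_eq_zero_of_notMem_tsupport hs
        rw [z1, z2, mul_zero, add_zero]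
    simp only [Pi.sub_apply, sub_mul]
    rw [integral_sub (integrable_mul_test hl1 hθ hθs) (integrable_mul_test hl2 hθ hθs),
      integral_modeCoeff_mul hk hh hu hy n hχ hχs]
    simp only [greenMode, mul_assoc, ← hξ]
    rw [integral_const_mul, integral_const_mul]
    simp only [← mul_assoc]
    rw [integral_cexp_abs_mul y.1 hχ hχs]
    have hhc : (h : ℂ) ≠ 0 := ofReal_ne_zero.2 hh.ne'
    field_simp
    rw [I_sq]
    ring
  refine ⟨A, B, fun s hs => ?_⟩
  have hU : IsOpen ({y.1}ᶜ : Set ℝ) := isOpen_compl_singleton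
  have h1 := Measure.eqOn_open_of_ae_eq (μ := volume) (U := ({y.1}ᶜ : Set ℝ))
    (f := modeCoeff h u n - greenMode k h y n)
    (g := fun s : ℝ => A * cexp (I * ξ * s) + B * cexp (-(I * ξ) * s))
    (ae_restrict_of_ae hAB) hU
    (fun s hs => ((continuousAt_modeCoeff hh hu n hs).sub
      (continuous_greenMode n).continuousAt).continuousWithinAt)
    (Continuous.continuousOn (by fun_prop)) (x := s) hs
  simp only [Pi.sub_apply] at h1
  linear_combination h1

/-! ### Uniqueness of the modes under the radiation condition -/

omit hh hu in
lemma eq_zero_of_tendsto_mul_cexp {c b : ℂ} {l : Filter ℝ} [l.NeBot]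
    (h : Tendsto (fun s : ℝ => c * cexp (b * s)) l (𝓝 0)) (hb : ∀ᶠ s : ℝ in l, 0 ≤ b.re * s) :
    c = 0 := by
  have h1 := h.norm
  rw [norm_zero] at h1
  refine norm_le_zero_iff.1 (ge_of_tendsto h1 ?_)
  filter_upwards [hb] with s hs
  rw [norm_mul, norm_exp, re_mul_ofReal]
  exact le_mul_of_one_le_right (norm_nonneg _) (Real.one_le_exp hs)

include hk in
/-- The modes of the Green function are determined by its equation and the radiation condition. -/
lemma modeCoeff_eq_greenMode (hkn : ∀ n : ℕ, k ≠ cutoff h n) (hy : y ∈ strip h) (n : ℕ)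
    {s : ℝ} (hs : s ≠ y.1) : modeCoeff h u n s = greenMode k h y n s := by
  obtain ⟨A, B, hAB⟩ := exists_modeCoeff_eq hk hh hu hkn hy n
  set ξ := axialWaveNumber k h n with hξ
  have hξ0 : ξ ≠ 0 := axialWaveNumber_ne_zero hk hh (hkn n)
  have him : 0 ≤ ξ.im := axialWaveNumber_im_nonneg k h n
  obtain ⟨hr1, hr2⟩ := hu.radiating n
  set c₀ : ℂ := I / (h * ξ) * Real.sin (cutoff h n * y.2) with hc₀
  -- To the right of the source the operator `∂ - iξ` annihilates `exp(iξs)` and leaves `-2iξB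
  -- exp(-iξs)`. Its modulus does not decay because `Im ξ ≥ 0`, so the coefficient is zero. The left
  -- side treats `A` in the same way.
  have hB : -2 * (I * ξ) * B = 0 := by
    refine eq_zero_of_tendsto_mul_cexp (l := atTop) (b := -(I * ξ)) (hr1.congr' ?_) ?_
    · filter_upwards [eventually_gt_atTop y.1] with s hs
      have e : modeCoeff h u n =ᶠ[𝓝 s] fun s : ℝ =>
          (c₀ * cexp (-(I * ξ) * y.1) + A) * cexp (I * ξ * s) + B * cexp (-(I * ξ) * s) := by
        filter_upwards [eventually_gt_nhds hs] with z hz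
        rw [hAB z hz.ne', greenMode, ← hξ, ← hc₀, abs_of_pos (sub_pos.2 hz),
          show I * ξ * ((z - y.1 : ℝ) : ℂ) = I * ξ * z + -(I * ξ) * y.1 by push_cast; ring,
          Complex.exp_add]
        ring
      rw [e.deriv_eq, e.eq_of_nhds, (((hasDerivAt_cexp_mul (I * ξ) s).const_mul _).fun_add
        ((hasDerivAt_cexp_mul (-(I * ξ)) s).const_mul B)).deriv]
      ring
    · filter_upwards [eventually_ge_atTop 0] with s hs
      simp
      positivity
  have hA : -2 * (I * ξ) * A = 0 := by
    refine eq_zero_of_tendsto_mul_cexp (l := atBot) (b := I * ξ) (hr2.congr' ?_) ?_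
    · filter_upwards [eventually_lt_atBot y.1] with s hs
      have e : modeCoeff h u n =ᶠ[𝓝 s] fun s : ℝ =>
          A * cexp (I * ξ * s) + (c₀ * cexp (I * ξ * y.1) + B) * cexp (-(I * ξ) * s) := by
        filter_upwards [eventually_lt_nhds hs] with z hz
        rw [hAB z hz.ne, greenMode, ← hξ, ← hc₀, abs_of_neg (sub_neg.2 hz),
          show I * ξ * ((-(z - y.1) : ℝ) : ℂ) = I * ξ * y.1 + -(I * ξ) * z by push_cast; ring,
          Complex.exp_add]
        ring
      rw [e.deriv_eq, e.eq_of_nhds, (((hasDerivAt_cexp_mul (I * ξ) s).const_mul A).fun_add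
        ((hasDerivAt_cexp_mul (-(I * ξ)) s).const_mul _)).deriv]
      ring
    · filter_upwards [eventually_le_atBot 0] with s hs
      simp
      exact mul_nonpos_of_nonneg_of_nonpos him hs
  have h2 : -2 * (I * ξ) ≠ 0 := mul_ne_zero (by norm_num) (mul_ne_zero I_ne_zero hξ0)
  rw [hAB s hs, (mul_eq_zero.1 hA).resolve_left h2, (mul_eq_zero.1 hB).resolve_left h2]
  ring

/-! ### Identification of the Green function with `S + G` -/

omit hh in
lemma continuousAt_of_isWaveguideGreen {x : ℝ × ℝ} (hx : x ∈ strip h) (hxy : x ≠ y) :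
    ContinuousAt u x := by
  refine hu.continuous_off_source.continuousAt ?_
  filter_upwards [isOpen_strip.mem_nhds hx, isOpen_compl_singleton.mem_nhds hxy] with z h1 h2
  exact ⟨⟨h1.1.le, h1.2.le⟩, h2⟩

include hk in
/-- The Green function of the waveguide is `S + G`. -/
lemma eq_modelGreen (hkh : 1 ≤ k * h) (hkn : ∀ n : ℕ, k ≠ cutoff h n) (hy : y ∈ strip h)
    {x : ℝ × ℝ} (hx : x ∈ strip h) (hxy : x ≠ y) : u x = modelGreen k h y x := by
  have hc := cos_ne_zero_of_ne_cutoff hk hh hkn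
  -- On a cross-section that misses the source all modes agree; completeness gives equality almost
  -- everywhere and continuity gives it everywhere. The cross-section through the source is reached
  -- at the end as a limit `s → y₁`.
  have main : ∀ s, s ≠ y.1 → ∀ t ∈ Ioo 0 h, u (s, t) = modelGreen k h y (s, t) := by
    intro s hs
    have hne : ∀ t, ((s, t) : ℝ × ℝ) ≠ y := fun t h' => hs (by rw [← h'])
    have hi1 : IntegrableOn (fun t => u (s, t)) (Ioc 0 h) := by
      have : ContinuousOn (fun t => u (s, t)) (Icc 0 h) :=
        hu.continuous_off_source.comp (by fun_prop) fun t ht => ⟨ht, hne t⟩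
      exact this.integrableOn_Icc.mono_set Ioc_subset_Icc_self
    have hi2 := intervalIntegrable_modelGreen hk hh hkh hc hy s
    have hii : ∀ n : ℕ, ∀ w : ℝ → ℂ, IntegrableOn w (Ioc 0 h) →
        IntervalIntegrable (fun t => w t * (Real.sin (cutoff h n * t) : ℂ)) volume 0 h :=
      fun n w hw => ((intervalIntegrable_iff_integrableOn_Ioc_of_le hh.le).2 hw).mul_continuousOn
        (by fun_prop)
    have h0 := ae_eq_zero_of_modes_eq_zero hh (hi1.sub hi2) fun n => by
      have e1 := modeCoeff_eq_greenMode hk hh hu hkn hy n hs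
      rw [← modeCoeff_modelGreen hk hh hkh hkn hy n s, modeCoeff, modeCoeff] at e1
      have h2 : (2 / h : ℂ) ≠ 0 := div_ne_zero two_ne_zero (ofReal_ne_zero.2 hh.ne')
      have e2 := mul_left_cancel₀ h2 e1
      simp only [Pi.sub_apply, sub_mul]
      rw [intervalIntegral.integral_sub (hii n _ hi1) (hii n _ hi2), e2, sub_self]
    have h1 : (fun t => u (s, t)) =ᵐ[volume.restrict (Ioo 0 h)] fun t => modelGreen k h y (s, t) := by
      refine (ae_restrict_iff' measurableSet_Ioo).2 ?_
      filter_upwards [h0] with t ht hmem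
      exact sub_eq_zero.1 (ht hmem)
    have hcs : ∀ (w : ℝ × ℝ → ℂ), (∀ x ∈ strip h, x ≠ y → ContinuousAt w x) →
        ContinuousOn (fun t => w (s, t)) (Ioo 0 h) := fun w hw t ht =>
      (ContinuousAt.comp (f := fun t : ℝ => (s, t)) (hw (s, t) ht (hne t))
        (by fun_prop)).continuousWithinAt
    exact fun t ht => Measure.eqOn_open_of_ae_eq h1 isOpen_Ioo
      (hcs u fun x hx hxy => continuousAt_of_isWaveguideGreen hu hx hxy)
      (hcs _ fun x hx hxy => continuousAt_modelGreen hk hh hc hy hx hxy) ht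
  by_cases hx1 : x.1 = y.1
  · have hl : ∀ w : ℝ × ℝ → ℂ, ContinuousAt w x →
        Tendsto (fun s : ℝ => w (s, x.2)) (𝓝[≠] x.1) (𝓝 (w x)) := fun w hw => by
      have : ContinuousAt (fun s : ℝ => w (s, x.2)) x.1 :=
        ContinuousAt.comp (f := fun s : ℝ => (s, x.2)) hw (by fun_prop)
      exact this.tendsto.mono_left nhdsWithin_le_nhds
    refine tendsto_nhds_unique_of_eventuallyEq
      (hl u (continuousAt_of_isWaveguideGreen hu hx hxy))
      (hl _ (continuousAt_modelGreen hk hh hc hy hx hxy)) ?_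
    filter_upwards [self_mem_nhdsWithin] with s hs
    exact main s (by rw [← hx1]; exact hs) x.2 hx
  · exact main x.1 hx1 x.2 hx

end green

lemma boundIntegral_nonneg (c₁ c₂ : ℝ) : 0 ≤ boundIntegral c₁ c₂ :=
  integral_nonneg fun u => by positivity

end Waveguide
end

/-! ### The theorem -/

theorem theorem4p2 (c₁ c₂ : ℝ) (hc₁ : c₁ ∈ Set.Ioo (0 : ℝ) 1) (hc₂ : 0 < c₂) :
    ∃ C : ℝ, 0 < C ∧
      ∀ (k h d c₀ : ℝ) (Ω : Set (ℝ × ℝ)) (N : ℝ × ℝ → ℝ × ℝ → ℂ),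
        0 < k → 0 < h → 0 < d → c₀ ∈ Set.Ioo (0 : ℝ) 1 →
        Real.pi / 2 < k * h →
        (∀ n : ℕ, k ≠ Waveguide.cutoff h n) →
        Waveguide.CondOmega k h d c₀ c₁ c₂ Ω →
        (∀ y ∈ Waveguide.strip h, Waveguide.IsWaveguideGreen k h y (fun x => N x y)) →
        ∃ S : ℝ × ℝ → ℝ × ℝ → ℂ,
          (∀ y ∈ Waveguide.strip h,
            ContDiffOn ℝ 1 (fun x => S x y) (Waveguide.strip h) ∧
            ∀ x ∈ Waveguide.strip h, x ≠ y →
              S x y = N x y - Waveguide.halfSpaceGreen k x y) ∧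
          ∀ x ∈ Ω, ∀ y ∈ Ω,
            ‖S x y‖ ≤ C / (|Real.cos (k * h)| * √(k * h)) ∧
            Waveguide.gradNorm (fun z => S z y) x ≤
              C * k / (|Real.cos (k * h)| * √(k * h)) := by
  have hB := Waveguide.boundIntegral_nonneg c₁ c₂
  -- The gradient needs `8 = 2 · 4`: the kernel bound carries `4` and the two partial derivatives a
  -- factor `2`. The summand `1` only makes the constant visibly positive.
  refine ⟨8 * Waveguide.boundIntegral c₁ c₂ + 1, by linarith, ?_⟩
  intro k h d c₀ Ω N hk hh _ _ hkh hkn hΩ hN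
  have hkh1 : 1 ≤ k * h := by linarith [Real.pi_gt_three]
  have hc := Waveguide.cos_ne_zero_of_ne_cutoff hk hh hkn
  refine ⟨fun x y => Waveguide.regPart k h x y, fun y hy =>
    ⟨Waveguide.contDiffOn_regPart hk hh hc hy, fun x hx hxy => ?_⟩, fun x hx y hy => ?_⟩
  · rw [Waveguide.eq_modelGreen hk hh (hN y hy) hkh1 hkn hy hx hxy, Waveguide.modelGreen]
    ring
  · have hxs : x ∈ Waveguide.strip h := (hΩ.subset hx).2
    have hys : y ∈ Waveguide.strip h := (hΩ.subset hy).2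
    have hx2 := (le_abs_self _).trans (hΩ.vertical x hx)
    have hy2 := (le_abs_self _).trans (hΩ.vertical y hy)
    have hw := hΩ.width x hx y hy
    have hden : 0 < |Real.cos (k * h)| * √(k * h) :=
      mul_pos (abs_pos.2 hc) (Real.sqrt_pos.2 (by linarith))
    constructor
    · refine (Waveguide.norm_regPart_le hk hkh1 hw hx2 hy2 hc₁.2 hc hxs hys).trans ?_
      gcongr
      linarith
    · refine (Waveguide.gradNorm_regPart_le hk hkh1 hw hx2 hy2 hc₁.2 hc hxs hys).trans ?_
      rw [mul_div_assoc', mul_div_assoc']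
      refine div_le_div_of_nonneg_right ?_ hden.le
      nlinarith
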